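/- **Setting.** Let $N\ge 2$, let $\Omega\subset\mathbb R^N$ be open and bounded, and let $X=(X_1,\dots,X_m)$ be locally Lipschitz vector fields on $\mathbb R^N$. Write $Xu=(X_1u,\dots,X_mu)$. Let $D=\Omega$ or $D=\mathbb R^N$. An absolutely continuous path $\gamma:[0,T]\to D$ is *$X$-subunit* if for a.e. $t$ one has $\dot\gamma(t)=\sum_j\theta_jX_j(\gamma(t))$ for some $\theta$ with $\sum_j\theta_j^2\le1$. Let $d_X(x,y)$ be the infimum of the $T>0$ for which some $X$-subunit path $\gamma:[0,T]\to D$ joins $x$ to $y$, and let $B_r(x)=\{y\in D: d_X(x,y)<r\}$. Assume, for some $Q>2$: - any two points of $D$ are joined by an $X$-subunit path in $D$; - for $x\in D$, $d_X(x,y)\to0$ as $y\to x$ in $D$; - $0<|B_{2r}(x)|\le 2^Q|B_r(x)|$ for all $x\in D$, $r>0$; - there are $C_P,\nu>0$ such that, for all balls $B_r=B_r(x)$ with $x\in D$, $r>0$, and all $u$ of class $C^1$ in a neighbourhood of $\overline{B_{\nu r}}$ (with $u$ integrable on $B_r$ and $Xu$ integrable on $B_{\nu r}$), $\frac1{|B_r|}\int_{B_r}|u-u_r|\le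 \frac{C_P\,r}{|B_{\nu r}|}\int_{B_{\nu r}}|Xu|$, where $u_r=\frac1{|B_r|}\int_{B_r}u$. Let $A$ be a measurable $m\times m$ matrix function such that, for some $0<\alpha<\beta$, $A(x)\eta\cdot\eta\ge\alpha|\eta|^2$ and $|A(x)\eta|\le\beta|\eta|$ for all $x\in\Omega$, $\eta\in\mathbb R^m$. Let $W^{1,2}_0(\Omega,X)$ be the closure of $C_c^\infty(\Omega)$ for $\|Xu\|_{L^2(\Omega)}$: the functions $u\in L^2(\Omega)$, with $X$-gradient $Xu\in L^2(\Omega)^m$, for which there are $\varphi_n\in C^\infty_c(\Omega)$ with $\varphi_n\to u$ and $X\varphi_n\to Xu$ in $L^2(\Omega)$. For a matrix function $M$, a *weak solution* of $X^*(M\,Xu)=h$ in $\Omega$, $u=0$ on $\partial\Omega$, is a $u\in W^{1,2}_0(\Omega,X)$ with $\int_\Omega M\,Xu\cdot Xv=\int_\Omega hv$ for all $v\in W_0^{1,2}(\Omega,X)$. Let $f\in L^1(\Omega)$. - A *duality solution* of $X^*(A\,Xu)=f$ in $\Omega$, $u=0$ on $\partial\Omega$, is a $u\in L^1(\Omega)$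 with $\int_\Omega gu=\int_\Omega fv$ for all $g\in L^\infty(\Omega)$, where $v\in L^\infty(\Omega)$ is the weak solution of the adjoint problem $X^*(A^TXv)=g$ in $\Omega$, $v=0$ on $\partial\Omega$. - A sequence $f_n\in L^{2Q/(Q+2)}(\Omega)$ is *approximating* if $f_n\to f$ in $L^1(\Omega)$. A *solution found by approximation* is a $u\in L^1(\Omega)$ which, for some approximating sequence $(f_n)$, is the $L^1(\Omega)$-limit of weak solutions $u_n$ of $X^*(A\,Xu_n)=f_n$ in $\Omega$, $u_n=0$ on $\partial\Omega$. **Theorem.** For every $g\in L^\infty(\Omega)$ the adjoint problem has a weak solution, it is unique up to null sets, and it belongs to $L^\infty(\Omega)$. There is a duality solution $u$ with datum $f$; it is unique up to null sets, and $u\in L^q(\Omega)$ for every $q<\frac{Q}{Q-2}$. A function is a solution found by approximation with datum $f$ if and only if it equals $u$ almost everywhere. Moreover, for every approximating sequence $(f_n)$, weak solutions $u_n$ with data $f_n$ exist, and any such $u_n$ converge to $u$ in $L^q(\Omega)$ for every $q<\frac Q{Q-2}$. -/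

import Mathlib

open MeasureTheory Filter Topology Matrix Set
open scoped ENNReal ContDiff

noncomputable section

namespace XElliptic

/-- A vector field on `ℝ^N` is identified with a map from `ℝ^N` to `ℝ^N`; a family of `m` vector
fields is indexed by `Fin m`. -/
abbrev VectorFields (N m : ℕ) : Type :=
  Fin m → EuclideanSpace ℝ (Fin N) → EuclideanSpace ℝ (Fin N)

variable {N m : ℕ}

/-- The `X`-gradient `X u = (X_1 u, …, X_m u)` of a differentiable function: `X_j u (x)` is the
derivative of `u` at `x` in the direction `X_j(x)`. -/
def xGrad (X : VectorFields N m) (u : EuclideanSpace ℝ (Fin N) → ℝ)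
    (x : EuclideanSpace ℝ (Fin N)) : EuclideanSpace ℝ (Fin m) :=
  WithLp.toLp 2 fun j => fderiv ℝ u x (X j x)

/-! Control distance -/

/-- `γ` restricted to `[0, T]` is an `X`-subunit path in `D`: it is absolutely continuous, takes
its values in `D`, and for almost every `t` one has `γ'(t) = ∑ θ_j X_j(γ(t))` for some
coefficients with `∑ θ_j ^ 2 ≤ 1`. -/
def IsSubunitPath (X : VectorFields N m) (D : Set (EuclideanSpace ℝ (Fin N))) (T : ℝ)
    (γ : ℝ → EuclideanSpace ℝ (Fin N)) : Prop :=
  AbsolutelyContinuousOnInterval γ 0 T ∧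
  (∀ t ∈ Icc 0 T, γ t ∈ D) ∧
  ∀ᵐ t ∂(volume.restrict (Icc 0 T)),
    ∃ θ : Fin m → ℝ, ∑ j, θ j ^ 2 ≤ 1 ∧ HasDerivAt γ (∑ j, θ j • X j (γ t)) t

/-- The set of times `T > 0` in which `y` can be reached from `x` along an `X`-subunit path
in `D`. -/
def travelTimes (X : VectorFields N m) (D : Set (EuclideanSpace ℝ (Fin N)))
    (x y : EuclideanSpace ℝ (Fin N)) : Set ℝ :=
  {T | 0 < T ∧ ∃ γ : ℝ → EuclideanSpace ℝ (Fin N), IsSubunitPath X D T γ ∧ γ 0 = x ∧ γ T = y}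

/-- Any two points of `D` are joined by an `X`-subunit path in `D`. -/
def IsXConnected (X : VectorFields N m) (D : Set (EuclideanSpace ℝ (Fin N))) : Prop :=
  ∀ x ∈ D, ∀ y ∈ D, (travelTimes X D x y).Nonempty

/-- The control (Carnot–Carathéodory) distance of `D`. -/
def ccDist (X : VectorFields N m) (D : Set (EuclideanSpace ℝ (Fin N)))
    (x y : EuclideanSpace ℝ (Fin N)) : ℝ :=
  sInf (travelTimes X D x y)

/-- The balls of the metric space `(D, d_X)`. -/
def ccBall (X : VectorFields N m) (D : Set (EuclideanSpace ℝ (Fin N)))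
    (x : EuclideanSpace ℝ (Fin N)) (r : ℝ) : Set (EuclideanSpace ℝ (Fin N)) :=
  {y | y ∈ D ∧ ccDist X D x y < r}

/-- Doubling condition, with exponent `Q`, for `(D, d_X)` with the Lebesgue measure. -/
def IsDoubling (X : VectorFields N m) (D : Set (EuclideanSpace ℝ (Fin N))) (Q : ℝ) : Prop :=
  ∀ x ∈ D, ∀ r : ℝ, 0 < r →
    0 < volume (ccBall X D x (2 * r)) ∧
    volume (ccBall X D x (2 * r)) ≤ ENNReal.ofReal (2 ^ Q) * volume (ccBall X D x r)

/-- The Poincaré inequality on `d_X`-balls, for functions of class `C^1` up to the closure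
of the larger ball. The two integrability requirements are automatic for `1 ≤ ν` when that closure
is compact; they make sure that the inequality is between honest averages. -/
def HasPoincare (X : VectorFields N m) (D : Set (EuclideanSpace ℝ (Fin N)))
    (C ν : ℝ) : Prop :=
  ∀ x ∈ D, ∀ r : ℝ, 0 < r → ∀ u : EuclideanSpace ℝ (Fin N) → ℝ,
    (∃ U, IsOpen U ∧ closure (ccBall X D x (ν * r)) ⊆ U ∧ ContDiffOn ℝ 1 u U) →
    IntegrableOn u (ccBall X D x r) →
    IntegrableOn (xGrad X u) (ccBall X D x (ν * r)) →
    (⨍ y in ccBall X D x r, |u y - ⨍ z in ccBall X D x r, u z|) ≤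
      C * r * ⨍ y in ccBall X D x (ν * r), ‖xGrad X u y‖

/-- The standing geometric assumptions on the vector fields, on the open set `D`:
`D` is `X`-connected, Euclidean convergence implies convergence in `d_X`, the metric measure space
`(D, d_X, Lebesgue)` is doubling with exponent `Q`, and it supports a Poincaré inequality. -/
structure GeometricAssumptions (X : VectorFields N m) (D : Set (EuclideanSpace ℝ (Fin N)))
    (Q : ℝ) : Prop where
  connected : IsXConnected X D
  continuous_dist : ∀ x ∈ D, Tendsto (fun y => ccDist X D x y) (𝓝[D] x) (𝓝 0)
  doubling : IsDoubling X D Q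
  poincare : ∃ C ν : ℝ, 0 < C ∧ 0 < ν ∧ HasPoincare X D C ν

/-! Sobolev spaces and weak solutions -/

/-- `u` belongs to `W_0^{1,p}(Ω, X)` and `G` is its `X`-gradient: `u` is a limit of functions
`φ_n ∈ C_c^∞(Ω)` whose `X`-gradients converge to `G` in `L^p(Ω)`. -/
def IsSobolevZero (X : VectorFields N m) (Ω : Set (EuclideanSpace ℝ (Fin N))) (p : ℝ≥0∞)
    (u : EuclideanSpace ℝ (Fin N) → ℝ)
    (G : EuclideanSpace ℝ (Fin N) → EuclideanSpace ℝ (Fin m)) : Prop :=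
  MemLp u p (volume.restrict Ω) ∧ MemLp G p (volume.restrict Ω) ∧
  ∃ φ : ℕ → EuclideanSpace ℝ (Fin N) → ℝ,
    (∀ n, ContDiff ℝ ∞ (φ n) ∧ HasCompactSupport (φ n) ∧ tsupport (φ n) ⊆ Ω) ∧
    Tendsto (fun n => eLpNorm (φ n - u) p (volume.restrict Ω)) atTop (𝓝 0) ∧
    Tendsto (fun n => eLpNorm (xGrad X (φ n) - G) p (volume.restrict Ω)) atTop (𝓝 0)

/-- `u ∈ W_0^{1,2}(Ω, X)` is a weak solution of `X^*(A X u) = f` in `Ω`, `u = 0` on `∂Ω`: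
`∫_Ω A X u · X v = ∫_Ω f v` for all `v ∈ W_0^{1,2}(Ω, X)`. -/
def IsWeakSolution (X : VectorFields N m) (Ω : Set (EuclideanSpace ℝ (Fin N)))
    (A : EuclideanSpace ℝ (Fin N) → Matrix (Fin m) (Fin m) ℝ)
    (f u : EuclideanSpace ℝ (Fin N) → ℝ) : Prop :=
  ∃ G, IsSobolevZero X Ω 2 u G ∧
    ∀ v H, IsSobolevZero X Ω 2 v H →
      ∫ x in Ω, (A x *ᵥ (G x).ofLp) ⬝ᵥ (H x).ofLp = ∫ x in Ω, f x * v x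

/-- `u ∈ L^1(Ω)` is a duality solution with datum `f`: `∫_Ω g u = ∫_Ω f v` for every
`g ∈ L^∞(Ω)`, where `v ∈ L^∞(Ω)` is the weak solution of the adjoint problem
`X^*(A^T X v) = g` in `Ω`, `v = 0` on `∂Ω`. -/
def IsDualitySolution (X : VectorFields N m) (Ω : Set (EuclideanSpace ℝ (Fin N)))
    (A : EuclideanSpace ℝ (Fin N) → Matrix (Fin m) (Fin m) ℝ)
    (f u : EuclideanSpace ℝ (Fin N) → ℝ) : Prop :=
  MemLp u 1 (volume.restrict Ω) ∧
  ∀ g, MemLp g ∞ (volume.restrict Ω) →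
    ∀ v, MemLp v ∞ (volume.restrict Ω) → IsWeakSolution X Ω (fun x => (A x)ᵀ) g v →
      ∫ x in Ω, g x * u x = ∫ x in Ω, f x * v x

/-- `(f_n)` is an approximating sequence of `f`: each `f_n` belongs to `L^{2Q/(Q+2)}(Ω)`, and
`f_n → f` in `L^1(Ω)`. -/
def IsApproxData (Ω : Set (EuclideanSpace ℝ (Fin N))) (Q : ℝ)
    (f : EuclideanSpace ℝ (Fin N) → ℝ) (fs : ℕ → EuclideanSpace ℝ (Fin N) → ℝ) : Prop :=
  (∀ n, MemLp (fs n) (ENNReal.ofReal (2 * Q / (Q + 2))) (volume.restrict Ω)) ∧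
  Tendsto (fun n => eLpNorm (fs n - f) 1 (volume.restrict Ω)) atTop (𝓝 0)

/-- `u` is a solution found by approximation with datum `f`: it is the limit in `L^1(Ω)` of weak
solutions `u_n` whose data `f_n` form an approximating sequence of `f`. -/
def IsSolutionByApproximation (X : VectorFields N m) (Ω : Set (EuclideanSpace ℝ (Fin N)))
    (A : EuclideanSpace ℝ (Fin N) → Matrix (Fin m) (Fin m) ℝ) (Q : ℝ)
    (f u : EuclideanSpace ℝ (Fin N) → ℝ) : Prop :=
  MemLp u 1 (volume.restrict Ω) ∧
  ∃ fs us : ℕ → EuclideanSpace ℝ (Fin N) → ℝ,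
    IsApproxData Ω Q f fs ∧ (∀ n, IsWeakSolution X Ω A (fs n) (us n)) ∧
    Tendsto (fun n => eLpNorm (us n - u) 1 (volume.restrict Ω)) atTop (𝓝 0)

end XElliptic

end

/-! The geometry enters only through the Sobolev inequality `‖φ‖_{2Q/(Q-2)} ≤ C ‖Xφ‖_2` for test
functions on `Ω` (`GeometricAssumptions.hasSobolev`); the rest is Stampacchia's duality method.

Sobolev inequality. By the Poincaré inequality along balls shrinking to `x`, `|φ x|` is at most the
mean of `|φ|` over a large ball plus a sum of terms `r_i ⨍ |Xφ|`. Hedberg's interpolation between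
the maximal function and the Cauchy–Schwarz bound `r^{-Q/2} ‖Xφ‖_2` sums the series, and the `L^2`
bound for the maximal function concludes (`GeometricSetting.hasSobolev`). The mean over the large
ball needs the Friedrichs inequality `‖φ‖_1 ≤ C ‖Xφ‖_1`.

Friedrichs inequality. If `D` is the whole space, a ball of more than twice the volume of `Ω`
contains `Ω`, and the mean is absorbed. If `D = Ω`, nothing outside `Ω` is controlled, and the proof
is by contradiction. Finite volume and doubling make `Ω` a single ball. If the inequality fails,
then the constant `1` on `Ω` is an `L^1` limit of test functions with `X`-gradients tending to zero,
so fields parallel to the `X_j` have zero flux out of `Ω`. Hence the `X_j` are tangent, in the sense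
of Bony, to the support of Lebesgue measure on the complement (`HasZeroFlux.inner_eq_zero`). By a
Gronwall argument subunit paths then stay away from that support for bounded times, although bounded
times suffice to reach all of `Ω` (`GeometricSetting.not_hasZeroFlux`).

Duality. Lax–Milgram on the closed space of `X`-gradients solves the problems with data in
`L^{2Q/(Q+2)}`. Truncation and Stampacchia's iteration give `‖v‖_∞ ≤ K ‖g‖_p` for the adjoint
problem when `p > Q/2` (`exists_eLpNorm_top_le`). Dually, `‖u‖_q ≤ C ‖f‖_1` for every duality
solution and every `q < Q/(Q-2)` (`exists_eLpNorm_le_of_isDualitySolution`). Weak solutions are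
duality solutions and these may be subtracted, so uniqueness, existence by an `L^1` Cauchy sequence,
and convergence of all approximations follow from this one estimate. -/

noncomputable section

namespace XElliptic

section

variable {N m : ℕ} {X : VectorFields N m} {D : Set (EuclideanSpace ℝ (Fin N))}

/-! ### Subunit paths and the control distance -/

/-- An absolutely continuous path with velocity bounded by `M` is `M`-Lipschitz. -/
theorem norm_sub_le_of_ae_deriv_le {γ : ℝ → EuclideanSpace ℝ (Fin N)} {T M : ℝ}
    (hac : AbsolutelyContinuousOnInterval γ 0 T)
    (hder : ∀ᵐ t ∂(volume.restrict (Icc 0 T)), ∃ w, ‖w‖ ≤ M ∧ HasDerivAt γ w t)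
    {s t : ℝ} (hs : 0 ≤ s) (hst : s ≤ t) (ht : t ≤ T) : ‖γ t - γ s‖ ≤ M * (t - s) := by
  -- Pairing with the fixed vector `e` reduces the claim to a scalar function, whose fundamental
  -- theorem of calculus gives `‖e‖² ≤ ‖e‖ M (t - s)`.
  set e := γ t - γ s with he
  have hacf : AbsolutelyContinuousOnInterval (fun τ => inner ℝ e (γ τ)) s t := by
    have h1 := hac.mono (c := s) (d := t) (by
      rw [uIcc_of_le hst, uIcc_of_le (hs.trans (hst.trans ht))]; exact Icc_subset_Icc hs ht)
    unfold AbsolutelyContinuousOnInterval at h1 ⊢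
    refine squeeze_zero (fun E => Finset.sum_nonneg fun _ _ => dist_nonneg) (fun E => ?_)
      (by simpa using h1.const_mul ‖e‖)
    rw [Finset.mul_sum]
    refine Finset.sum_le_sum fun i _ => ?_
    rw [Real.dist_eq, ← inner_sub_right, dist_eq_norm]
    exact abs_real_inner_le_norm _ _
  have hftc := hacf.integral_deriv_eq_sub
  have hae : ∀ᵐ τ, τ ∈ Icc 0 T → ∃ w, ‖w‖ ≤ M ∧ HasDerivAt γ w τ :=
    (ae_restrict_iff' measurableSet_Icc).1 hder
  have hb : ‖∫ τ in s..t, deriv (fun τ => inner ℝ e (γ τ)) τ‖ ≤ (‖e‖ * M) * |t - s| := by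
    refine intervalIntegral.norm_integral_le_of_norm_le_const_ae ?_
    filter_upwards [hae] with τ hτ hm
    rw [uIoc_of_le hst] at hm
    obtain ⟨w, hw, hd⟩ := hτ ⟨hs.trans hm.1.le, hm.2.trans ht⟩
    have := ((hasDerivAt_const τ e).inner ℝ hd).deriv
    simp only [inner_zero_left, add_zero] at this
    rw [this]
    exact (abs_real_inner_le_norm _ _).trans (by gcongr)
  rw [hftc, ← inner_sub_right, ← he, real_inner_self_eq_norm_sq, abs_of_nonneg (by linarith),
    Real.norm_of_nonneg (by positivity)] at hb
  -- For `e = 0` the sign of `M` matters and is not assumed: if `s < t`, some time in `[0, T]`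
  -- carries a derivative of norm at most `M`, so `M ≥ 0`.
  rcases (norm_nonneg e).eq_or_lt with h0 | h0
  · rw [← h0]
    rcases hst.eq_or_lt with h1 | h1
    · simp [h1]
    · by_contra hneg
      push Not at hneg
      have hM : M < 0 := by
        by_contra hM
        push Not at hM
        nlinarith
      have hpos : volume (Icc 0 T) ≠ 0 := by
        rw [Real.volume_Icc]; simp; linarith
      have : NeZero (volume.restrict (Icc 0 T)) := ⟨by simpa using hpos⟩
      obtain ⟨τ, w, hw, -⟩ := hder.exists
      linarith [norm_nonneg w]
  · nlinarith

theorem norm_sum_smul_le {θ : Fin m → ℝ} (hθ : ∑ j, θ j ^ 2 ≤ 1)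
    (V : Fin m → EuclideanSpace ℝ (Fin N)) : ‖∑ j, θ j • V j‖ ≤ ∑ j, ‖V j‖ := by
  refine (norm_sum_le _ _).trans (Finset.sum_le_sum fun j _ => ?_)
  rw [norm_smul]
  have h1 : θ j ^ 2 ≤ 1 :=
    (Finset.single_le_sum (f := fun j => θ j ^ 2) (fun i _ => sq_nonneg _)
      (Finset.mem_univ j)).trans hθ
  have : ‖θ j‖ ≤ 1 := by
    rw [Real.norm_eq_abs]; exact (sq_le_one_iff_abs_le_one _).1 h1
  exact mul_le_of_le_one_left (norm_nonneg _) this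

theorem IsSubunitPath.norm_sub_le {γ : ℝ → EuclideanSpace ℝ (Fin N)} {T M : ℝ}
    (h : IsSubunitPath X D T γ) (hM : ∀ t ∈ Icc 0 T, ∑ j, ‖X j (γ t)‖ ≤ M)
    {s t : ℝ} (hs : 0 ≤ s) (hst : s ≤ t) (ht : t ≤ T) : ‖γ t - γ s‖ ≤ M * (t - s) := by
  refine norm_sub_le_of_ae_deriv_le h.1 ?_ hs hst ht
  filter_upwards [h.2.2, ae_restrict_mem measurableSet_Icc] with τ hτ hm
  obtain ⟨θ, hθ, hd⟩ := hτ
  exact ⟨_, (norm_sum_smul_le hθ _).trans (hM τ hm), hd⟩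

theorem continuous_sum_norm (hX : ∀ j, LocallyLipschitz (X j)) :
    Continuous fun x => ∑ j, ‖X j x‖ :=
  continuous_finsetSum _ fun j _ => (hX j).continuous.norm

theorem IsSubunitPath.continuousOn {γ : ℝ → EuclideanSpace ℝ (Fin N)} {T : ℝ} (hT : 0 ≤ T)
    (h : IsSubunitPath X D T γ) : ContinuousOn γ (Icc 0 T) := by
  simpa [uIcc_of_le hT] using h.1.continuousOn

/-- The image of the path is compact and the fields are bounded on it. Lipschitz bounds pass more
easily than absolute continuity through reversal and concatenation. -/
theorem IsSubunitPath.exists_lipschitz (hX : ∀ j, LocallyLipschitz (X j))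
    {γ : ℝ → EuclideanSpace ℝ (Fin N)} {T : ℝ} (hT : 0 ≤ T) (h : IsSubunitPath X D T γ) :
    ∃ K : ℝ, 0 ≤ K ∧ ∀ s ∈ Icc 0 T, ∀ t ∈ Icc 0 T, s ≤ t → ‖γ t - γ s‖ ≤ K * (t - s) := by
  obtain ⟨K, hK⟩ := isCompact_Icc.exists_bound_of_continuousOn (s := Icc 0 T)
    ((continuous_sum_norm hX).comp_continuousOn (h.continuousOn hT))
  refine ⟨max K 0, le_max_right _ _, fun s hs t ht hst => h.norm_sub_le (fun τ hτ => ?_) hs.1 hst ht.2⟩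
  exact (le_abs_self _).trans ((hK τ hτ).trans (le_max_left _ _))

theorem absolutelyContinuousOnInterval_of_norm_sub_le {γ : ℝ → EuclideanSpace ℝ (Fin N)} {T K : ℝ}
    (hT : 0 ≤ T) (hK : 0 ≤ K)
    (h : ∀ s ∈ Icc 0 T, ∀ t ∈ Icc 0 T, s ≤ t → ‖γ t - γ s‖ ≤ K * (t - s)) :
    AbsolutelyContinuousOnInterval γ 0 T := by
  have : LipschitzOnWith ⟨K, hK⟩ γ (uIcc 0 T) := by
    rw [uIcc_of_le hT]
    refine LipschitzOnWith.of_dist_le_mul fun s hs t ht => ?_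
    rcases le_total s t with hst | hst
    · rw [dist_comm, dist_eq_norm, Real.dist_eq, abs_sub_comm, abs_of_nonneg (by linarith)]
      exact h s hs t ht hst
    · rw [dist_eq_norm, Real.dist_eq, abs_of_nonneg (by linarith)]
      exact h t ht s hs hst
  exact this.absolutelyContinuousOnInterval

theorem IsSubunitPath.const {x : EuclideanSpace ℝ (Fin N)} (hx : x ∈ D) {T : ℝ} (hT : 0 ≤ T) :
    IsSubunitPath X D T fun _ => x := by
  refine ⟨absolutelyContinuousOnInterval_of_norm_sub_le hT le_rfl (by simp), fun _ _ => hx, ?_⟩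
  refine Eventually.of_forall fun t => ⟨0, by simp, ?_⟩
  simpa using hasDerivAt_const t x

theorem IsSubunitPath.restrict {γ : ℝ → EuclideanSpace ℝ (Fin N)} {T S : ℝ} (hS : 0 ≤ S)
    (hST : S ≤ T) (h : IsSubunitPath X D T γ) : IsSubunitPath X D S γ := by
  have hsub : Icc 0 S ⊆ Icc 0 T := Icc_subset_Icc le_rfl hST
  refine ⟨h.1.mono ?_, fun t ht => h.2.1 t (hsub ht),
    ae_mono (Measure.restrict_mono hsub le_rfl) h.2.2⟩
  rwa [uIcc_of_le hS, uIcc_of_le (hS.trans hST)]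

theorem IsSubunitPath.reverse (hX : ∀ j, LocallyLipschitz (X j))
    {γ : ℝ → EuclideanSpace ℝ (Fin N)} {T : ℝ} (hT : 0 ≤ T) (h : IsSubunitPath X D T γ) :
    IsSubunitPath X D T fun t => γ (T - t) := by
  obtain ⟨K, hK0, hK⟩ := h.exists_lipschitz hX hT
  have hmem : ∀ t ∈ Icc 0 T, T - t ∈ Icc 0 T := fun t ht => ⟨by linarith [ht.2], by linarith [ht.1]⟩
  refine ⟨absolutelyContinuousOnInterval_of_norm_sub_le hT hK0 fun s hs t ht hst => ?_,
    fun t ht => h.2.1 _ (hmem t ht), ?_⟩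
  · rw [norm_sub_rev]
    have := hK _ (hmem t ht) _ (hmem s hs) (by linarith)
    linarith
  · have h1 := (ae_restrict_iff' measurableSet_Icc).1 h.2.2
    have h2 : ∀ᵐ t : ℝ, T - t ∈ Icc 0 T → ∃ θ : Fin m → ℝ, ∑ j, θ j ^ 2 ≤ 1 ∧
        HasDerivAt γ (∑ j, θ j • X j (γ (T - t))) (T - t) :=
      (Measure.measurePreserving_sub_left volume T).quasiMeasurePreserving.ae h1
    rw [ae_restrict_iff' measurableSet_Icc]
    filter_upwards [h2] with t ht htm
    obtain ⟨θ, hθ, hd⟩ := ht (hmem t htm)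
    refine ⟨-θ, by simpa using hθ, ?_⟩
    have h3 := hd.scomp t ((hasDerivAt_id t).const_sub T)
    simpa [Function.comp_def] using h3

theorem IsSubunitPath.concat (hX : ∀ j, LocallyLipschitz (X j))
    {γ₁ γ₂ : ℝ → EuclideanSpace ℝ (Fin N)} {S T : ℝ} (hS : 0 ≤ S) (hT : 0 ≤ T)
    (h₁ : IsSubunitPath X D S γ₁) (h₂ : IsSubunitPath X D T γ₂) (hγ : γ₁ S = γ₂ 0) :
    IsSubunitPath X D (S + T) fun t => if t ≤ S then γ₁ t else γ₂ (t - S) := by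
  obtain ⟨K₁, hK₁0, hK₁⟩ := h₁.exists_lipschitz hX hS
  obtain ⟨K₂, hK₂0, hK₂⟩ := h₂.exists_lipschitz hX hT
  refine ⟨absolutelyContinuousOnInterval_of_norm_sub_le (add_nonneg hS hT) (add_nonneg hK₁0 hK₂0)
    fun s hs t ht hst => ?_, fun t ht => ?_, ?_⟩
  · by_cases h1 : t ≤ S
    · simp only [h1, hst.trans h1, if_true]
      refine (hK₁ s ⟨hs.1, hst.trans h1⟩ t ⟨ht.1, h1⟩ hst).trans ?_
      nlinarith
    · by_cases h2 : s ≤ S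
      · simp only [h1, h2, if_true, if_false]
        push Not at h1
        have e1 := hK₁ s ⟨hs.1, h2⟩ S ⟨hS, le_rfl⟩ h2
        have e2 := hK₂ 0 ⟨le_rfl, hT⟩ (t - S) ⟨by linarith, by linarith [ht.2]⟩ (by linarith)
        calc ‖γ₂ (t - S) - γ₁ s‖ = ‖(γ₂ (t - S) - γ₂ 0) + (γ₁ S - γ₁ s)‖ := by
              rw [hγ]; congr 1; abel
          _ ≤ _ := norm_add_le _ _
          _ ≤ K₂ * (t - S - 0) + K₁ * (S - s) := add_le_add e2 e1
          _ ≤ _ := by nlinarith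
      · simp only [h1, h2, if_false]
        push Not at h1 h2
        refine (hK₂ (s - S) ⟨by linarith, by linarith [hs.2]⟩ (t - S)
          ⟨by linarith, by linarith [ht.2]⟩ (by linarith)).trans ?_
        nlinarith
  · by_cases h1 : t ≤ S
    · simp only [h1, if_true]
      exact h₁.2.1 t ⟨ht.1, h1⟩
    · simp only [h1, if_false]
      push Not at h1
      exact h₂.2.1 _ ⟨by linarith, by linarith [ht.2]⟩
  · have e1 := (ae_restrict_iff' measurableSet_Icc).1 h₁.2.2
    have e2 := (measurePreserving_sub_right volume S).quasiMeasurePreserving.ae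
      ((ae_restrict_iff' measurableSet_Icc).1 h₂.2.2)
    -- The concatenated path need not be differentiable at the junction, which is a null set of
    -- times.
    have e3 : ∀ᵐ t : ℝ, t ≠ S := by simp [ae_iff]
    rw [ae_restrict_iff' measurableSet_Icc]
    filter_upwards [e1, e2, e3] with t ht1 ht2 ht3 htm
    rcases lt_or_gt_of_ne ht3 with hlt | hgt
    · obtain ⟨θ, hθ, hd⟩ := ht1 ⟨htm.1, hlt.le⟩
      refine ⟨θ, hθ, ?_⟩
      simp only [hlt.le, if_true]
      refine hd.congr_of_eventuallyEq ?_
      filter_upwards [gt_mem_nhds hlt] with τ hτ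
      simp [le_of_lt hτ]
    · obtain ⟨θ, hθ, hd⟩ := ht2 ⟨by linarith, by linarith [htm.2]⟩
      refine ⟨θ, hθ, ?_⟩
      simp only [not_le.2 hgt, if_false]
      have h3 := hd.scomp t ((hasDerivAt_id t).sub_const S)
      simp only [one_smul] at h3
      refine h3.congr_of_eventuallyEq ?_
      filter_upwards [lt_mem_nhds hgt] with τ hτ
      simp [not_le.2 hτ]

theorem travelTimes_bddBelow (x y : EuclideanSpace ℝ (Fin N)) : BddBelow (travelTimes X D x y) :=
  ⟨0, fun _ hT => hT.1.le⟩

theorem ccDist_nonneg (x y : EuclideanSpace ℝ (Fin N)) : 0 ≤ ccDist X D x y :=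
  Real.sInf_nonneg fun _ hT => hT.1.le

theorem ccDist_self {x : EuclideanSpace ℝ (Fin N)} (hx : x ∈ D) : ccDist X D x x = 0 := by
  refine le_antisymm ?_ (ccDist_nonneg _ _)
  refine le_of_forall_pos_le_add fun ε hε => ?_
  rw [zero_add]
  exact csInf_le (travelTimes_bddBelow x x) ⟨hε, _, IsSubunitPath.const hx hε.le, rfl, rfl⟩

theorem travelTimes_comm (hX : ∀ j, LocallyLipschitz (X j)) (x y : EuclideanSpace ℝ (Fin N)) :
    travelTimes X D x y ⊆ travelTimes X D y x := by
  rintro T ⟨hT, γ, hγ, h0, h1⟩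
  exact ⟨hT, _, hγ.reverse hX hT.le, by simpa using h1, by simpa using h0⟩

theorem ccDist_comm (hX : ∀ j, LocallyLipschitz (X j)) (x y : EuclideanSpace ℝ (Fin N)) :
    ccDist X D x y = ccDist X D y x :=
  congrArg sInf ((travelTimes_comm hX x y).antisymm (travelTimes_comm hX y x))

theorem exists_travelTime_lt (hc : IsXConnected X D) {x y : EuclideanSpace ℝ (Fin N)} (hx : x ∈ D)
    (hy : y ∈ D) {r : ℝ} (h : ccDist X D x y < r) : ∃ T ∈ travelTimes X D x y, T < r :=
  exists_lt_of_csInf_lt (hc x hx y hy) h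

theorem ccDist_triangle (hX : ∀ j, LocallyLipschitz (X j)) (hc : IsXConnected X D)
    {x y z : EuclideanSpace ℝ (Fin N)} (hx : x ∈ D) (hy : y ∈ D) (hz : z ∈ D) :
    ccDist X D x z ≤ ccDist X D x y + ccDist X D y z := by
  refine le_of_forall_pos_le_add fun ε hε => ?_
  obtain ⟨S, ⟨hS, γ₁, hγ₁, h10, h11⟩, hSlt⟩ :=
    exists_travelTime_lt hc hx hy (lt_add_of_pos_right (ccDist X D x y) (half_pos hε))
  obtain ⟨T, ⟨hT, γ₂, hγ₂, h20, h21⟩, hTlt⟩ :=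
    exists_travelTime_lt hc hy hz (lt_add_of_pos_right (ccDist X D y z) (half_pos hε))
  have : ccDist X D x z ≤ S + T := by
    refine csInf_le (travelTimes_bddBelow x z) ⟨by positivity, _,
      hγ₁.concat hX hS.le hT.le hγ₂ (h11.trans h20.symm), ?_, ?_⟩
    · simp [hS.le, h10]
    · simp [hT, h21]
  linarith

/-! ### Balls -/

theorem mem_ccBall_self {x : EuclideanSpace ℝ (Fin N)} (hx : x ∈ D) {r : ℝ} (hr : 0 < r) :
    x ∈ ccBall X D x r := ⟨hx, by rwa [ccDist_self hx]⟩

theorem ccBall_subset (x : EuclideanSpace ℝ (Fin N)) (r : ℝ) : ccBall X D x r ⊆ D := fun _ h => h.1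

theorem ccBall_mono (x : EuclideanSpace ℝ (Fin N)) {r s : ℝ} (h : r ≤ s) :
    ccBall X D x r ⊆ ccBall X D x s := fun _ hy => ⟨hy.1, hy.2.trans_le h⟩

theorem isOpen_ccBall (hX : ∀ j, LocallyLipschitz (X j)) (hc : IsXConnected X D)
    (hcont : ∀ x ∈ D, Tendsto (fun y => ccDist X D x y) (𝓝[D] x) (𝓝 0)) (hD : IsOpen D)
    {x : EuclideanSpace ℝ (Fin N)} (hx : x ∈ D) (r : ℝ) : IsOpen (ccBall X D x r) := by
  rw [isOpen_iff_mem_nhds]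
  rintro y ⟨hy, hlt⟩
  have h1 := hcont y hy
  rw [hD.nhdsWithin_eq hy] at h1
  filter_upwards [h1.eventually (gt_mem_nhds (sub_pos.2 hlt)), hD.mem_nhds hy] with z hz hzD
  refine ⟨hzD, (ccDist_triangle hX hc hx hy hzD).trans_lt ?_⟩
  linarith

/-- Up to its first exit time `s` from the Euclidean ball, a path has speed at most `M`, so `ε ≤ M
s`. A path of duration less than `ε / M` therefore cannot leave. -/
theorem exists_ccBall_subset_ball (hX : ∀ j, LocallyLipschitz (X j)) (hc : IsXConnected X D)
    {x : EuclideanSpace ℝ (Fin N)} (hx : x ∈ D) {ε : ℝ} (hε : 0 < ε) :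
    ∃ r, 0 < r ∧ ccBall X D x r ⊆ Metric.ball x ε := by
  obtain ⟨K, hK⟩ := (isCompact_closedBall x ε).exists_bound_of_continuousOn
    (continuous_sum_norm hX).continuousOn
  have hM : ∀ y ∈ Metric.closedBall x ε, ∑ j, ‖X j y‖ ≤ max K 1 := fun y hy =>
    (le_abs_self _).trans ((hK y hy).trans (le_max_left _ _))
  set M := max K 1
  have hM0 : 0 < M := lt_of_lt_of_le one_pos (le_max_right _ _)
  refine ⟨ε / M, by positivity, ?_⟩
  rintro y ⟨hy, hlt⟩
  obtain ⟨T, ⟨hT, γ, hγ, h0, h1⟩, hTlt⟩ := exists_travelTime_lt hc hx hy hlt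
  rw [lt_div_iff₀ hM0] at hTlt
  by_contra hcon
  set S := {t | t ∈ Icc 0 T ∧ ε ≤ ‖γ t - x‖} with hS
  have hSne : S.Nonempty := ⟨T, ⟨hT.le, le_rfl⟩, by
    rw [h1]; simpa [dist_eq_norm] using hcon⟩
  have hScl : IsClosed S := by
    have := (hγ.continuousOn hT.le).sub (continuousOn_const (c := x))
    exact this.norm.preimage_isClosed_of_isClosed isClosed_Icc isClosed_Ici
  have hSb : BddBelow S := ⟨0, fun t ht => ht.1.1⟩
  obtain ⟨hs1, hs2⟩ := hScl.csInf_mem hSne hSb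
  set s := sInf S
  have hlow : ∀ t, 0 ≤ t → t < s → ‖γ t - x‖ < ε := fun t ht hts => by
    by_contra hge
    exact absurd (csInf_le hSb ⟨⟨ht, hts.le.trans hs1.2⟩, not_lt.1 hge⟩) (not_le.2 hts)
  have hspos : 0 < s := by
    rcases hs1.1.eq_or_lt with h | h
    · rw [← h, h0] at hs2; simp at hs2; linarith
    · exact h
  have hle : ∀ t ∈ Icc 0 s, ‖γ t - x‖ ≤ ε := by
    have hcl : closure (Ico 0 s) = Icc 0 s := closure_Ico hspos.ne
    intro t ht
    rw [← hcl] at ht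
    refine ContinuousWithinAt.closure_le (f := fun t => ‖γ t - x‖) (g := fun _ => ε) ht ?_
      continuousWithinAt_const (fun τ hτ => (hlow τ hτ.1 hτ.2).le)
    have htI : t ∈ Icc 0 T := by rw [hcl] at ht; exact ⟨ht.1, ht.2.trans hs1.2⟩
    exact ((((hγ.continuousOn hT.le) t htI).sub continuousWithinAt_const).norm).mono
      fun τ hτ => ⟨hτ.1, hτ.2.le.trans hs1.2⟩
  have := (hγ.restrict hs1.1 hs1.2).norm_sub_le (M := M)
    (fun t ht => hM _ (by simpa [dist_eq_norm] using hle t ht)) le_rfl hs1.1 le_rfl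
  rw [h0] at this
  nlinarith [hs1.2]

end

/-! ### Volumes of control balls under the doubling condition -/

section

variable {N m : ℕ} {X : VectorFields N m} {D : Set (EuclideanSpace ℝ (Fin N))} {Q : ℝ}

/-- The geometric assumptions on an open set `D`, with locally Lipschitz vector fields. -/
structure GeometricSetting (X : VectorFields N m) (D : Set (EuclideanSpace ℝ (Fin N)))
    (Q : ℝ) : Prop where
  lip : ∀ j, LocallyLipschitz (X j)
  isOpen : IsOpen D
  two_lt : 2 < Q
  geo : GeometricAssumptions X D Q

namespace GeometricSetting

variable (h : GeometricSetting X D Q)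
include h

theorem isOpen_ball {x : EuclideanSpace ℝ (Fin N)} (hx : x ∈ D) (r : ℝ) :
    IsOpen (ccBall X D x r) :=
  isOpen_ccBall h.lip h.geo.connected h.geo.continuous_dist h.isOpen hx r

theorem comm (x y : EuclideanSpace ℝ (Fin N)) : ccDist X D x y = ccDist X D y x :=
  ccDist_comm h.lip x y

theorem triangle {x y z : EuclideanSpace ℝ (Fin N)} (hx : x ∈ D) (hy : y ∈ D) (hz : z ∈ D) :
    ccDist X D x z ≤ ccDist X D x y + ccDist X D y z :=
  ccDist_triangle h.lip h.geo.connected hx hy hz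

theorem ball_subset_ball {x y : EuclideanSpace ℝ (Fin N)} (hx : x ∈ D) (hy : y ∈ D) {r s : ℝ}
    (hs : ccDist X D y x + r ≤ s) : ccBall X D x r ⊆ ccBall X D y s := fun z hz =>
  ⟨hz.1, by linarith [h.triangle hy hx hz.1, hz.2]⟩

theorem volume_ball_iterate_le {x : EuclideanSpace ℝ (Fin N)} (hx : x ∈ D) {r : ℝ} (hr : 0 < r)
    (k : ℕ) : volume (ccBall X D x (2 ^ k * r)) ≤
      ENNReal.ofReal (2 ^ Q) ^ k * volume (ccBall X D x r) := by
  induction k with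
  | zero => simp
  | succ k ih =>
    have h1 := (h.geo.doubling x hx (2 ^ k * r) (by positivity)).2
    rw [← mul_assoc, ← pow_succ'] at h1
    calc _ ≤ _ := h1
      _ ≤ ENNReal.ofReal (2 ^ Q) * (ENNReal.ofReal (2 ^ Q) ^ k * volume (ccBall X D x r)) := by
        gcongr
      _ = _ := by rw [← mul_assoc, ← pow_succ']

theorem volume_ball_pos {x : EuclideanSpace ℝ (Fin N)} (hx : x ∈ D) {r : ℝ} (hr : 0 < r) :
    0 < volume (ccBall X D x r) := by
  have := (h.geo.doubling x hx (r / 2) (by positivity)).1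
  rwa [mul_div_cancel₀ _ two_ne_zero] at this

/-- A small control ball lies in a Euclidean ball and so has finite volume; doubling carries
finiteness to every radius. -/
theorem volume_ball_lt_top {x : EuclideanSpace ℝ (Fin N)} (hx : x ∈ D) (r : ℝ) :
    volume (ccBall X D x r) < ⊤ := by
  obtain ⟨s, hs, hsub⟩ := exists_ccBall_subset_ball h.lip h.geo.connected hx one_pos
  obtain ⟨k, hk⟩ := pow_unbounded_of_one_lt (r / s) (one_lt_two (α := ℝ))
  rw [div_lt_iff₀ hs] at hk
  calc _ ≤ volume (ccBall X D x (2 ^ k * s)) := measure_mono (ccBall_mono x hk.le)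
    _ ≤ _ := h.volume_ball_iterate_le hx hs k
    _ < ⊤ := ENNReal.mul_lt_top (ENNReal.pow_lt_top ENNReal.ofReal_lt_top)
      ((measure_mono hsub).trans_lt measure_ball_lt_top)

theorem real_volume_ball_pos {x : EuclideanSpace ℝ (Fin N)} (hx : x ∈ D) {r : ℝ} (hr : 0 < r) :
    0 < volume.real (ccBall X D x r) :=
  ENNReal.toReal_pos (h.volume_ball_pos hx hr).ne' (h.volume_ball_lt_top hx r).ne

theorem real_volume_ball_mono {x y : EuclideanSpace ℝ (Fin N)} (hy : y ∈ D) {r s : ℝ}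
    (hs : ccBall X D x r ⊆ ccBall X D y s) :
    volume.real (ccBall X D x r) ≤ volume.real (ccBall X D y s) :=
  ENNReal.toReal_mono (h.volume_ball_lt_top hy s).ne (measure_mono hs)

theorem real_volume_ball_iterate_le {x : EuclideanSpace ℝ (Fin N)} (hx : x ∈ D) {r : ℝ}
    (hr : 0 < r) (k : ℕ) : volume.real (ccBall X D x (2 ^ k * r)) ≤
      (2 ^ Q) ^ k * volume.real (ccBall X D x r) := by
  have h1 := ENNReal.toReal_mono (ENNReal.mul_ne_top (ENNReal.pow_ne_top ENNReal.ofReal_ne_top)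
    (h.volume_ball_lt_top hx r).ne) (h.volume_ball_iterate_le hx hr k)
  rwa [ENNReal.toReal_mul, ENNReal.toReal_pow, ENNReal.toReal_ofReal (by positivity)] at h1

theorem real_volume_ball_le {x : EuclideanSpace ℝ (Fin N)} (hx : x ∈ D) {r R : ℝ}
    (hr : 0 < r) (hrR : r ≤ R) : volume.real (ccBall X D x R) ≤
      (2 * R / r) ^ Q * volume.real (ccBall X D x r) := by
  obtain ⟨k, hk1, hk2⟩ := exists_nat_pow_near ((one_le_div hr).2 hrR) (one_lt_two (α := ℝ))
  rw [le_div_iff₀ hr] at hk1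
  rw [div_lt_iff₀ hr] at hk2
  calc _ ≤ volume.real (ccBall X D x (2 ^ (k + 1) * r)) :=
        h.real_volume_ball_mono hx (ccBall_mono x hk2.le)
    _ ≤ (2 ^ Q) ^ (k + 1) * volume.real (ccBall X D x r) := h.real_volume_ball_iterate_le hx hr _
    _ ≤ _ := by
      gcongr
      rw [← Real.rpow_natCast, ← Real.rpow_mul (by norm_num), mul_comm Q, Real.rpow_mul (by norm_num),
        Real.rpow_natCast]
      refine Real.rpow_le_rpow (by positivity) ?_ (by linarith [h.two_lt])
      rw [le_div_iff₀ hr, pow_succ]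
      linarith

/-! ### The maximal function -/

omit h in
/-- The uncentred maximal function over the balls of radius at most `R`. -/
def _root_.XElliptic.maximalFun (X : VectorFields N m) (D : Set (EuclideanSpace ℝ (Fin N))) (R : ℝ)
    (g : EuclideanSpace ℝ (Fin N) → ℝ≥0∞) (x : EuclideanSpace ℝ (Fin N)) : ℝ≥0∞ :=
  ⨆ (p : EuclideanSpace ℝ (Fin N) × ℝ)
    (_ : (p.1 ∈ D ∧ 0 < p.2 ∧ p.2 ≤ R) ∧ x ∈ ccBall X D p.1 p.2),
    (∫⁻ y in ccBall X D p.1 p.2, g y) / volume (ccBall X D p.1 p.2)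

omit h in
theorem _root_.XElliptic.lt_maximalFun_iff {R : ℝ} {g : EuclideanSpace ℝ (Fin N) → ℝ≥0∞}
    {t : ℝ≥0∞} {x : EuclideanSpace ℝ (Fin N)} :
    t < maximalFun X D R g x ↔ ∃ p : EuclideanSpace ℝ (Fin N) × ℝ,
      (p.1 ∈ D ∧ 0 < p.2 ∧ p.2 ≤ R) ∧ x ∈ ccBall X D p.1 p.2 ∧
      t < (∫⁻ y in ccBall X D p.1 p.2, g y) / volume (ccBall X D p.1 p.2) := by
  simp only [maximalFun, lt_iSup_iff]
  constructor
  · rintro ⟨p, hp, ht⟩; exact ⟨p, hp.1, hp.2, ht⟩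
  · rintro ⟨p, hp1, hp2, ht⟩; exact ⟨p, ⟨hp1, hp2⟩, ht⟩

/-- This is the gain from taking uncentred balls: a ball with large mean lies entirely in the
superlevel set. -/
theorem isOpen_lt_maximalFun (R : ℝ) (g : EuclideanSpace ℝ (Fin N) → ℝ≥0∞) (t : ℝ≥0∞) :
    IsOpen {x | t < maximalFun X D R g x} := by
  rw [isOpen_iff_mem_nhds]
  intro x hx
  obtain ⟨p, hp1, hp2, ht⟩ := lt_maximalFun_iff.1 hx
  filter_upwards [(h.isOpen_ball hp1.1 p.2).mem_nhds hp2] with y hy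
  exact lt_maximalFun_iff.2 ⟨p, hp1, hy, ht⟩

theorem measurable_maximalFun (R : ℝ) (g : EuclideanSpace ℝ (Fin N) → ℝ≥0∞) :
    Measurable (maximalFun X D R g) :=
  measurable_of_Ioi fun t => (h.isOpen_lt_maximalFun R g t).measurableSet

/-- Vitali covering with ratio `2`: a ball meeting a selected ball of radius `r` has radius at most
`2r`, so it lies in the concentric ball of radius `5r`. The factor `2 ^ 3` is the next power of two,
hence three doublings. The bound on the radii makes the covering lemma applicable. -/
theorem maximalFun_weak (R : ℝ) (g : EuclideanSpace ℝ (Fin N) → ℝ≥0∞) (t : ℝ≥0∞) :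
    t * volume {x | t < maximalFun X D R g x} ≤ ENNReal.ofReal (2 ^ Q) ^ 3 * ∫⁻ x, g x := by
  set B : EuclideanSpace ℝ (Fin N) × ℝ → Set (EuclideanSpace ℝ (Fin N)) :=
    fun p => ccBall X D p.1 p.2
  set T : Set (EuclideanSpace ℝ (Fin N) × ℝ) := {p | (p.1 ∈ D ∧ 0 < p.2 ∧ p.2 ≤ R) ∧
    t < (∫⁻ y in B p, g y) / volume (B p)} with hT
  obtain ⟨u, huT, hud, hcov⟩ := Vitali.exists_disjoint_subfamily_covering_enlargement B T
    (fun p => p.2) 2 one_lt_two (fun p hp => hp.1.2.1.le) R (fun p hp => hp.1.2.2)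
    (fun p hp => ⟨p.1, mem_ccBall_self hp.1.1 hp.1.2.1⟩)
  have hucount : u.Countable := hud.countable_of_isOpen (fun p hp => h.isOpen_ball (huT hp).1.1 _)
    (fun p hp => ⟨p.1, mem_ccBall_self (huT hp).1.1 (huT hp).1.2.1⟩)
  have hsub : {x | t < maximalFun X D R g x} ⊆ ⋃ p ∈ u, ccBall X D p.1 (2 ^ 3 * p.2) := by
    intro x hx
    obtain ⟨p, hp1, hp2, ht⟩ := lt_maximalFun_iff.1 hx
    obtain ⟨q, hq, ⟨z, hzp, hzq⟩, hle⟩ := hcov p ⟨hp1, ht⟩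
    refine mem_biUnion hq ⟨hp2.1, ?_⟩
    have hqD := (huT hq).1.1
    have hq0 := (huT hq).1.2.1
    have e1 := h.triangle hqD hzq.1 hp2.1
    have e2 := h.triangle hzq.1 hp1.1 hp2.1
    rw [h.comm z p.1] at e2
    have := hzp.2; have := hzq.2; have := hp2.2
    linarith
  calc t * volume {x | t < maximalFun X D R g x}
      ≤ t * volume (⋃ p ∈ u, ccBall X D p.1 (2 ^ 3 * p.2)) := by gcongr
    _ ≤ t * ∑' p : u, volume (ccBall X D p.1.1 (2 ^ 3 * p.1.2)) := by
        gcongr; exact measure_biUnion_le _ hucount _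
    _ ≤ t * ∑' p : u, ENNReal.ofReal (2 ^ Q) ^ 3 * volume (B p) := by
        gcongr with p
        exact h.volume_ball_iterate_le (huT p.2).1.1 (huT p.2).1.2.1 3
    _ = ENNReal.ofReal (2 ^ Q) ^ 3 * ∑' p : u, t * volume (B p) := by
        rw [ENNReal.tsum_mul_left, ENNReal.tsum_mul_left, mul_left_comm]
    _ ≤ ENNReal.ofReal (2 ^ Q) ^ 3 * ∑' p : u, ∫⁻ y in B p, g y := by
        gcongr with p
        exact ENNReal.mul_le_of_le_div (huT p.2).2.le
    _ = ENNReal.ofReal (2 ^ Q) ^ 3 * ∫⁻ y in ⋃ p ∈ u, B p, g y := by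
        rw [lintegral_biUnion hucount (fun p hp => (h.isOpen_ball (huT hp).1.1 _).measurableSet) hud]
    _ ≤ _ := by gcongr; exact Measure.restrict_le_self

omit h in
theorem maximalFun_le {R : ℝ} {g : EuclideanSpace ℝ (Fin N) → ℝ≥0∞} {K : ℝ≥0∞}
    (hg : ∀ x, g x ≤ K) (x : EuclideanSpace ℝ (Fin N)) : maximalFun X D R g x ≤ K := by
  refine iSup₂_le fun p hp => ?_
  refine ENNReal.div_le_of_le_mul ?_
  calc ∫⁻ y in ccBall X D p.1 p.2, g y ≤ ∫⁻ y in ccBall X D p.1 p.2, K := lintegral_mono hg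
    _ = _ := by simp

theorem maximalFun_le_add {R : ℝ} {g : EuclideanSpace ℝ (Fin N) → ℝ≥0∞}
    (K : ℝ≥0∞) (x : EuclideanSpace ℝ (Fin N)) :
    maximalFun X D R g x ≤ maximalFun X D R ({y | K < g y}.indicator g) x + K := by
  refine iSup₂_le fun p hp => ?_
  have h1 : ∀ y, g y ≤ {y | K < g y}.indicator g y + K := fun y => by
    by_cases hy : K < g y
    · rw [indicator_of_mem (by exact hy)]; exact le_self_add
    · rw [indicator_of_notMem (by exact hy), zero_add]; exact not_lt.1 hy
  set B := ccBall X D p.1 p.2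
  calc (∫⁻ y in B, g y) / volume B
      ≤ (∫⁻ y in B, ({y | K < g y}.indicator g y + K)) / volume B := by
        gcongr with y; exact h1 y
    _ = (∫⁻ y in B, {y | K < g y}.indicator g y) / volume B + K := by
        rw [lintegral_add_right _ measurable_const, ENNReal.add_div]
        simp only [lintegral_const, Measure.restrict_apply MeasurableSet.univ, univ_inter]
        rw [ENNReal.mul_div_cancel_right (h.volume_ball_pos hp.1.1 hp.1.2.1).ne'
          (h.volume_ball_lt_top hp.1.1 _).ne]
    _ ≤ _ := by
        gcongr
        exact le_iSup₂ (f := fun (p : EuclideanSpace ℝ (Fin N) × ℝ)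
          (_ : (p.1 ∈ D ∧ 0 < p.2 ∧ p.2 ≤ R) ∧ x ∈ ccBall X D p.1 p.2) =>
          (∫⁻ y in ccBall X D p.1 p.2, {y | K < g y}.indicator g y) / volume (ccBall X D p.1 p.2))
          p hp

/-- Marcinkiewicz interpolation by hand: the superlevel set at height `t` is controlled by the weak
bound for the part of `g` above `t / 2`, since the remainder contributes at most `t / 2`; the
layer-cake formula then integrates in `t`. Boundedness of `g` keeps the maximal function finite. -/
theorem maximalFun_strong (R : ℝ) {g : EuclideanSpace ℝ (Fin N) → ℝ} (hg : Measurable g)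
    {K : ℝ} (hK : ∀ x, g x ≤ K) :
    ∫⁻ x, maximalFun X D R (fun y => ENNReal.ofReal (g y)) x ^ 2 ≤
      (8 * ENNReal.ofReal (2 ^ Q) ^ 3) * ∫⁻ x, ENNReal.ofReal (g x) ^ 2 := by
  set G : EuclideanSpace ℝ (Fin N) → ℝ≥0∞ := fun y => ENNReal.ofReal (g y) with hG
  have hGm : Measurable G := hg.ennreal_ofReal
  set C := ENNReal.ofReal (2 ^ Q) ^ 3
  set M := maximalFun X D R G with hM
  have hMm : Measurable M := h.measurable_maximalFun R G
  have hMK : ∀ x, M x ≤ ENNReal.ofReal K :=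
    maximalFun_le fun x => ENNReal.ofReal_le_ofReal (hK x)
  have hMtop : ∀ x, M x ≠ ⊤ := fun x => ((hMK x).trans_lt ENNReal.ofReal_lt_top).ne
  have hlc := lintegral_rpow_eq_lintegral_meas_lt_mul (volume : Measure (EuclideanSpace ℝ (Fin N)))
    (f := fun x => (M x).toReal) (Eventually.of_forall fun x => ENNReal.toReal_nonneg)
    hMm.ennreal_toReal.aemeasurable (p := 2) two_pos
  have hl : ∫⁻ x, M x ^ 2 = ∫⁻ x, ENNReal.ofReal ((M x).toReal ^ (2 : ℝ)) := by
    refine lintegral_congr fun x => ?_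
    rw [Real.rpow_two, ENNReal.ofReal_pow ENNReal.toReal_nonneg, ENNReal.ofReal_toReal (hMtop x)]
  have hlevel : ∀ t ∈ Ioi (0 : ℝ), volume {x | t < (M x).toReal} * ENNReal.ofReal (t ^ ((2 : ℝ) - 1))
      ≤ 2 * C * ∫⁻ x, {x | ENNReal.ofReal (t / 2) < G x}.indicator G x := by
    intro t ht
    have ht' : (0 : ℝ) < t := ht
    have hw := h.maximalFun_weak R ({x | ENNReal.ofReal (t / 2) < G x}.indicator G)
      (ENNReal.ofReal (t / 2))
    have hsub : {x | t < (M x).toReal} ⊆ {x | ENNReal.ofReal (t / 2) <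
        maximalFun X D R ({x | ENNReal.ofReal (t / 2) < G x}.indicator G) x} := by
      intro x hx
      have h1 := h.maximalFun_le_add (R := R) (g := G) (ENNReal.ofReal (t / 2)) x
      by_contra hcon
      have hcon' : maximalFun X D R ({x | ENNReal.ofReal (t / 2) < G x}.indicator G) x ≤
        ENNReal.ofReal (t / 2) := not_lt.1 hcon
      have h2 : M x ≤ ENNReal.ofReal (t / 2) + ENNReal.ofReal (t / 2) :=
        h1.trans (by gcongr)
      rw [← ENNReal.ofReal_add (by positivity) (by positivity), add_halves] at h2
      have := ENNReal.toReal_le_of_le_ofReal ht'.le h2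
      exact absurd hx (not_lt.2 this)
    have h21 : ENNReal.ofReal (t ^ ((2 : ℝ) - 1)) = 2 * ENNReal.ofReal (t / 2) := by
      rw [show (2 : ℝ) - 1 = 1 by norm_num, Real.rpow_one, ← ENNReal.ofReal_ofNat,
        ← ENNReal.ofReal_mul (by norm_num)]
      congr 1; ring
    calc volume {x | t < (M x).toReal} * ENNReal.ofReal (t ^ ((2 : ℝ) - 1))
        = 2 * (ENNReal.ofReal (t / 2) * volume {x | t < (M x).toReal}) := by rw [h21]; ring
      _ ≤ 2 * (C * ∫⁻ x, {x | ENNReal.ofReal (t / 2) < G x}.indicator G x) := by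
          exact mul_le_mul_right ((mul_le_mul_right (measure_mono hsub) _).trans hw) 2
      _ = _ := by ring
  -- After Tonelli, for fixed `x` the admissible heights are `0 < t < 2 g(x)`, an interval of length
  -- `2 g(x)`.
  have hswap : ∫⁻ t in Ioi (0 : ℝ), ∫⁻ x, {x | ENNReal.ofReal (t / 2) < G x}.indicator G x =
      ∫⁻ x, 2 * G x ^ 2 := by
    rw [lintegral_lintegral_swap]
    · refine lintegral_congr fun x => ?_
      have : ∀ t ∈ Ioi (0 : ℝ), {x | ENNReal.ofReal (t / 2) < G x}.indicator G x =
          (Iio (2 * g x)).indicator (fun _ => G x) t := by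
        intro t ht
        have ht' : (0 : ℝ) < t := ht
        have hiff : ENNReal.ofReal (t / 2) < G x ↔ t < 2 * g x := by
          rw [hG]
          simp only
          rw [ENNReal.ofReal_lt_ofReal_iff_of_nonneg (by positivity)]
          constructor <;> intro <;> linarith
        by_cases ht2 : t < 2 * g x
        · rw [indicator_of_mem (by exact hiff.2 ht2), indicator_of_mem (by exact ht2)]
        · rw [indicator_of_notMem (by exact fun hc => ht2 (hiff.1 hc)),
            indicator_of_notMem (by exact ht2)]
      rw [setLIntegral_congr_fun measurableSet_Ioi this, lintegral_indicator measurableSet_Iio,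
        lintegral_const, Measure.restrict_apply MeasurableSet.univ, univ_inter,
        Measure.restrict_apply measurableSet_Iio, Iio_inter_Ioi, Real.volume_Ioo, sub_zero,
        ENNReal.ofReal_mul zero_le_two, ENNReal.ofReal_ofNat, hG]
      ring
    · refine Measurable.aemeasurable ?_
      have : (Function.uncurry fun (t : ℝ) x => {x | ENNReal.ofReal (t / 2) < G x}.indicator G x) =
          {p : ℝ × EuclideanSpace ℝ (Fin N) | ENNReal.ofReal (p.1 / 2) < G p.2}.indicator
            (fun p => G p.2) := by
        ext ⟨t, x⟩
        simp [Function.uncurry, indicator]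
      rw [this]
      refine (hGm.comp measurable_snd).indicator (measurableSet_lt ?_ (hGm.comp measurable_snd))
      exact (measurable_fst.div_const 2).ennreal_ofReal
  calc ∫⁻ x, M x ^ 2 = ENNReal.ofReal 2 * ∫⁻ t in Ioi (0 : ℝ),
        volume {x | t < (M x).toReal} * ENNReal.ofReal (t ^ ((2 : ℝ) - 1)) := by rw [hl, hlc]
    _ ≤ ENNReal.ofReal 2 * ∫⁻ t in Ioi (0 : ℝ), 2 * C *
        ∫⁻ x, {x | ENNReal.ofReal (t / 2) < G x}.indicator G x := by
        gcongr ENNReal.ofReal 2 * ?_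
        exact setLIntegral_mono' measurableSet_Ioi hlevel
    _ = ENNReal.ofReal 2 * (2 * C * ∫⁻ x, 2 * G x ^ 2) := by
        rw [lintegral_const_mul' _ _ (by finiteness), hswap]
    _ = _ := by
        rw [lintegral_const_mul' _ _ (by finiteness), ENNReal.ofReal_ofNat]
        ring

end GeometricSetting

end

section

variable {N m : ℕ} {X : VectorFields N m} {D Ω : Set (EuclideanSpace ℝ (Fin N))} {Q : ℝ}

/-! ### Test functions -/

/-- `φ` is a smooth function with compact support in `Ω`. -/
def IsTest (Ω : Set (EuclideanSpace ℝ (Fin N))) (φ : EuclideanSpace ℝ (Fin N) → ℝ) : Prop :=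
  ContDiff ℝ ∞ φ ∧ HasCompactSupport φ ∧ tsupport φ ⊆ Ω

theorem xGrad_eq_zero_of_notMem_tsupport (X : VectorFields N m)
    {φ : EuclideanSpace ℝ (Fin N) → ℝ} {x : EuclideanSpace ℝ (Fin N)} (hx : x ∉ tsupport φ) :
    xGrad X φ x = 0 := by
  have : fderiv ℝ φ x = 0 := by
    by_contra hne
    exact hx (support_fderiv_subset ℝ (by simpa using hne))
  ext j
  simp [xGrad, this]

namespace IsTest

variable {φ ψ : EuclideanSpace ℝ (Fin N) → ℝ}

theorem continuous (h : IsTest Ω φ) : Continuous φ := h.1.continuous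

theorem integrable (h : IsTest Ω φ) : Integrable φ := h.continuous.integrable_of_hasCompactSupport h.2.1

theorem eq_zero (h : IsTest Ω φ) {x : EuclideanSpace ℝ (Fin N)} (hx : x ∉ Ω) : φ x = 0 :=
  image_eq_zero_of_notMem_tsupport fun hc => hx (h.2.2 hc)

theorem xGrad_eq_zero (h : IsTest Ω φ) {x : EuclideanSpace ℝ (Fin N)} (hx : x ∉ Ω) :
    xGrad X φ x = 0 :=
  xGrad_eq_zero_of_notMem_tsupport X fun hc => hx (h.2.2 hc)

theorem continuous_xGrad (h : IsTest Ω φ) (hX : ∀ j, LocallyLipschitz (X j)) :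
    Continuous (xGrad X φ) := by
  refine (PiLp.continuous_toLp 2 _).comp (continuous_pi fun j => ?_)
  exact (h.1.continuous_fderiv (by simp)).clm_apply (hX j).continuous

theorem hasCompactSupport_xGrad (h : IsTest Ω φ) : HasCompactSupport (xGrad X φ) :=
  h.2.1.mono' fun x hx => by
    by_contra hc
    exact hx (xGrad_eq_zero_of_notMem_tsupport X hc)

theorem integrable_xGrad (h : IsTest Ω φ) (hX : ∀ j, LocallyLipschitz (X j)) :
    Integrable (xGrad X φ) :=
  (h.continuous_xGrad hX).integrable_of_hasCompactSupport h.hasCompactSupport_xGrad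

theorem exists_norm_xGrad_le (h : IsTest Ω φ) (hX : ∀ j, LocallyLipschitz (X j)) :
    ∃ K, ∀ x, ‖xGrad X φ x‖ ≤ K :=
  (h.continuous_xGrad hX).bounded_above_of_compact_support h.hasCompactSupport_xGrad

theorem setIntegral_norm_le (h : IsTest Ω φ) (hX : ∀ j, LocallyLipschitz (X j))
    (S : Set (EuclideanSpace ℝ (Fin N))) :
    ∫ y in S, ‖xGrad X φ y‖ ≤ ∫ y, ‖xGrad X φ y‖ :=
  setIntegral_le_integral (h.integrable_xGrad hX).norm (Eventually.of_forall fun _ => norm_nonneg _)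

end IsTest

/-- The sum is geometric on both sides of scale `1`. For the induction, the bound beyond `1` carries
the term `- c ρ^{1-s}`, where `c = 1 / (2^{s-1} - 1)` is chosen so that `c (ρ/2)^{1-s} = c ρ^{1-s} +
ρ^{1-s}`: the correction telescopes. -/
theorem sum_min_rpow_le {s : ℝ} (hs : 1 < s) {f : ℝ → ℝ}
    (hf1 : ∀ ρ, 0 < ρ → f ρ ≤ ρ) (hf2 : ∀ ρ, 0 < ρ → f ρ ≤ ρ ^ (1 - s)) (n : ℕ) :
    ∀ ρ : ℝ, 0 < ρ → (ρ ≤ 1 → ∑ i ∈ Finset.range n, f (ρ / 2 ^ i) ≤ 2 * ρ) ∧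
      (1 < ρ → ∑ i ∈ Finset.range n, f (ρ / 2 ^ i) ≤
        3 + 1 / (2 ^ (s - 1) - 1) - 1 / (2 ^ (s - 1) - 1) * ρ ^ (1 - s)) := by
  have hd : 0 < (2 : ℝ) ^ (s - 1) - 1 := sub_pos.2 (Real.one_lt_rpow one_lt_two (by linarith))
  set c := 1 / ((2 : ℝ) ^ (s - 1) - 1) with hc
  have hc0 : 0 < c := by positivity
  have hle1 : ∀ ρ : ℝ, 1 < ρ → ρ ^ (1 - s) ≤ 1 := fun ρ hρ =>
    Real.rpow_le_one_of_one_le_of_nonpos hρ.le (by linarith)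
  induction n with
  | zero =>
    intro ρ hρ
    refine ⟨fun _ => by simp; positivity, fun h1 => ?_⟩
    have := hle1 ρ h1
    simp only [Finset.range_zero, Finset.sum_empty]
    nlinarith
  | succ n ih =>
    intro ρ hρ
    have hsum : ∑ i ∈ Finset.range (n + 1), f (ρ / 2 ^ i) =
        ∑ i ∈ Finset.range n, f (ρ / 2 / 2 ^ i) + f ρ := by
      rw [Finset.sum_range_succ']
      congr 1
      · refine Finset.sum_congr rfl fun i _ => ?_
        rw [pow_succ', div_div]
      · simp
    rw [hsum]
    have ih' := ih (ρ / 2) (by positivity)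
    refine ⟨fun h1 => ?_, fun h1 => ?_⟩
    · have := ih'.1 (by linarith)
      have := hf1 ρ hρ
      linarith
    · have e1 := hle1 ρ h1
      rcases le_or_gt (ρ / 2) 1 with h2 | h2
      · have := ih'.1 h2
        have := hf2 ρ hρ
        nlinarith
      · have e2 := ih'.2 h2
        have e3 := hf2 ρ hρ
        have e4 : (ρ / 2) ^ (1 - s) = 2 ^ (s - 1) * ρ ^ (1 - s) := by
          rw [Real.div_rpow hρ.le zero_le_two, div_eq_mul_inv, ← Real.rpow_neg zero_le_two, mul_comm,
            neg_sub]
        have e5 : c * (2 ^ (s - 1) * ρ ^ (1 - s)) = c * ρ ^ (1 - s) + ρ ^ (1 - s) := by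
          rw [hc]; field_simp; ring
        rw [e4, e5] at e2
        linarith

/-- Hedberg's interpolation between the bounds `m_i ≤ a` and `m_i ≤ b r_i^{-s}`. -/
theorem sum_hedberg_le {s : ℝ} (hs : 1 < s) : ∃ K : ℝ, 0 ≤ K ∧ ∀ (R a b : ℝ) (μ : ℝ → ℝ), 0 < R →
    0 ≤ a → 0 ≤ b → (∀ r, 0 < r → r ≤ R → μ r ≤ a) → (∀ r, 0 < r → r ≤ R → μ r ≤ b * r ^ (-s)) →
    ∀ n : ℕ, ∑ i ∈ Finset.range n, R / 2 ^ i * μ (R / 2 ^ i) ≤ K * (a ^ (1 - 1 / s) * b ^ (1 / s)) := by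
  have hd : 0 < (2 : ℝ) ^ (s - 1) - 1 := sub_pos.2 (Real.one_lt_rpow one_lt_two (by linarith))
  have hs0 : 0 < s := by linarith
  set c := 1 / ((2 : ℝ) ^ (s - 1) - 1) with hc
  have hc0 : 0 < c := by positivity
  refine ⟨3 + c, by positivity, fun R a b μ hR ha hb h1 h2 n => ?_⟩
  have hri : ∀ i : ℕ, 0 < R / 2 ^ i ∧ R / 2 ^ i ≤ R := fun i =>
    ⟨by positivity, div_le_self hR.le (one_le_pow₀ one_le_two)⟩
  have hnon : 0 ≤ (3 + c) * (a ^ (1 - 1 / s) * b ^ (1 / s)) := by positivity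
  rcases ha.eq_or_lt with ha0 | ha0
  · refine le_trans (Finset.sum_nonpos fun i _ => ?_) hnon
    exact mul_nonpos_of_nonneg_of_nonpos (hri i).1.le (by rw [ha0]; exact h1 _ (hri i).1 (hri i).2)
  rcases hb.eq_or_lt with hb0 | hb0
  · refine le_trans (Finset.sum_nonpos fun i _ => ?_) hnon
    refine mul_nonpos_of_nonneg_of_nonpos (hri i).1.le ?_
    have := h2 _ (hri i).1 (hri i).2
    rwa [← hb0, zero_mul] at this
  -- The scale at which the two bounds coincide, `a = b t^{-s}`. Measured in units of `t`, each term
  -- is at most `a t` times a minimum of powers, and `a t` is the target quantity.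
  set t := (b / a) ^ (1 / s) with ht
  have ht0 : 0 < t := by positivity
  have hat : a * t = a ^ (1 - 1 / s) * b ^ (1 / s) := by
    rw [ht, Real.div_rpow hb ha, Real.rpow_sub ha0, Real.rpow_one]; ring
  have hts : t ^ s = b / a := by
    rw [ht, ← Real.rpow_mul (by positivity), one_div_mul_cancel hs0.ne', Real.rpow_one]
  have key := sum_min_rpow_le hs (f := fun ρ => min ρ (ρ ^ (1 - s)))
    (fun ρ _ => min_le_left _ _) (fun ρ _ => min_le_right _ _) n (R / t) (by positivity)
  have hbound : ∑ i ∈ Finset.range n, min (R / t / 2 ^ i) ((R / t / 2 ^ i) ^ (1 - s)) ≤ 3 + c := by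
    rcases le_or_gt (R / t) 1 with h3 | h3
    · linarith [key.1 h3]
    · have : 0 ≤ c * (R / t) ^ (1 - s) := by positivity
      linarith [key.2 h3]
  calc ∑ i ∈ Finset.range n, R / 2 ^ i * μ (R / 2 ^ i)
      ≤ ∑ i ∈ Finset.range n, (a * t) * min (R / t / 2 ^ i) ((R / t / 2 ^ i) ^ (1 - s)) := by
        refine Finset.sum_le_sum fun i _ => ?_
        obtain ⟨hr0, hrR⟩ := hri i
        set r := R / 2 ^ i
        have hrt : R / t / 2 ^ i = r / t := by rw [div_right_comm]
        rw [hrt, mul_min_of_nonneg _ _ (by positivity)]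
        refine le_min ?_ ?_
        · calc r * μ r ≤ r * a := by gcongr; exact h1 r hr0 hrR
            _ = _ := by field_simp
        · calc r * μ r ≤ r * (b * r ^ (-s)) := by gcongr; exact h2 r hr0 hrR
            _ = _ := by
              rw [Real.div_rpow hr0.le ht0.le, Real.rpow_sub ht0, Real.rpow_sub hr0, hts,
                Real.rpow_neg hr0.le, Real.rpow_one, Real.rpow_one]
              field_simp
    _ ≤ (a * t) * (3 + c) := by
        rw [← Finset.mul_sum]; gcongr
    _ = _ := by rw [hat]; ring

/-! ### The Poincaré inequality along chains of shrinking balls -/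

namespace GeometricSetting

theorem exists_poincare (h : GeometricSetting X D Q) :
    ∃ C ν : ℝ, 0 < C ∧ 0 < ν ∧ ∀ x ∈ D, ∀ r : ℝ, 0 < r → ∀ φ, IsTest Ω φ →
      (⨍ y in ccBall X D x r, |φ y - ⨍ z in ccBall X D x r, φ z|) ≤
      C * r * ⨍ y in ccBall X D x (ν * r), ‖xGrad X φ y‖ := by
  obtain ⟨C, ν, hC, hν, hP⟩ := h.geo.poincare
  refine ⟨C, ν, hC, hν, fun x hx r hr φ hφ => hP x hx r hr φ
    ⟨univ, isOpen_univ, subset_univ _, (hφ.1.of_le (by simp)).contDiffOn⟩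
    hφ.integrable.integrableOn (hφ.integrable_xGrad h.lip).integrableOn⟩

/-- Used with `K = 2 ^ Q` for consecutive balls of a chain, and with `K = 1`, `B = B'` for the
convergence of means. -/
theorem abs_setAverage_sub_le {B B' : Set (EuclideanSpace ℝ (Fin N))} {u : EuclideanSpace ℝ (Fin N) → ℝ}
    (hu : Integrable u) (hB : volume B ≠ 0) (hB' : volume B' ≠ ⊤) (hsub : B ⊆ B') {c K : ℝ}
    (hK : volume.real B' ≤ K * volume.real B) :
    |(⨍ y in B, u y) - c| ≤ K * ⨍ y in B', |u y - c| := by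
  have hBt : volume B ≠ ⊤ := ((measure_mono hsub).trans_lt hB'.lt_top).ne
  have hp : 0 < volume.real B := ENNReal.toReal_pos hB hBt
  have hp' : 0 < volume.real B' := hp.trans_le (ENNReal.toReal_mono hB' (measure_mono hsub))
  have hint : IntegrableOn (fun y => u y - c) B' :=
    hu.integrableOn.sub (integrableOn_const hB')
  have e1 : (⨍ y in B, u y) - c = (volume.real B)⁻¹ * ∫ y in B, (u y - c) := by
    rw [setAverage_eq, integral_sub hu.integrableOn (integrableOn_const hBt), setIntegral_const,
      smul_eq_mul, smul_eq_mul]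
    field_simp
  rw [e1, abs_mul, abs_of_pos (inv_pos.2 hp), setAverage_eq, smul_eq_mul]
  have e2 : |∫ y in B, (u y - c)| ≤ ∫ y in B', |u y - c| :=
    (abs_integral_le_integral_abs).trans (setIntegral_mono_set hint.abs
      (Eventually.of_forall fun _ => abs_nonneg _) hsub.eventuallyLE)
  calc (volume.real B)⁻¹ * |∫ y in B, (u y - c)|
      ≤ (K * (volume.real B')⁻¹) * ∫ y in B', |u y - c| := by
        refine mul_le_mul ?_ e2 (abs_nonneg _) ?_
        · rw [inv_eq_one_div, div_le_iff₀ hp, mul_assoc, mul_comm, mul_assoc,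
            inv_mul_eq_div, le_div_iff₀ hp', one_mul]
          linarith
        · have : 0 ≤ K := by
            by_contra hneg
            nlinarith
          positivity
    _ = _ := by ring

/-- Small control balls lie in small Euclidean balls, so continuity of `u` suffices and the limit
holds at every point of `D`. -/
theorem tendsto_setAverage_ball (h : GeometricSetting X D Q) {u : EuclideanSpace ℝ (Fin N) → ℝ}
    (hu : Continuous u) (hui : Integrable u) {x : EuclideanSpace ℝ (Fin N)} (hx : x ∈ D) {R : ℝ}
    (hR : 0 < R) :
    Tendsto (fun n : ℕ => ⨍ y in ccBall X D x (R / 2 ^ n), u y) atTop (𝓝 (u x)) := by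
  rw [Metric.tendsto_atTop]
  intro ε hε
  obtain ⟨δ, hδ, hδu⟩ := Metric.continuous_iff.1 hu x (ε / 2) (by positivity)
  obtain ⟨s, hs, hsub⟩ := exists_ccBall_subset_ball h.lip h.geo.connected hx hδ
  obtain ⟨k, hk⟩ := pow_unbounded_of_one_lt (R / s) (one_lt_two (α := ℝ))
  refine ⟨k, fun n hn => ?_⟩
  have hr : 0 < R / 2 ^ n := by positivity
  have hrs : R / 2 ^ n ≤ s := by
    rw [div_lt_iff₀ hs] at hk
    rw [div_le_iff₀ (by positivity)]
    have : (2 : ℝ) ^ k ≤ 2 ^ n := pow_le_pow_right₀ one_le_two hn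
    nlinarith
  set B := ccBall X D x (R / 2 ^ n)
  have hB0 := (h.volume_ball_pos hx hr).ne'
  have hBt := (h.volume_ball_lt_top hx (R / 2 ^ n)).ne
  have h1 := abs_setAverage_sub_le hui hB0 hBt subset_rfl (c := u x) (K := 1) (by simp)
  rw [Real.dist_eq]
  refine h1.trans_lt ?_
  rw [one_mul, setAverage_eq, smul_eq_mul]
  have hp := h.real_volume_ball_pos hx hr
  have h2 : ∫ y in B, |u y - u x| ≤ ∫ y in B, ε / 2 := by
    refine setIntegral_mono_on (hui.integrableOn.sub (integrableOn_const hBt)).abs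
      (integrableOn_const hBt) (h.isOpen_ball hx _).measurableSet fun y hy => ?_
    have := hδu y (hsub (ccBall_mono x hrs hy))
    rw [Real.dist_eq] at this
    exact this.le
  rw [setIntegral_const, smul_eq_mul] at h2
  rw [inv_mul_eq_div, div_lt_iff₀ hp]
  nlinarith

/-- The pointwise estimate by means over a chain of balls. -/
theorem exists_abs_le_sum (h : GeometricSetting X D Q) :
    ∃ C ν : ℝ, 0 < C ∧ 0 < ν ∧ ∀ x ∈ D, ∀ R : ℝ, 0 < R → ∀ φ, IsTest Ω φ → ∀ S : ℝ,
      (∀ n : ℕ, ∑ i ∈ Finset.range n, R / 2 ^ i *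
        (⨍ y in ccBall X D x (ν * (R / 2 ^ i)), ‖xGrad X φ y‖) ≤ S) →
      |φ x| ≤ |⨍ y in ccBall X D x R, φ y| + C * S := by
  obtain ⟨C, ν, hC, hν, hP⟩ := h.exists_poincare (Ω := Ω)
  refine ⟨2 ^ Q * C, ν, by positivity, hν, fun x hx R hR φ hφ S hS => ?_⟩
  set a : ℕ → ℝ := fun n => ⨍ y in ccBall X D x (R / 2 ^ n), φ y with ha
  have hstep : ∀ i : ℕ, |a (i + 1)| ≤ |a i| + 2 ^ Q * C * (R / 2 ^ i *
      (⨍ y in ccBall X D x (ν * (R / 2 ^ i)), ‖xGrad X φ y‖)) := by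
    intro i
    have hr : 0 < R / 2 ^ i := by positivity
    have hr' : 0 < R / 2 ^ (i + 1) := by positivity
    have h2 : R / 2 ^ i = 2 ^ 1 * (R / 2 ^ (i + 1)) := by field_simp; ring
    -- The mean over the half ball differs from `a i` by at most `2 ^ Q` times the oscillation over
    -- the whole ball, which the Poincaré inequality bounds.
    have e1 := abs_setAverage_sub_le hφ.integrable (c := a i) (h.volume_ball_pos hx hr').ne'
      (h.volume_ball_lt_top hx (R / 2 ^ i)).ne
      (ccBall_mono x (by rw [h2]; linarith)) (K := 2 ^ Q) (by
        have := h.real_volume_ball_iterate_le hx hr' 1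
        rwa [← h2, pow_one] at this)
    have e2 := hP x hx _ hr φ hφ
    have e3 : (2 : ℝ) ^ Q * (⨍ y in ccBall X D x (R / 2 ^ i), |φ y - a i|) ≤
        2 ^ Q * (C * (R / 2 ^ i) * ⨍ y in ccBall X D x (ν * (R / 2 ^ i)), ‖xGrad X φ y‖) := by
      gcongr
    have e4 : |a (i + 1)| - |a i| ≤ |a (i + 1) - a i| := abs_sub_abs_le_abs_sub _ _
    linarith
  have hn : ∀ n : ℕ, |a n| ≤ |a 0| + 2 ^ Q * C * ∑ i ∈ Finset.range n, R / 2 ^ i *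
      (⨍ y in ccBall X D x (ν * (R / 2 ^ i)), ‖xGrad X φ y‖) := by
    intro n
    induction n with
    | zero => simp
    | succ n ih =>
      rw [Finset.sum_range_succ, mul_add]
      linarith [hstep n]
  have ha0 : a 0 = ⨍ y in ccBall X D x R, φ y := by simp [ha]
  rw [← ha0]
  refine le_of_tendsto (h.tendsto_setAverage_ball hφ.continuous hφ.integrable hx hR).abs
    (Eventually.of_forall fun n => (hn n).trans ?_)
  have := hS n
  gcongr

end GeometricSetting

end

section

variable {N m : ℕ} {X : VectorFields N m} {D Ω : Set (EuclideanSpace ℝ (Fin N))} {Q : ℝ}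

/-! ### The Sobolev inequality for test functions -/

theorem setLIntegral_le_eLpNorm_two {g : EuclideanSpace ℝ (Fin N) → ℝ} (hg : Measurable g)
    (hg0 : ∀ x, 0 ≤ g x) (B : Set (EuclideanSpace ℝ (Fin N))) :
    ∫⁻ y in B, ENNReal.ofReal (g y) ≤ eLpNorm g 2 volume * volume B ^ (1 / 2 : ℝ) := by
  have h1 := eLpNorm_le_eLpNorm_mul_rpow_measure_univ (μ := volume.restrict B) (p := 1) (q := 2)
    one_le_two hg.aestronglyMeasurable
  rw [eLpNorm_one_eq_lintegral_enorm] at h1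
  calc ∫⁻ y in B, ENNReal.ofReal (g y) = ∫⁻ y in B, ‖g y‖ₑ := by
        refine lintegral_congr fun y => ?_
        rw [Real.enorm_eq_ofReal (hg0 y)]
    _ ≤ _ := h1
    _ ≤ eLpNorm g 2 volume * volume B ^ (1 / 2 : ℝ) := by
        gcongr
        · exact Measure.restrict_le_self
        · rw [Measure.restrict_apply MeasurableSet.univ, univ_inter,
            show 1 / (1 : ℝ≥0∞).toReal - 1 / (2 : ℝ≥0∞).toReal = 1 / 2 by norm_num]

/-- The `L^1` Friedrichs inequality on `Ω`. -/
def HasFriedrichs (X : VectorFields N m) (Ω : Set (EuclideanSpace ℝ (Fin N))) : Prop :=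
  ∃ C : ℝ, ∀ φ, IsTest Ω φ → ∫ y, |φ y| ≤ C * ∫ y, ‖xGrad X φ y‖

/-- The Sobolev inequality with exponent `p` on `Ω`, for test functions. -/
def HasSobolev (X : VectorFields N m) (Ω : Set (EuclideanSpace ℝ (Fin N))) (p : ℝ≥0∞) : Prop :=
  ∃ C : ℝ≥0∞, C ≠ ⊤ ∧ ∀ φ, IsTest Ω φ →
    eLpNorm φ p (volume.restrict Ω) ≤ C * eLpNorm (xGrad X φ) 2 (volume.restrict Ω)

namespace GeometricSetting

/-- Hedberg's argument. Write `G` for the `L^2` norm of `Xφ` and `M` for its maximal function. The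
mean over the ball of radius `R` costs `A₁ G` by Friedrichs, and the chain of balls costs `A₂
G^{2/Q} M^{1-2/Q}`; then one integrates. Since the dilation `ν` of the Poincaré inequality may be
less than `1`, `R` is taken so large that both `R` and `ν R` exceed the diameter of the given ball.
-/
theorem hasSobolev (h : GeometricSetting X D Q) (hΩ : IsOpen Ω)
    {x₀ : EuclideanSpace ℝ (Fin N)} (hx₀ : x₀ ∈ D) {R₀ : ℝ} (hR₀ : 0 < R₀)
    (hΩB : Ω ⊆ ccBall X D x₀ R₀) (hF : HasFriedrichs X Ω) :
    HasSobolev X Ω (ENNReal.ofReal (2 * Q / (Q - 2))) := by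
  obtain ⟨CF, hCF⟩ := hF
  obtain ⟨C, ν, hC, hν, hP⟩ := h.exists_abs_le_sum (Ω := Ω)
  have hQ := h.two_lt
  have hQ2 : 0 < Q - 2 := by linarith
  obtain ⟨K, hK0, hK⟩ := sum_hedberg_le (s := Q / 2) (by linarith)
  have hΩD : Ω ⊆ D := fun x hx => (hΩB hx).1
  have hΩt : volume Ω ≠ ⊤ := ((measure_mono hΩB).trans_lt (h.volume_ball_lt_top hx₀ R₀)).ne
  set V₀ := volume.real (ccBall X D x₀ R₀) with hV₀
  have hV₀p : 0 < V₀ := h.real_volume_ball_pos hx₀ hR₀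
  -- large balls contain `Ω`
  set R := 2 * R₀ * max 1 ν⁻¹ with hR
  have hR2 : 2 * R₀ ≤ R := le_mul_of_one_le_right (by positivity) (le_max_left _ _)
  have hRν : 2 * R₀ ≤ ν * R := by
    have : ν * ν⁻¹ ≤ ν * max 1 ν⁻¹ := by gcongr; exact le_max_right _ _
    rw [mul_inv_cancel₀ hν.ne'] at this
    rw [hR]; nlinarith
  have hRp : 0 < R := by linarith
  have hbig : ∀ x ∈ Ω, ∀ r, 2 * R₀ ≤ r → ccBall X D x₀ R₀ ⊆ ccBall X D x r := fun x hx r hr => by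
    refine h.ball_subset_ball hx₀ (hΩD hx) ?_
    rw [h.comm]
    linarith [(hΩB hx).2]
  -- lower bound for the volume of balls
  set c := V₀ / (2 * R) ^ Q with hc
  have hcp : 0 < c := by positivity
  have hlow : ∀ x ∈ Ω, ∀ r, 0 < r → r ≤ R → c * r ^ Q ≤ volume.real (ccBall X D x (ν * r)) := by
    intro x hx r hr hrR
    have e1 := h.real_volume_ball_le (hΩD hx) (r := ν * r) (R := ν * R) (by positivity) (by gcongr)
    have e2 := h.real_volume_ball_mono (hΩD hx) (hbig x hx _ hRν)
    have e3 : 2 * (ν * R) / (ν * r) = 2 * R / r := by field_simp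
    rw [e3, Real.div_rpow (by positivity) hr.le, div_mul_eq_mul_div, le_div_iff₀ (by positivity)] at e1
    rw [hc, div_mul_eq_mul_div, div_le_iff₀ (by positivity)]
    have : V₀ * r ^ Q ≤ volume.real (ccBall X D x (ν * R)) * r ^ Q := by gcongr
    linarith
  set p := ENNReal.ofReal (2 * Q / (Q - 2)) with hp
  have hexp : 0 < 1 - 1 / (Q / 2) := by
    rw [sub_pos, div_lt_one (by positivity)]; linarith
  have hexp2 : 0 ≤ 1 / (Q / 2) := by positivity
  set σ := 1 - 1 / (Q / 2) with hσ
  set V := volume.real Ω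
  -- the constants
  set A₁ := V₀⁻¹ * |CF| * V ^ (1 / 2 : ℝ)
  set A₂ := C * K * (c ^ (-(1 / 2) : ℝ)) ^ (1 / (Q / 2))
  have hA₁ : 0 ≤ A₁ := by positivity
  have hA₂ : 0 ≤ A₂ := by positivity
  set L : ℝ≥0∞ := ENNReal.ofReal A₁ * volume Ω ^ (1 / p.toReal) +
    ENNReal.ofReal A₂ * ((8 * ENNReal.ofReal (2 ^ Q) ^ 3) ^ (1 / 2 : ℝ)) ^ σ with hL
  have hLt : L ≠ ⊤ := by
    have hnn : 0 ≤ 1 / p.toReal := by positivity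
    refine ENNReal.add_ne_top.2 ⟨ENNReal.mul_ne_top ENNReal.ofReal_ne_top
      (ENNReal.rpow_ne_top_of_nonneg hnn hΩt), ENNReal.mul_ne_top ENNReal.ofReal_ne_top
      (ENNReal.rpow_ne_top_of_nonneg hexp.le (ENNReal.rpow_ne_top_of_nonneg (by norm_num) ?_))⟩
    exact ENNReal.mul_ne_top (by norm_num) (ENNReal.pow_ne_top ENNReal.ofReal_ne_top)
  refine ⟨L, hLt, fun φ hφ => ?_⟩
  set g : EuclideanSpace ℝ (Fin N) → ℝ := fun y => ‖xGrad X φ y‖ with hg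
  have hgm : Measurable g := (hφ.continuous_xGrad h.lip).norm.measurable
  have hg0 : ∀ y, 0 ≤ g y := fun y => norm_nonneg _
  have hgi : Integrable g := (hφ.integrable_xGrad h.lip).norm
  obtain ⟨Kg, hKg⟩ := hφ.exists_norm_xGrad_le h.lip
  have hgL2 : eLpNorm g 2 volume = eLpNorm (xGrad X φ) 2 (volume.restrict Ω) := by
    rw [hg, eLpNorm_norm, eLpNorm_restrict_eq_of_support_subset]
    intro y hy
    by_contra hc
    exact hy (hφ.xGrad_eq_zero hc)
  have hgLt : eLpNorm g 2 volume ≠ ⊤ := by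
    have : MemLp g 2 volume := by
      rw [hg]
      exact ((hφ.continuous_xGrad h.lip).memLp_of_hasCompactSupport hφ.hasCompactSupport_xGrad).norm
    exact this.eLpNorm_ne_top
  set G := (eLpNorm g 2 volume).toReal with hG
  have hG0 : 0 ≤ G := ENNReal.toReal_nonneg
  have hGe : eLpNorm g 2 volume = ENNReal.ofReal G := (ENNReal.ofReal_toReal hgLt).symm
  have hCS : ∀ B : Set (EuclideanSpace ℝ (Fin N)), volume B ≠ ⊤ →
      ∫ y in B, g y ≤ G * volume.real B ^ (1 / 2 : ℝ) := by
    intro B hB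
    have e1 := setLIntegral_le_eLpNorm_two hgm hg0 B
    rw [← ofReal_integral_eq_lintegral_ofReal hgi.integrableOn (Eventually.of_forall hg0)] at e1
    have e2 := ENNReal.toReal_mono (ENNReal.mul_ne_top hgLt
      (ENNReal.rpow_ne_top_of_nonneg (by norm_num) hB)) e1
    rwa [ENNReal.toReal_ofReal (integral_nonneg hg0), ENNReal.toReal_mul, ← ENNReal.toReal_rpow] at e2
  set M := maximalFun X D (ν * R) (fun y => ENNReal.ofReal (g y)) with hM
  have hMt : ∀ x, M x ≠ ⊤ := fun x =>
    ((maximalFun_le (fun x => ENNReal.ofReal_le_ofReal (hKg x)) x).trans_lt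
      ENNReal.ofReal_lt_top).ne
  -- pointwise estimate
  have hpt : ∀ x ∈ Ω, |φ x| ≤ A₁ * G + A₂ * G ^ (1 / (Q / 2)) * (M x).toReal ^ σ := by
    intro x hx
    have hxD := hΩD hx
    have hball : ∀ r, 0 < r → 0 < volume.real (ccBall X D x (ν * r)) := fun r hr =>
      h.real_volume_ball_pos hxD (by positivity)
    have hm1 : ∀ r, 0 < r → r ≤ R → (⨍ y in ccBall X D x (ν * r), g y) ≤ (M x).toReal := by
      intro r hr hrR
      refine (ENNReal.ofReal_le_iff_le_toReal (hMt x)).1 ?_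
      rw [ofReal_setAverage hgi.integrableOn (Eventually.of_forall hg0)]
      exact le_iSup₂ (f := fun (p : EuclideanSpace ℝ (Fin N) × ℝ)
          (_ : (p.1 ∈ D ∧ 0 < p.2 ∧ p.2 ≤ ν * R) ∧ x ∈ ccBall X D p.1 p.2) =>
          (∫⁻ y in ccBall X D p.1 p.2, ENNReal.ofReal (g y)) / volume (ccBall X D p.1 p.2))
          (x, ν * r) ⟨⟨hxD, by positivity, mul_le_mul_of_nonneg_left hrR hν.le⟩, mem_ccBall_self hxD (by positivity)⟩
    -- Cauchy–Schwarz bounds the mean by `G W^{-1/2}`, with `W` the volume of the ball, and `W ≥ c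
    -- r^Q`.
    have hm2 : ∀ r, 0 < r → r ≤ R → (⨍ y in ccBall X D x (ν * r), g y) ≤
        (c ^ (-(1 / 2) : ℝ) * G) * r ^ (-(Q / 2)) := by
      intro r hr hrR
      have hb := hball r hr
      have e1 := hCS _ (h.volume_ball_lt_top hxD (ν * r)).ne
      rw [setAverage_eq, smul_eq_mul, inv_mul_eq_div, div_le_iff₀ hb]
      refine e1.trans ?_
      set W := volume.real (ccBall X D x (ν * r)) with hW
      have e2 : W ^ (1 / 2 : ℝ) = W ^ (-(1 / 2) : ℝ) * W := by
        rw [← Real.rpow_add_one hb.ne']; norm_num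
      have e3 : W ^ (-(1 / 2) : ℝ) ≤ (c * r ^ Q) ^ (-(1 / 2) : ℝ) :=
        Real.rpow_le_rpow_of_nonpos (by positivity) (hlow x hx r hr hrR) (by norm_num)
      have e4 : (c * r ^ Q) ^ (-(1 / 2) : ℝ) = c ^ (-(1 / 2) : ℝ) * r ^ (-(Q / 2)) := by
        rw [Real.mul_rpow hcp.le (by positivity), ← Real.rpow_mul hr.le]
        congr 2; ring
      rw [e4] at e3
      rw [e2]
      calc G * (W ^ (-(1 / 2) : ℝ) * W) ≤ G * ((c ^ (-(1 / 2) : ℝ) * r ^ (-(Q / 2))) * W) := by gcongr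
        _ = _ := by ring
    have hsum := hK R (M x).toReal (c ^ (-(1 / 2) : ℝ) * G)
      (fun r => ⨍ y in ccBall X D x (ν * r), g y) hRp ENNReal.toReal_nonneg (by positivity) hm1 hm2
    have e5 := hP x hxD R hRp φ hφ _ hsum
    have e6 : |⨍ y in ccBall X D x R, φ y| ≤ A₁ * G := by
      have hVR : V₀ ≤ volume.real (ccBall X D x R) := h.real_volume_ball_mono hxD (hbig x hx _ hR2)
      have e7 : ∫ y, g y = ∫ y in Ω, g y :=
        (setIntegral_eq_integral_of_forall_compl_eq_zero fun y hy => by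
          simp [hg, hφ.xGrad_eq_zero hy]).symm
      have e8 : ∫ y in ccBall X D x R, |φ y| ≤ ∫ y, |φ y| :=
        setIntegral_le_integral hφ.integrable.abs (Eventually.of_forall fun _ => abs_nonneg _)
      have e9 : ∫ y, |φ y| ≤ |CF| * (G * V ^ (1 / 2 : ℝ)) := by
        refine (hCF φ hφ).trans ?_
        have : 0 ≤ ∫ y, g y := integral_nonneg hg0
        calc CF * ∫ y, g y ≤ |CF| * ∫ y, g y := by gcongr; exact le_abs_self _
          _ ≤ _ := by rw [e7]; gcongr; exact hCS Ω hΩt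
      rw [setAverage_eq, smul_eq_mul, abs_mul, abs_of_nonneg (by positivity)]
      calc (volume.real (ccBall X D x R))⁻¹ * |∫ y in ccBall X D x R, φ y|
          ≤ V₀⁻¹ * (|CF| * (G * V ^ (1 / 2 : ℝ))) := by
            gcongr
            exact (abs_integral_le_integral_abs).trans (e8.trans e9)
        _ = _ := by simp only [A₁]; ring
    refine e5.trans (add_le_add e6 (le_of_eq ?_))
    rw [Real.mul_rpow (by positivity) hG0]
    simp only [A₂]; ring
  -- integration
  have hp1 : 1 ≤ p := by
    rw [hp, ENNReal.one_le_ofReal, le_div_iff₀ hQ2]; linarith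
  -- With `σ = 1 - 2/Q` the exponents match, so the `L^p` norm of `M^σ` is the `σ`-th power of the
  -- `L^2` norm of `M`.
  have hpσ : p * ENNReal.ofReal σ = 2 := by
    rw [hp, ← ENNReal.ofReal_mul (by positivity), ← ENNReal.ofReal_ofNat]
    congr 1
    rw [hσ]; field_simp
  have hMm : Measurable fun x => (M x).toReal := (h.measurable_maximalFun _ _).ennreal_toReal
  have hMnorm : eLpNorm (fun x => (M x).toReal) 2 (volume.restrict Ω) ≤
      (8 * ENNReal.ofReal (2 ^ Q) ^ 3) ^ (1 / 2 : ℝ) * ENNReal.ofReal G := by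
    have hstrong := h.maximalFun_strong (ν * R) hgm hKg
    have hsq : ∀ (f : EuclideanSpace ℝ (Fin N) → ℝ),
        eLpNorm f 2 volume = (∫⁻ x, ‖f x‖ₑ ^ 2) ^ (1 / 2 : ℝ) := fun f => by
      rw [eLpNorm_eq_lintegral_rpow_enorm_toReal two_ne_zero ENNReal.ofNat_ne_top]
      simp
    refine (eLpNorm_mono_measure _ Measure.restrict_le_self).trans ?_
    rw [← hGe, hsq, hsq, ← ENNReal.mul_rpow_of_nonneg _ _ (by norm_num)]
    refine ENNReal.rpow_le_rpow ?_ (by norm_num)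
    convert hstrong using 2
    · ext x
      rw [Real.enorm_eq_ofReal ENNReal.toReal_nonneg, ENNReal.ofReal_toReal (hMt x)]
    · congr 1; ext x
      rw [Real.enorm_eq_ofReal (hg0 x)]
  calc eLpNorm φ p (volume.restrict Ω)
      ≤ eLpNorm (fun x => A₁ * G + A₂ * G ^ (1 / (Q / 2)) * (M x).toReal ^ σ) p (volume.restrict Ω) := by
        refine eLpNorm_mono_ae_real ?_
        filter_upwards [ae_restrict_mem hΩ.measurableSet] with x hx using hpt x hx
    _ ≤ eLpNorm (fun _ => A₁ * G) p (volume.restrict Ω) +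
        eLpNorm (fun x => A₂ * G ^ (1 / (Q / 2)) * (M x).toReal ^ σ) p (volume.restrict Ω) :=
        eLpNorm_add_le aestronglyMeasurable_const
          ((hMm.pow_const σ).const_mul _).aestronglyMeasurable hp1
    _ ≤ ENNReal.ofReal (A₁ * G) * volume Ω ^ (1 / p.toReal) +
        ENNReal.ofReal (A₂ * G ^ (1 / (Q / 2))) *
          ((8 * ENNReal.ofReal (2 ^ Q) ^ 3) ^ (1 / 2 : ℝ) * ENNReal.ofReal G) ^ σ := by
        refine add_le_add ?_ ?_
        · refine (eLpNorm_const' _ (one_pos.trans_le hp1).ne' ENNReal.ofReal_ne_top).trans_le (le_of_eq ?_)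
          rw [Real.enorm_eq_ofReal (by positivity), Measure.restrict_apply MeasurableSet.univ,
            univ_inter]
        · have e1 := eLpNorm_const_smul_le (c := A₂ * G ^ (1 / (Q / 2)))
            (f := fun x => (M x).toReal ^ σ) (p := p) (μ := volume.restrict Ω)
          refine e1.trans ?_
          rw [Real.enorm_eq_ofReal (by positivity)]
          gcongr
          have e2 := eLpNorm_norm_rpow (p := p) (μ := volume.restrict Ω)
            (fun x => (M x).toReal) hexp
          simp only [Real.norm_of_nonneg ENNReal.toReal_nonneg] at e2
          rw [e2, hpσ]
          exact ENNReal.rpow_le_rpow hMnorm hexp.le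
    _ = L * ENNReal.ofReal G := by
        rw [hL, ENNReal.mul_rpow_of_nonneg _ _ hexp.le, ENNReal.ofReal_mul hA₁,
          ENNReal.ofReal_mul hA₂, ← ENNReal.ofReal_rpow_of_nonneg hG0 hexp2]
        have e1 : ENNReal.ofReal G ^ (1 / (Q / 2)) * ENNReal.ofReal G ^ σ = ENNReal.ofReal G := by
          rw [← ENNReal.rpow_add_of_nonneg _ _ hexp2 hexp.le, hσ, add_sub_cancel, ENNReal.rpow_one]
        rw [add_mul]
        congr 1
        · ring
        · calc _ = ENNReal.ofReal A₂ * ((8 * ENNReal.ofReal (2 ^ Q) ^ 3) ^ (1 / 2 : ℝ)) ^ σ *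
              (ENNReal.ofReal G ^ (1 / (Q / 2)) * ENNReal.ofReal G ^ σ) := by ring
            _ = _ := by rw [e1]
    _ = _ := by rw [← hGe, hgL2]

end GeometricSetting

end

section

variable {N m : ℕ} {X : VectorFields N m} {D Ω : Set (EuclideanSpace ℝ (Fin N))} {Q : ℝ}

/-! ### The Friedrichs inequality when the geometry is that of the whole space -/

theorem iUnion_ccBall_nat {x : EuclideanSpace ℝ (Fin N)} :
    ⋃ n : ℕ, ccBall X D x n = D := by
  refine subset_antisymm (iUnion_subset fun n => ccBall_subset _ _) fun y hy => ?_
  obtain ⟨n, hn⟩ := exists_nat_gt (ccDist X D x y)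
  exact mem_iUnion.2 ⟨n, hy, hn⟩

theorem monotone_ccBall_nat {x : EuclideanSpace ℝ (Fin N)} :
    Monotone fun n : ℕ => ccBall X D x n := fun _ _ h => ccBall_mono x (by exact_mod_cast h)

theorem tendsto_volume_ccBall_nat (X : VectorFields N m) (D : Set (EuclideanSpace ℝ (Fin N)))
    (x : EuclideanSpace ℝ (Fin N)) :
    Tendsto (fun n : ℕ => volume (ccBall X D x n)) atTop (𝓝 (volume D)) := by
  have := tendsto_measure_iUnion_atTop (μ := volume) (monotone_ccBall_nat (X := X) (D := D) (x := x))
  rwa [iUnion_ccBall_nat] at this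

namespace GeometricSetting

/-- The oscillation of a test function over a ball is controlled by its `X`-gradient. -/
theorem exists_integral_sub_average_le (h : GeometricSetting X D Q)
    {x : EuclideanSpace ℝ (Fin N)} (hx : x ∈ D) {R : ℝ} (hR : 0 < R) :
    ∃ K : ℝ, 0 ≤ K ∧ ∀ φ, IsTest Ω φ →
      ∫ y in ccBall X D x R, |φ y - ⨍ z in ccBall X D x R, φ z| ≤ K * ∫ y, ‖xGrad X φ y‖ := by
  obtain ⟨C, ν, hC, hν, hP⟩ := h.exists_poincare (Ω := Ω)
  set V := volume.real (ccBall X D x R)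
  set W := volume.real (ccBall X D x (ν * R))
  have hV : 0 < V := h.real_volume_ball_pos hx hR
  have hW : 0 < W := h.real_volume_ball_pos hx (by positivity)
  refine ⟨V * (C * R * W⁻¹), by positivity, fun φ hφ => ?_⟩
  have h1 := hP x hx R hR φ hφ
  rw [setAverage_eq, setAverage_eq volume (fun y => ‖xGrad X φ y‖), smul_eq_mul, smul_eq_mul, inv_mul_le_iff₀ hV] at h1
  refine h1.trans ?_
  have h2 := hφ.setIntegral_norm_le h.lip (ccBall X D x (ν * R))
  calc V * (C * R * (W⁻¹ * ∫ y in ccBall X D x (ν * R), ‖xGrad X φ y‖))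
      ≤ V * (C * R * (W⁻¹ * ∫ y, ‖xGrad X φ y‖)) := by gcongr
    _ = _ := by ring

/-- On the whole space the control balls are open and exhaust, so compactness of the closure of `Ω`
applies. -/
theorem exists_subset_ball (h : GeometricSetting X univ Q) (hΩ : Bornology.IsBounded Ω) (x : EuclideanSpace ℝ (Fin N)) :
    ∃ n : ℕ, 0 < n ∧ Ω ⊆ ccBall X univ x n := by
  obtain ⟨n, hn⟩ := hΩ.isCompact_closure.elim_directed_cover (fun n : ℕ => ccBall X univ x n)
    (fun n => h.isOpen_ball (mem_univ x) n)
    (by rw [iUnion_ccBall_nat]; exact subset_univ _)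
    monotone_ccBall_nat.directed_le
  exact ⟨n + 1, n.succ_pos, (subset_closure.trans hn).trans (monotone_ccBall_nat n.le_succ)⟩

/-- The whole space has infinite volume, so some ball `B ⊇ Ω` has `|B| > 2|Ω|`. The mean `a` of `φ`
over `B` then satisfies `|a| |Ω| ≤ ‖φ‖_1 / 2` and is absorbed by the left-hand side. -/
theorem hasFriedrichs_univ (h : GeometricSetting X univ Q) (hN : 2 ≤ N)
    (hΩ : Bornology.IsBounded Ω) : HasFriedrichs X Ω := by
  have : Nontrivial (EuclideanSpace ℝ (Fin N)) := by
    have : Nonempty (Fin N) := ⟨⟨0, by omega⟩⟩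
    infer_instance
  have htop : volume (univ : Set (EuclideanSpace ℝ (Fin N))) = ⊤ :=
    measure_univ_of_isAddLeftInvariant _
  have hΩt : volume Ω < ⊤ := hΩ.measure_lt_top
  obtain ⟨n₀, hn₀, hsub⟩ := h.exists_subset_ball hΩ 0
  have ht := tendsto_volume_ccBall_nat X univ 0
  rw [htop] at ht
  obtain ⟨n, hn, hnn⟩ := ((ht.eventually (lt_mem_nhds (a := 2 * volume Ω)
    (ENNReal.mul_lt_top (by norm_num) hΩt))).and (eventually_ge_atTop n₀)).exists
  have hsub' : Ω ⊆ ccBall X univ 0 n := hsub.trans (monotone_ccBall_nat hnn)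
  have hn0 : (0 : ℝ) < n := by exact_mod_cast hn₀.trans_le hnn
  obtain ⟨K, hK0, hK⟩ := h.exists_integral_sub_average_le (Ω := Ω) (mem_univ 0) hn0
  refine ⟨2 * K, fun φ hφ => ?_⟩
  set B := ccBall X univ 0 n
  have hBt := (h.volume_ball_lt_top (mem_univ 0) n).ne
  set V := volume.real B
  have hV : 0 < V := h.real_volume_ball_pos (mem_univ 0) hn0
  have hΩV : 2 * volume.real Ω ≤ V := by
    have := ENNReal.toReal_mono hBt hn.le
    rwa [ENNReal.toReal_mul, ENNReal.toReal_ofNat] at this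
  set a := ⨍ z in B, φ z with ha
  have h1 : ∫ y, |φ y| = ∫ y in Ω, |φ y| :=
    (setIntegral_eq_integral_of_forall_compl_eq_zero fun y hy => by simp [hφ.eq_zero hy]).symm
  have hia : IntegrableOn (fun y => |φ y - a|) B :=
    (hφ.integrable.integrableOn.sub (integrableOn_const hBt)).abs
  have h2 : ∫ y in Ω, |φ y| ≤ ∫ y in Ω, (|φ y - a| + |a|) := by
    refine integral_mono hφ.integrable.abs.integrableOn
      ((hia.mono_set hsub').add (integrableOn_const hΩt.ne)) fun y => ?_
    have := abs_add_le (φ y - a) a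
    rwa [sub_add_cancel] at this
  rw [integral_add (hia.mono_set hsub') (integrableOn_const hΩt.ne), setIntegral_const,
    smul_eq_mul] at h2
  have h3 : ∫ y in Ω, |φ y - a| ≤ ∫ y in B, |φ y - a| :=
    setIntegral_mono_set hia (Eventually.of_forall fun _ => abs_nonneg _) hsub'.eventuallyLE
  have h4 : |a| * V ≤ ∫ y, |φ y| := by
    rw [ha, setAverage_eq, smul_eq_mul, abs_mul, abs_of_pos (inv_pos.2 hV), mul_right_comm,
      inv_mul_cancel₀ hV.ne', one_mul]
    exact (abs_integral_le_integral_abs).trans (setIntegral_le_integral hφ.integrable.abs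
      (Eventually.of_forall fun _ => abs_nonneg _))
  have h5 := hK φ hφ
  nlinarith [abs_nonneg a]

/-! ### Bounded diameter when the volume is finite -/

/-- Suppose `y` is at distance `ρ ≥ 3n` from `x`. The ball at `y` of radius `ρ - n` misses `B(x,
n)`, while its double contains `B(x, n)`; by doubling, `(1 + q)|B(x, n)| ≤ |D|` with `q = 2^{-Q}`.
This fails once `B(x, n)` nearly fills `D`. -/
theorem exists_eq_ball (h : GeometricSetting X D Q) (hD : volume D ≠ ⊤)
    {x : EuclideanSpace ℝ (Fin N)} (hx : x ∈ D) : ∃ R : ℝ, 0 < R ∧ D = ccBall X D x R := by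
  have hpos : 0 < volume.real D := by
    refine (h.real_volume_ball_pos hx one_pos).trans_le
      (ENNReal.toReal_mono hD (measure_mono (ccBall_subset _ _)))
  set q : ℝ := ((2 : ℝ) ^ Q)⁻¹
  have hq : 0 < q := by positivity
  have ht : Tendsto (fun n : ℕ => volume.real (ccBall X D x n)) atTop (𝓝 (volume.real D)) :=
    (ENNReal.tendsto_toReal hD).comp (tendsto_volume_ccBall_nat X D x)
  have hlt : volume.real D / (1 + q) < volume.real D := by
    rw [div_lt_iff₀ (by positivity)]; nlinarith
  obtain ⟨n, hn, hn1⟩ := ((ht.eventually (lt_mem_nhds hlt)).and (eventually_ge_atTop 1)).exists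
  have hn0 : (0 : ℝ) < n := by exact_mod_cast hn1
  refine ⟨3 * n, by positivity, subset_antisymm (fun y hy => ⟨hy, ?_⟩) (ccBall_subset _ _)⟩
  by_contra hge
  push Not at hge
  set ρ := ccDist X D x y with hρ
  have hρn : 0 < ρ - n := by linarith
  have e1 : ccBall X D x n ⊆ ccBall X D y (2 * (ρ - n)) := by
    refine h.ball_subset_ball hx hy ?_
    rw [h.comm, ← hρ]; linarith
  have e2 := h.real_volume_ball_mono hy e1
  have e3 := h.real_volume_ball_iterate_le hy hρn 1
  rw [pow_one, pow_one] at e3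
  have e4 : q * volume.real (ccBall X D x n) ≤ volume.real (ccBall X D y (ρ - n)) := by
    rw [inv_mul_le_iff₀ (by positivity)]; linarith
  have hdisj : Disjoint (ccBall X D x n) (ccBall X D y (ρ - n)) := by
    rw [Set.disjoint_left]
    intro z hz1 hz2
    have := h.triangle hx hz1.1 hy
    rw [h.comm z y, ← hρ] at this
    linarith [hz1.2, hz2.2]
  have e5 := ENNReal.toReal_mono hD (measure_mono (union_subset (ccBall_subset (X := X) (D := D) x n)
    (ccBall_subset (X := X) (D := D) y (ρ - n))))
  rw [measure_union hdisj (h.isOpen_ball hy _).measurableSet,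
    ENNReal.toReal_add (h.volume_ball_lt_top hx _).ne (h.volume_ball_lt_top hy _).ne] at e5
  change volume.real (ccBall X D x n) + volume.real (ccBall X D y (ρ - n)) ≤ volume.real D at e5
  rw [div_lt_iff₀ (by positivity)] at hn
  nlinarith

end GeometricSetting

end

section

variable {N m : ℕ} {X : VectorFields N m} {D Ω : Set (EuclideanSpace ℝ (Fin N))} {Q : ℝ}

/-! ### Divergence of Lipschitz fields -/

theorem _root_.LocallyLipschitz.mul_real {α : Type*} [PseudoMetricSpace α] {f g : α → ℝ}
    (hf : LocallyLipschitz f) (hg : LocallyLipschitz g) : LocallyLipschitz fun x => f x * g x :=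
  ((contDiff_fst.mul contDiff_snd : ContDiff ℝ 1 fun p : ℝ × ℝ => p.1 * p.2).locallyLipschitz).comp
    (hf.prodMk hg)

/-- Compactness gives a constant on a ball one unit larger than one containing the support. A point
of the support and a point beyond the larger ball are at distance at least `1`, so there the
supremum of `|f|` serves as a constant. -/
theorem _root_.LocallyLipschitz.exists_lipschitzWith_of_hasCompactSupport
    {f : EuclideanSpace ℝ (Fin N) → ℝ} (hf : LocallyLipschitz f) (hc : HasCompactSupport f) :
    ∃ K, LipschitzWith K f := by
  obtain ⟨ρ, hρ⟩ := hc.isCompact.isBounded.subset_closedBall (0 : EuclideanSpace ℝ (Fin N))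
  obtain ⟨K, hK⟩ := (hf.locallyLipschitzOn (s := Metric.closedBall 0 (ρ + 1))).exists_lipschitzOnWith_of_compact
    (isCompact_closedBall _ _)
  obtain ⟨M, hM⟩ := hf.continuous.bounded_above_of_compact_support hc
  have hM0 : 0 ≤ M := (norm_nonneg _).trans (hM 0)
  refine ⟨K + ⟨M, hM0⟩, LipschitzWith.of_dist_le_mul fun x y => ?_⟩
  have hzero : ∀ z, z ∉ Metric.closedBall (0 : EuclideanSpace ℝ (Fin N)) ρ → f z = 0 := fun z hz =>
    image_eq_zero_of_notMem_tsupport fun h => hz (hρ h)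
  have hfar : ∀ a b, a ∈ Metric.closedBall (0 : EuclideanSpace ℝ (Fin N)) ρ →
      b ∉ Metric.closedBall (0 : EuclideanSpace ℝ (Fin N)) (ρ + 1) →
      dist (f a) (f b) ≤ (K + M) * dist a b := by
    intro a b ha hb
    rw [hzero b fun h => hb (Metric.closedBall_subset_closedBall (by linarith) h), dist_zero_right]
    have h1 : 1 ≤ dist a b := by
      rw [Metric.mem_closedBall] at ha hb
      have := dist_triangle b a 0
      rw [dist_comm b a] at this
      linarith
    have h2 := hM a
    have : 0 ≤ (K : ℝ) := K.2
    nlinarith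
  change dist (f x) (f y) ≤ ((K : ℝ) + M) * dist x y
  by_cases hx : x ∈ Metric.closedBall (0 : EuclideanSpace ℝ (Fin N)) (ρ + 1)
  · by_cases hy : y ∈ Metric.closedBall (0 : EuclideanSpace ℝ (Fin N)) (ρ + 1)
    · refine (hK.dist_le_mul x hx y hy).trans ?_
      have := dist_nonneg (x := x) (y := y)
      nlinarith
    · by_cases hx' : x ∈ Metric.closedBall (0 : EuclideanSpace ℝ (Fin N)) ρ
      · exact hfar x y hx' hy
      · rw [hzero x hx', hzero y fun h => hy (Metric.closedBall_subset_closedBall (by linarith) h),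
          dist_self]
        have : 0 ≤ (K : ℝ) := K.2
        positivity
  · by_cases hy' : y ∈ Metric.closedBall (0 : EuclideanSpace ℝ (Fin N)) ρ
    · rw [dist_comm, dist_comm x]
      exact hfar y x hy' hx
    · rw [hzero y hy', hzero x fun h => hx (Metric.closedBall_subset_closedBall (by linarith) h),
          dist_self]
      have : 0 ≤ (K : ℝ) := K.2
      positivity

/-- The divergence, in the almost everywhere sense, of a field with components `F k`. -/
def divField (F : Fin N → EuclideanSpace ℝ (Fin N) → ℝ) (y : EuclideanSpace ℝ (Fin N)) : ℝ :=
  ∑ k, lineDeriv ℝ (F k) y (EuclideanSpace.single k 1)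

theorem integrable_lineDeriv_of_hasCompactSupport {f : EuclideanSpace ℝ (Fin N) → ℝ} {K : NNReal}
    (hf : LipschitzWith K f) (hc : HasCompactSupport f) (v : EuclideanSpace ℝ (Fin N)) :
    Integrable fun y => lineDeriv ℝ f y v := by
  have h1 : MemLp (fun y => lineDeriv ℝ f y v) ∞ (volume.restrict (tsupport f)) :=
    hf.memLp_lineDeriv v
  have : IsFiniteMeasure ((volume : Measure (EuclideanSpace ℝ (Fin N))).restrict (tsupport f)) :=
    ⟨by simpa using hc.isCompact.measure_lt_top⟩
  have h2 : IntegrableOn (fun y => lineDeriv ℝ f y v) (tsupport f) := h1.integrable le_top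
  refine h2.integrable_of_forall_notMem_eq_zero fun y hy => ?_
  have : f =ᶠ[𝓝 y] fun _ => 0 := notMem_tsupport_iff_eventuallyEq.1 hy
  rw [this.lineDeriv_eq]
  simp [lineDeriv]

/-- Rademacher's theorem allows integration by parts in each component. Only `F` needs compact
support, so `φ` may be constant, as in `integral_divField`. -/
theorem integral_mul_divField {F : Fin N → EuclideanSpace ℝ (Fin N) → ℝ} {K : Fin N → NNReal}
    (hF : ∀ k, LipschitzWith (K k) (F k)) (hc : ∀ k, HasCompactSupport (F k))
    {φ : EuclideanSpace ℝ (Fin N) → ℝ} {L : NNReal} (hφ : LipschitzWith L φ) :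
    ∫ y, φ y * divField F y =
      - ∫ y, ∑ k, lineDeriv ℝ φ y (EuclideanSpace.single k 1) * F k y := by
  have hi : ∀ k, Integrable fun y => lineDeriv ℝ (F k) y (EuclideanSpace.single k 1) * φ y := by
    intro k
    have h1 := integrable_lineDeriv_of_hasCompactSupport (hF k) (hc k) (EuclideanSpace.single k 1)
    obtain ⟨M, hM⟩ := (hc k).isCompact.exists_bound_of_continuousOn hφ.continuous.continuousOn
    refine (h1.norm.mul_const M).mono'
      (h1.aestronglyMeasurable.mul hφ.continuous.aestronglyMeasurable)
      (Eventually.of_forall fun y => ?_)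
    rw [norm_mul]
    by_cases hy : y ∈ tsupport (F k)
    · gcongr; exact hM y hy
    · have : F k =ᶠ[𝓝 y] fun _ => 0 := notMem_tsupport_iff_eventuallyEq.1 hy
      rw [this.lineDeriv_eq]
      simp [lineDeriv]
  have hj : ∀ k, Integrable fun y => lineDeriv ℝ φ y (EuclideanSpace.single k 1) * F k y := by
    intro k
    have h1 : Integrable (F k) := (hF k).continuous.integrable_of_hasCompactSupport (hc k)
    exact (hφ.memLp_lineDeriv (EuclideanSpace.single k 1)).integrable_mul (p := ∞) (q := 1)
      (memLp_one_iff_integrable.2 h1)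
  simp only [divField, Finset.mul_sum]
  rw [integral_finsetSum _ fun k _ => by simpa only [mul_comm] using hi k,
    integral_finsetSum _ fun k _ => hj k, ← Finset.sum_neg_distrib]
  refine Finset.sum_congr rfl fun k _ => ?_
  rw [hφ.integral_lineDeriv_mul_eq (hF k) (hc k), ← integral_neg]
  refine integral_congr_ae (Eventually.of_forall fun y => ?_)
  simp only [lineDeriv_neg]
  ring

theorem integral_divField {F : Fin N → EuclideanSpace ℝ (Fin N) → ℝ} {K : Fin N → NNReal}
    (hF : ∀ k, LipschitzWith (K k) (F k)) (hc : ∀ k, HasCompactSupport (F k)) :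
    ∫ y, divField F y = 0 := by
  have := integral_mul_divField hF hc (LipschitzWith.const (1 : ℝ))
  simpa [lineDeriv] using this

theorem integrable_divField {F : Fin N → EuclideanSpace ℝ (Fin N) → ℝ} {K : Fin N → NNReal}
    (hF : ∀ k, LipschitzWith (K k) (F k)) (hc : ∀ k, HasCompactSupport (F k)) :
    Integrable (divField F) :=
  integrable_finsetSum _ fun k _ => integrable_lineDeriv_of_hasCompactSupport (hF k) (hc k) _

theorem abs_divField_le {F : Fin N → EuclideanSpace ℝ (Fin N) → ℝ} {K : Fin N → NNReal}
    (hF : ∀ k, LipschitzWith (K k) (F k)) (y : EuclideanSpace ℝ (Fin N)) :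
    |divField F y| ≤ ∑ k, (K k : ℝ) := by
  refine (Finset.abs_sum_le_sum_abs _ _).trans (Finset.sum_le_sum fun k _ => ?_)
  have := norm_lineDeriv_le_of_lipschitz ℝ (hF k) (x₀ := y) (v := EuclideanSpace.single k 1)
  simpa using this

/-- `F` is a Lipschitz field with compact support, parallel to `X j`. -/
structure IsParallelField (X : VectorFields N m) (j : Fin m)
    (F : Fin N → EuclideanSpace ℝ (Fin N) → ℝ) : Prop where
  lip : ∃ K : Fin N → NNReal, ∀ k, LipschitzWith (K k) (F k)
  compact : ∀ k, HasCompactSupport (F k)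
  parallel : ∃ ζ : EuclideanSpace ℝ (Fin N) → ℝ, (∃ M : ℝ, ∀ y, |ζ y| ≤ M) ∧
    ∀ k y, F k y = ζ y * X j y k

theorem IsTest.exists_lipschitz {φ : EuclideanSpace ℝ (Fin N) → ℝ} (h : IsTest Ω φ) :
    ∃ K, LipschitzWith K φ :=
  h.1.lipschitzWith_of_hasCompactSupport h.2.1 (by simp)

theorem IsTest.sum_lineDeriv_mul {φ : EuclideanSpace ℝ (Fin N) → ℝ} (h : IsTest Ω φ)
    (y v : EuclideanSpace ℝ (Fin N)) :
    ∑ k, lineDeriv ℝ φ y (EuclideanSpace.single k 1) * v k = fderiv ℝ φ y v := by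
  have hd : DifferentiableAt ℝ φ y := h.1.differentiable (by simp) y
  have hv : v = ∑ k, v k • EuclideanSpace.single k (1 : ℝ) := by
    have := (EuclideanSpace.basisFun (Fin N) ℝ).sum_repr v
    simpa using this.symm
  conv_rhs => rw [hv, map_sum]
  refine Finset.sum_congr rfl fun k _ => ?_
  rw [hd.lineDeriv_eq_fderiv, map_smul, smul_eq_mul, mul_comm]

/-- After integration by parts only the derivative of `φ` along `F = ζ X_j` remains, that is `ζ
X_jφ`, and `ζ` is bounded. -/
theorem IsParallelField.exists_abs_integral_le {j : Fin m} {F : Fin N → EuclideanSpace ℝ (Fin N) → ℝ}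
    (hX : ∀ j, LocallyLipschitz (X j)) (hF : IsParallelField X j F) : ∃ M : ℝ, 0 ≤ M ∧ ∀ φ, IsTest Ω φ →
      |∫ y, φ y * divField F y| ≤ M * ∫ y, ‖xGrad X φ y‖ := by
  obtain ⟨K, hK⟩ := hF.lip
  obtain ⟨ζ, ⟨M, hM⟩, hζ⟩ := hF.parallel
  have hM0 : 0 ≤ M := (abs_nonneg _).trans (hM 0)
  refine ⟨M, hM0, fun φ hφ => ?_⟩
  obtain ⟨L, hL⟩ := hφ.exists_lipschitz
  rw [integral_mul_divField hK hF.compact hL, abs_neg, ← integral_const_mul]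
  refine (abs_integral_le_integral_abs).trans (integral_mono_of_nonneg
    (Eventually.of_forall fun _ => abs_nonneg _) ((hφ.integrable_xGrad hX).norm.const_mul M)
    (Eventually.of_forall fun y => ?_))
  have h1 : ∑ k, lineDeriv ℝ φ y (EuclideanSpace.single k 1) * F k y = ζ y * xGrad X φ y j := by
    simp only [hζ]
    have := hφ.sum_lineDeriv_mul y (X j y)
    simp only [xGrad]
    rw [← this, Finset.mul_sum]
    exact Finset.sum_congr rfl fun k _ => by ring
  simp only [h1, abs_mul]
  have h2 : |xGrad X φ y j| ≤ ‖xGrad X φ y‖ := by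
    have := PiLp.norm_apply_le (xGrad X φ y) j
    simpa using this
  exact mul_le_mul (hM y) h2 (abs_nonneg _) hM0

/-- If the Friedrichs inequality fails, all fields parallel to `X j` have zero flux across the
boundary. -/
theorem GeometricSetting.setIntegral_divField_eq_zero (h : GeometricSetting X Ω Q)
    (hΩ : volume Ω ≠ ⊤) {x : EuclideanSpace ℝ (Fin N)} (hx : x ∈ Ω) (hF : ¬ HasFriedrichs X Ω)
    {j : Fin m} {F : Fin N → EuclideanSpace ℝ (Fin N) → ℝ} (hj : IsParallelField X j F) :
    ∫ y in Ω, divField F y = 0 := by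
  obtain ⟨R, hR, hball⟩ := h.exists_eq_ball hΩ hx
  obtain ⟨K, hK0, hK⟩ := h.exists_integral_sub_average_le (Ω := Ω) hx hR
  rw [← hball] at hK
  obtain ⟨L, hL⟩ := hj.lip
  obtain ⟨M, hM0, hM⟩ := hj.exists_abs_integral_le (Ω := Ω) h.lip
  set S : ℝ := ∑ k, (L k : ℝ)
  have hS : 0 ≤ S := Finset.sum_nonneg fun k _ => (L k).2
  set V := volume.real Ω
  have hV : 0 < V := by
    have := h.real_volume_ball_pos hx hR
    rwa [← hball] at this
  have hint : Integrable (divField F) := integrable_divField hL hj.compact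
  set I := ∫ y in Ω, divField F y with hI
  -- Take a test function with `‖φ‖_1 > n ‖Xφ‖_1` and mean `a`. As `Ω` is itself a ball, `φ - a` is
  -- controlled in `L^1` by `‖Xφ‖_1`. Hence `φ / a` is close to `1` on `Ω` while `X(φ / a)` is
  -- small, and the flux, being nearly `∫ (φ/a) div F`, is `O(1/n)`.
  have key : ∀ n : ℕ, 2 * K ≤ n → |I| * n ≤ 2 * V * (S * K + M) := by
    intro n hn
    have hF' : ∃ φ, IsTest Ω φ ∧ (n : ℝ) * ∫ y, ‖xGrad X φ y‖ < ∫ y, |φ y| := by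
      by_contra hcon
      push Not at hcon
      exact hF ⟨n, hcon⟩
    obtain ⟨φ, hφ, hlt⟩ := hF'
    set a := ⨍ z in Ω, φ z with ha
    set G := ∫ y, ‖xGrad X φ y‖ with hG
    have hG0 : 0 ≤ G := integral_nonneg fun _ => norm_nonneg _
    have h1 := hK φ hφ
    have hia : IntegrableOn (fun y => φ y - a) Ω :=
      hφ.integrable.integrableOn.sub (integrableOn_const hΩ)
    have h2 : ∫ y, |φ y| ≤ ∫ y in Ω, (|φ y - a| + |a|) := by
      rw [← setIntegral_eq_integral_of_forall_compl_eq_zero (s := Ω)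
        fun y hy => by simp [hφ.eq_zero hy]]
      refine integral_mono hφ.integrable.abs.integrableOn
        (hia.abs.add (integrableOn_const hΩ)) fun y => ?_
      have := abs_add_le (φ y - a) a
      rwa [sub_add_cancel] at this
    rw [integral_add hia.abs (integrableOn_const hΩ), setIntegral_const, smul_eq_mul] at h2
    -- For `n ≥ 2K` the oscillation is at most half of `‖φ‖_1`, so the mean carries the other half;
    -- in particular `a ≠ 0`.
    have h3 : ∫ y, |φ y| ≤ 2 * (V * |a|) := by
      have : 2 * K * G ≤ n * G := by gcongr
      change ∫ y, |φ y| ≤ (∫ y in Ω, |φ y - a|) + V * |a| at h2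
      linarith
    have h4 : a * I = (∫ y, φ y * divField F y) - ∫ y in Ω, (φ y - a) * divField F y := by
      have e1 : ∫ y, φ y * divField F y = ∫ y in Ω, φ y * divField F y :=
        (setIntegral_eq_integral_of_forall_compl_eq_zero fun y hy => by simp [hφ.eq_zero hy]).symm
      have hbd : ∀ᵐ y ∂(volume.restrict Ω), ‖divField F y‖ ≤ S :=
        Eventually.of_forall fun y => abs_divField_le hL y
      rw [e1, ← integral_sub
        (hφ.integrable.integrableOn.mul_bdd hint.aestronglyMeasurable.restrict hbd)
        (hia.mul_bdd hint.aestronglyMeasurable.restrict hbd), hI, ← integral_const_mul]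
      refine integral_congr_ae (Eventually.of_forall fun y => ?_)
      simp only
      ring
    have h5 : |∫ y in Ω, (φ y - a) * divField F y| ≤ S * (K * G) := by
      calc |∫ y in Ω, (φ y - a) * divField F y| ≤ ∫ y in Ω, |(φ y - a) * divField F y| :=
            abs_integral_le_integral_abs
        _ ≤ ∫ y in Ω, S * |φ y - a| := by
            refine integral_mono_of_nonneg (Eventually.of_forall fun _ => abs_nonneg _)
              (hia.abs.const_mul S) (Eventually.of_forall fun y => ?_)
            simp only [abs_mul]
            rw [mul_comm]
            gcongr
            exact abs_divField_le hL y
        _ ≤ _ := by rw [integral_const_mul]; gcongr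
    have h6 : |a| * |I| ≤ (M + S * K) * G := by
      rw [← abs_mul, h4]
      refine (abs_sub _ _).trans ?_
      linarith [hM φ hφ]
    have ha0 : 0 < |a| := by
      by_contra hneg
      have : |a| = 0 := le_antisymm (not_lt.1 hneg) (abs_nonneg _)
      rw [this] at h3
      have : 0 ≤ (n : ℝ) * G := by positivity
      linarith
    have hn0 : (0 : ℝ) ≤ n := n.cast_nonneg
    have hMS : 0 ≤ M + S * K := by positivity
    have h7 : |a| * (|I| * n) ≤ |a| * (2 * V * (S * K + M)) := by
      calc |a| * (|I| * n) = (|a| * |I|) * n := by ring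
        _ ≤ ((M + S * K) * G) * n := by gcongr
        _ = (M + S * K) * (n * G) := by ring
        _ ≤ (M + S * K) * (2 * (V * |a|)) :=
            mul_le_mul_of_nonneg_left (hlt.le.trans h3) hMS
        _ = _ := by ring
    exact le_of_mul_le_mul_left h7 ha0
  by_contra hne
  have hI0 : 0 < |I| := abs_pos.2 hne
  obtain ⟨n, hn⟩ := exists_nat_gt (max (2 * K) (2 * V * (S * K + M) / |I|))
  have h1 := key n ((le_max_left _ _).trans hn.le)
  have h2 := (le_max_right _ _).trans_lt hn
  rw [div_lt_iff₀ hI0] at h2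
  linarith

end

section

variable {N m : ℕ} {X : VectorFields N m} {D Ω : Set (EuclideanSpace ℝ (Fin N))} {Q : ℝ}

/-! ### Tangency of the fields to the essential boundary, and its consequences -/

/-- The fields parallel to the `X j` have zero flux across the boundary of `Ω`. -/
def HasZeroFlux (X : VectorFields N m) (Ω : Set (EuclideanSpace ℝ (Fin N))) : Prop :=
  ∀ j F, IsParallelField X j F → ∫ y in Ω, divField F y = 0

/-- Globally Lipschitz components are differentiable almost everywhere, with derivatives bounded by
the Lipschitz constant; the field itself is only locally Lipschitz. -/
theorem exists_lipschitz_extension (hX : ∀ j, LocallyLipschitz (X j)) (j : Fin m) (ρ : ℝ) :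
    ∃ (L : ℝ) (g : Fin N → EuclideanSpace ℝ (Fin N) → ℝ), 0 ≤ L ∧
      (∀ k, LipschitzWith (Real.toNNReal L) (g k)) ∧
      ∀ k, ∀ y ∈ Metric.closedBall (0 : EuclideanSpace ℝ (Fin N)) ρ, g k y = X j y k := by
  obtain ⟨K, hK⟩ := ((hX j).locallyLipschitzOn (s := Metric.closedBall 0 ρ)).exists_lipschitzOnWith_of_compact
    (isCompact_closedBall _ _)
  have h1 : ∀ k, ∃ g : EuclideanSpace ℝ (Fin N) → ℝ, LipschitzWith K g ∧
      EqOn (fun y => X j y k) g (Metric.closedBall 0 ρ) := fun k => by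
    refine LipschitzOnWith.extend_real (LipschitzOnWith.of_dist_le_mul fun x hx y hy => ?_)
    refine le_trans ?_ (hK.dist_le_mul x hx y hy)
    rw [Real.dist_eq, dist_eq_norm]
    have := PiLp.norm_apply_le (X j x - X j y) k
    simpa using this
  choose g hg1 hg2 using h1
  exact ⟨K, g, K.2, fun k => by simpa using hg1 k, fun k y hy => (hg2 k hy).symm⟩

/-- The bump `((ρ² - |y - c|²)⁺)²`. -/
def ballBump (c : EuclideanSpace ℝ (Fin N)) (ρ : ℝ) (y : EuclideanSpace ℝ (Fin N)) : ℝ :=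
  max 0 (ρ ^ 2 - ‖y - c‖ ^ 2) * max 0 (ρ ^ 2 - ‖y - c‖ ^ 2)

theorem locallyLipschitz_ballBump (c : EuclideanSpace ℝ (Fin N)) (ρ : ℝ) :
    LocallyLipschitz (ballBump c ρ) := by
  have h1 : ContDiff ℝ 1 fun y : EuclideanSpace ℝ (Fin N) => ρ ^ 2 - ‖y - c‖ ^ 2 :=
    contDiff_const.sub ((contDiff_id.sub contDiff_const).norm_sq ℝ)
  exact (h1.locallyLipschitz.const_max 0).mul_real (h1.locallyLipschitz.const_max 0)

theorem ballBump_eq_zero {c y : EuclideanSpace ℝ (Fin N)} {ρ : ℝ} (hρ : 0 ≤ ρ) (h : ρ ≤ ‖y - c‖) :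
    ballBump c ρ y = 0 := by
  have : ρ ^ 2 ≤ ‖y - c‖ ^ 2 := by gcongr
  simp [ballBump, max_eq_left (sub_nonpos.2 this)]

theorem hasCompactSupport_ballBump (c : EuclideanSpace ℝ (Fin N)) {ρ : ℝ} (hρ : 0 ≤ ρ) :
    HasCompactSupport (ballBump c ρ) := by
  refine HasCompactSupport.intro (isCompact_closedBall c ρ) fun y hy => ballBump_eq_zero hρ ?_
  rw [Metric.mem_closedBall, dist_eq_norm, not_le] at hy
  exact hy.le

theorem isParallelField_ballBump (hX : ∀ j, LocallyLipschitz (X j)) (j : Fin m)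
    (c : EuclideanSpace ℝ (Fin N)) {ρ : ℝ} (hρ : 0 ≤ ρ) :
    IsParallelField X j fun k y => ballBump c ρ y * X j y k := by
  have hc : ∀ k, HasCompactSupport fun y => ballBump c ρ y * X j y k := fun k =>
    (hasCompactSupport_ballBump c hρ).mul_right
  have hl : ∀ k, LocallyLipschitz fun y => X j y k := fun k => by
    have h1 : LocallyLipschitz fun v : EuclideanSpace ℝ (Fin N) => v k :=
      (LipschitzWith.of_dist_le_mul (K := 1) fun x y => by
        rw [Real.dist_eq, dist_eq_norm, NNReal.coe_one, one_mul]
        simpa using PiLp.norm_apply_le (x - y) k).locallyLipschitz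
    exact h1.comp (hX j)
  have hex : ∀ k, ∃ K, LipschitzWith K fun y => ballBump c ρ y * X j y k := fun k =>
    ((locallyLipschitz_ballBump c ρ).mul_real (hl k)).exists_lipschitzWith_of_hasCompactSupport (hc k)
  choose K hK using hex
  refine ⟨⟨K, hK⟩, hc, ballBump c ρ, ?_, fun k y => rfl⟩
  obtain ⟨M, hM⟩ := (locallyLipschitz_ballBump c ρ).continuous.bounded_above_of_compact_support
    (hasCompactSupport_ballBump c hρ)
  exact ⟨M, hM⟩

theorem divField_ballBump_eq_zero {j : Fin m} {c y : EuclideanSpace ℝ (Fin N)} {ρ : ℝ} (hρ : 0 ≤ ρ)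
    (hy : ρ < ‖y - c‖) : divField (fun k y => ballBump c ρ y * X j y k) y = 0 := by
  refine Finset.sum_eq_zero fun k _ => ?_
  have : (fun y => ballBump c ρ y * X j y k) =ᶠ[𝓝 y] fun _ => 0 := by
    have hcont : Continuous fun z : EuclideanSpace ℝ (Fin N) => ‖z - c‖ := by fun_prop
    filter_upwards [hcont.continuousAt.eventually (lt_mem_nhds hy)] with z hz
    rw [ballBump_eq_zero hρ (le_of_lt hz), zero_mul]
  rw [this.lineDeriv_eq]
  simp [lineDeriv]

/-- Inside the ball, the divergence of the bump field is `w (-4 ⟪X, y - c⟫ + w div X)`. -/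
theorem exists_divField_ballBump_eq (hX : ∀ j, LocallyLipschitz (X j)) (j : Fin m)
    (c : EuclideanSpace ℝ (Fin N)) (ρ₀ : ℝ) :
    ∃ L : ℝ, 0 ≤ L ∧ ∀ ρ : ℝ, 0 < ρ → ρ ≤ ρ₀ → ∀ᵐ y, ‖y - c‖ < ρ →
      ∃ d : ℝ, |d| ≤ L ∧ divField (fun k y => ballBump c ρ y * X j y k) y =
        (ρ ^ 2 - ‖y - c‖ ^ 2) * (-4 * inner ℝ (y - c) (X j y) + (ρ ^ 2 - ‖y - c‖ ^ 2) * d) := by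
  obtain ⟨L, g, hL0, hg, hgX⟩ := exists_lipschitz_extension hX j (‖c‖ + ρ₀)
  refine ⟨∑ _k : Fin N, L, Finset.sum_nonneg fun _ _ => hL0, fun ρ hρ hρρ₀ => ?_⟩
  have hdiff : ∀ᵐ y, ∀ k, DifferentiableAt ℝ (g k) y :=
    ae_all_iff.2 fun k => (hg k).ae_differentiableAt
  filter_upwards [hdiff] with y hy hyρ
  refine ⟨∑ k, fderiv ℝ (g k) y (EuclideanSpace.single k 1), ?_, ?_⟩
  · refine (Finset.abs_sum_le_sum_abs _ _).trans (Finset.sum_le_sum fun k _ => ?_)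
    have := norm_lineDeriv_le_of_lipschitz ℝ (hg k) (x₀ := y) (v := EuclideanSpace.single k 1)
    rw [(hy k).lineDeriv_eq_fderiv] at this
    simpa [hL0] using this
  · set w : EuclideanSpace ℝ (Fin N) → ℝ := fun z => ρ ^ 2 - ‖z - c‖ ^ 2 with hw
    have hwd : HasFDerivAt w (-(2 • (innerSL ℝ (y - c)))) y := by
      have h1 := ((hasFDerivAt_id (𝕜 := ℝ) y).sub_const c).norm_sq
      have h2 := h1.const_sub (ρ ^ 2)
      exact h2.congr_fderiv (by ext v; simp)
    have hcont : Continuous fun z : EuclideanSpace ℝ (Fin N) => ‖z - c‖ := by fun_prop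
    have heq : ∀ k, (fun z => ballBump c ρ z * X j z k) =ᶠ[𝓝 y] fun z => (w z * w z) * g k z := by
      intro k
      filter_upwards [hcont.continuousAt.eventually (gt_mem_nhds hyρ)] with z hz
      have hz' : ‖z - c‖ < ρ := hz
      have h1 : 0 ≤ w z := by
        have : ‖z - c‖ ^ 2 ≤ ρ ^ 2 := by gcongr
        simp only [hw]; linarith
      rw [hgX k z]
      · simp only [ballBump]
        rw [max_eq_right h1]
      · rw [mem_closedBall_zero_iff]
        calc ‖z‖ = ‖(z - c) + c‖ := by rw [sub_add_cancel]
          _ ≤ ‖z - c‖ + ‖c‖ := norm_add_le _ _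
          _ ≤ _ := by linarith
    have hgy : ∀ k, g k y = X j y k := fun k => by
      refine hgX k y ?_
      rw [mem_closedBall_zero_iff]
      calc ‖y‖ = ‖(y - c) + c‖ := by rw [sub_add_cancel]
        _ ≤ ‖y - c‖ + ‖c‖ := norm_add_le _ _
        _ ≤ _ := by linarith
    have hline : ∀ k, lineDeriv ℝ (fun z => ballBump c ρ z * X j z k) y (EuclideanSpace.single k 1) =
        w y * (-4 * ((y - c) k * X j y k) + w y * fderiv ℝ (g k) y (EuclideanSpace.single k 1)) := by
      intro k
      rw [(heq k).lineDeriv_eq]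
      have h1 := ((hwd.mul hwd).mul (hy k).hasFDerivAt).hasLineDerivAt (EuclideanSpace.single k 1)
      have h2 := h1.lineDeriv
      have h3 : inner ℝ (y - c) (EuclideanSpace.single k (1 : ℝ)) = (y - c) k := by
        rw [EuclideanSpace.inner_single_right]; simp
      refine Eq.trans h2 ?_
      simp only [_root_.add_apply, _root_.smul_apply, _root_.neg_apply, Pi.mul_apply,
        innerSL_apply_apply, h3, smul_eq_mul, nsmul_eq_mul, hgy]
      push_cast
      ring
    have hinner : inner ℝ (y - c) (X j y) = ∑ k, (y - c) k * X j y k := by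
      simp [PiLp.inner_apply, mul_comm]
    simp only [divField, hline]
    rw [hinner, ← Finset.mul_sum, Finset.sum_add_distrib, ← Finset.mul_sum, ← Finset.mul_sum]

/-- The fields are tangent to the essential boundary: they are orthogonal to its normals in the
sense of Bony. -/
theorem HasZeroFlux.inner_eq_zero (hX : ∀ j, LocallyLipschitz (X j)) (hΩo : IsOpen Ω)
    (hflux : HasZeroFlux X Ω)
    {x p : EuclideanSpace ℝ (Fin N)} (hp : p ∈ (volume.restrict Ωᶜ).support) (hxp : x ≠ p)
    (hball : ∀ y ∈ Metric.ball x ‖x - p‖, y ∉ (volume.restrict Ωᶜ).support) (j : Fin m) :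
    inner ℝ (x - p) (X j p) = 0 := by
  by_contra hne
  have : Nontrivial (EuclideanSpace ℝ (Fin N)) := ⟨⟨x, p, hxp⟩⟩
  -- With `c` the midpoint of `x` and `p`, the ball of radius `δ/2` about `c` touches the sphere
  -- about `x` only at `p`. A slightly larger ball leaves `B(x, δ)` only in a small lens near `p`.
  set c : EuclideanSpace ℝ (Fin N) := (1 / 2 : ℝ) • (x + p) with hc
  set δ := ‖x - p‖ with hδ
  have hδ0 : 0 < δ := norm_pos_iff.2 (sub_ne_zero.2 hxp)
  -- `κ` is the normal component, of sign `σ`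
  set κ := inner ℝ (p - c) (X j p) with hκ
  have hpc : p - c = (-(1 / 2) : ℝ) • (x - p) := by
    rw [hc]; module
  have hκ0 : κ ≠ 0 := by
    rw [hκ, hpc, real_inner_smul_left]
    exact mul_ne_zero (by norm_num) hne
  obtain ⟨σ, hσ, hσκ⟩ : ∃ σ : ℝ, |σ| = 1 ∧ σ * κ = |κ| := by
    rcases le_total 0 κ with h | h
    · exact ⟨1, by simp, by rw [abs_of_nonneg h, one_mul]⟩
    · exact ⟨-1, by simp, by rw [abs_of_nonpos h]; ring⟩
  have hκp : 0 < |κ| := abs_pos.2 hκ0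
  have hcont : Continuous fun y => σ * inner ℝ (y - c) (X j y) :=
    continuous_const.mul ((continuous_id.sub continuous_const).inner (hX j).continuous)
  obtain ⟨η, hη, hηk⟩ := Metric.eventually_nhds_iff.1
    (hcont.continuousAt.eventually (lt_mem_nhds (show |κ| / 2 < σ * inner ℝ (p - c) (X j p) by
      rw [← hκ, hσκ]; linarith)))
  obtain ⟨L, hL0, hL⟩ := exists_divField_ballBump_eq hX j c (δ + 1)
  -- the radius
  obtain ⟨ε, hε0, hε1, hε2, hε3⟩ : ∃ ε : ℝ, 0 < ε ∧ 2 * ε < η ^ 2 ∧ ε * L < |κ| ∧ ε ≤ 1 := by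
    refine ⟨min (η ^ 2 / 4) (min (|κ| / (2 * (L + 1))) 1), by positivity, ?_, ?_, ?_⟩
    · have := min_le_left (η ^ 2 / 4) (min (|κ| / (2 * (L + 1))) 1)
      have : 0 < η ^ 2 := by positivity
      linarith
    · have h1 : min (η ^ 2 / 4) (min (|κ| / (2 * (L + 1))) 1) ≤ |κ| / (2 * (L + 1)) :=
        (min_le_right _ _).trans (min_le_left _ _)
      calc _ ≤ |κ| / (2 * (L + 1)) * L := by gcongr
        _ < |κ| := by
          rw [div_mul_eq_mul_div, div_lt_iff₀ (by positivity)]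
          nlinarith
    · exact (min_le_right _ _).trans (min_le_right _ _)
  -- The bound `2ε < η²` confines the lens to `B(p, η)`, where the normal component keeps its sign;
  -- `ε L < |κ|` makes it dominate the divergence of `X_j`; `ε ≤ 1` gives `ρ ≤ δ + 1`, so that `L`
  -- applies.
  set ρ := Real.sqrt (δ ^ 2 / 4 + ε) with hρ
  have hρ2 : ρ ^ 2 = δ ^ 2 / 4 + ε := Real.sq_sqrt (by positivity)
  have hρ0 : 0 < ρ := Real.sqrt_pos.2 (by positivity)
  have hρle : ρ ≤ δ + 1 := by
    rw [hρ, Real.sqrt_le_left (by positivity)]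
    nlinarith
  have hfield := isParallelField_ballBump hX j c hρ0.le
  obtain ⟨Kf, hKf⟩ := hfield.lip
  set F : Fin N → EuclideanSpace ℝ (Fin N) → ℝ := fun k y => ballBump c ρ y * X j y k with hF
  have hint : Integrable (divField F) := integrable_divField hKf hfield.compact
  -- The integral over the whole space vanishes by compact support, and the integral over `Ω` by the
  -- zero-flux hypothesis.
  have hzero : ∫ y in Ωᶜ, divField F y = 0 := by
    have h1 := integral_add_compl hΩo.measurableSet hint
    rw [hflux j F hfield, integral_divField hKf hfield.compact, zero_add] at h1
    exact h1
  -- sign of the divergence outside of the touching ball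
  have hsphere : ∀ᵐ y, y ∉ Metric.sphere c ρ :=
    measure_eq_zero_iff_ae_notMem.1 (Measure.addHaar_sphere volume c ρ)
  have hae : ∀ᵐ y ∂(volume.restrict Ωᶜ), (‖y - c‖ < ρ → 0 < -(σ * divField F y)) ∧
      0 ≤ -(σ * divField F y) := by
    have h1 : ∀ᵐ y ∂(volume.restrict Ωᶜ), y ∈ (volume.restrict Ωᶜ).support :=
      mem_ae_iff.2 (Measure.measure_compl_support (μ := volume.restrict Ωᶜ))
    filter_upwards [h1, ae_restrict_of_ae hsphere, ae_restrict_of_ae (hL ρ hρ0 hρle)] with y hy1 hy2 hy3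
    have hyball : δ ≤ ‖y - x‖ := by
      by_contra hlt
      exact hball y (by simpa [dist_eq_norm] using hlt) hy1
    have hin : ‖y - c‖ < ρ → 0 < -(σ * divField F y) := by
      intro hyρ
      obtain ⟨d, hd, hdiv⟩ := hy3 hyρ
      -- The parallelogram law. With `‖y - x‖ ≥ δ` it gives `‖y - c‖² ≥ δ²/4 + ‖y - p‖²/2`, hence
      -- both `w ≤ ε` and `‖y - p‖² < 2ε`.
      have hpar : ‖y - x‖ ^ 2 + ‖y - p‖ ^ 2 = 2 * ‖y - c‖ ^ 2 + δ ^ 2 / 2 := by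
        have hx' : y - x = (y - c) + (-(1 / 2) : ℝ) • (x - p) := by rw [hc]; module
        have hp' : y - p = (y - c) - (-(1 / 2) : ℝ) • (x - p) := by rw [hc]; module
        have := parallelogram_law_with_norm ℝ (y - c) ((-(1 / 2) : ℝ) • (x - p))
        rw [← hx', ← hp', norm_smul, ← hδ] at this
        norm_num at this
        rw [this]
        ring
      have hy2' : δ ^ 2 ≤ ‖y - x‖ ^ 2 := by gcongr
      have hyρ2 : ‖y - c‖ ^ 2 < ρ ^ 2 := by gcongr
      set w := ρ ^ 2 - ‖y - c‖ ^ 2 with hw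
      have hw0 : 0 < w := by linarith
      have hwε : w ≤ ε := by
        have := sq_nonneg ‖y - p‖
        linarith
      have hnear : dist y p < η := by
        rw [dist_eq_norm]
        refine lt_of_pow_lt_pow_left₀ 2 hη.le ?_
        linarith
      have hk := hηk hnear
      have hσd : -(σ * d) ≥ -L := by
        have : |σ * d| ≤ L := by rw [abs_mul, hσ, one_mul]; exact hd
        have := le_abs_self (σ * d)
        linarith
      have e1 : -(σ * divField F y) = w * (4 * (σ * inner ℝ (y - c) (X j y)) + w * (-(σ * d))) := by
        rw [hdiv]; ring
      rw [e1]
      refine mul_pos hw0 ?_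
      have e2 : w * (-(σ * d)) ≥ w * (-L) := by gcongr
      have e3 : w * L ≤ ε * L := by gcongr
      linarith
    refine ⟨hin, ?_⟩
    rcases lt_trichotomy ‖y - c‖ ρ with h | h | h
    · exact (hin h).le
    · exact absurd (by simpa [dist_eq_norm] using h) hy2
    · rw [divField_ballBump_eq_zero hρ0.le h]; simp
  have hz : (fun y => -(σ * divField F y)) =ᵐ[volume.restrict Ωᶜ] 0 := by
    rw [← integral_eq_zero_iff_of_nonneg_ae (hae.mono fun y hy => hy.2)
      ((hint.integrableOn.const_mul σ).neg), integral_neg, integral_const_mul, hzero]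
    simp
  -- The divergence has one sign on the complement and integral zero, so it vanishes there almost
  -- everywhere. It is nonzero almost everywhere on the part of the complement inside the ball,
  -- which must therefore be null although `p` lies in the support.
  have hnull : (volume.restrict Ωᶜ) (Metric.ball c ρ) = 0 := by
    rw [measure_eq_zero_iff_ae_notMem]
    filter_upwards [hae, hz] with y hy1 hy2 hy3
    have := hy1.1 (by simpa [dist_eq_norm] using hy3)
    simp only [Pi.zero_apply] at hy2
    linarith
  have hpmem : Metric.ball c ρ ∈ 𝓝 p := by
    refine Metric.isOpen_ball.mem_nhds ?_
    rw [Metric.mem_ball, dist_eq_norm, hpc, norm_smul, ← hδ]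
    refine lt_of_pow_lt_pow_left₀ 2 hρ0.le ?_
    rw [hρ2]
    norm_num
    nlinarith
  exact absurd hnull ((Measure.mem_support_iff_forall p).1 hp _ hpmem).ne'

end

section

variable {N m : ℕ} {X : VectorFields N m} {D Ω : Set (EuclideanSpace ℝ (Fin N))} {Q : ℝ}

/-! ### The essential boundary cannot be reached in finite time -/

theorem notMem_support_restrict_compl (hΩo : IsOpen Ω) {x : EuclideanSpace ℝ (Fin N)} (hx : x ∈ Ω) :
    x ∉ (volume.restrict Ωᶜ).support := by
  rw [Measure.notMem_support_iff_exists]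
  exact ⟨Ω, hΩo.mem_nhds hx, by rw [Measure.restrict_apply hΩo.measurableSet]; simp⟩

theorem le_of_ae_deriv_nonneg {F : ℝ → ℝ} {T : ℝ} (hT : 0 ≤ T)
    (hF : AbsolutelyContinuousOnInterval F 0 T)
    (hd : ∀ᵐ t ∂(volume.restrict (Icc 0 T)), 0 ≤ deriv F t) : F 0 ≤ F T := by
  have h1 := hF.integral_deriv_eq_sub
  have h2 : 0 ≤ ∫ t in (0 : ℝ)..T, deriv F t := by
    rw [intervalIntegral.integral_of_le hT]
    exact integral_nonneg_of_ae (ae_mono (Measure.restrict_mono Ioc_subset_Icc_self le_rfl) hd)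
  linarith

theorem IsSubunitPath.absolutelyContinuous_infDist
    {γ : ℝ → EuclideanSpace ℝ (Fin N)} {T : ℝ} (h : IsSubunitPath X D T γ)
    (K : Set (EuclideanSpace ℝ (Fin N))) :
    AbsolutelyContinuousOnInterval (fun t => Metric.infDist (γ t) K) 0 T := by
  have h1 := h.1
  unfold AbsolutelyContinuousOnInterval at h1 ⊢
  refine squeeze_zero (fun E => Finset.sum_nonneg fun _ _ => dist_nonneg) (fun E => ?_) h1
  refine Finset.sum_le_sum fun i _ => ?_
  simpa using (Metric.lipschitz_infDist_pt K).dist_le_mul (γ (E.2 i).1) (γ (E.2 i).2)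

/-- Gronwall. If `p` is a point of the support nearest to `γ(t)`, the fields at `p` are orthogonal
to `γ(t) - p`, so their component at `γ(t)` towards `p` is `O(dist)`. Hence `(dist²)' ≥ -2S dist²`
almost everywhere, and `dist² e^{2St}` is nondecreasing. -/
theorem HasZeroFlux.exists_infDist_le (hX : ∀ j, LocallyLipschitz (X j)) (hΩo : IsOpen Ω)
    (hΩb : Bornology.IsBounded Ω) (hflux : HasZeroFlux X Ω)
    (hK : (volume.restrict Ωᶜ).support.Nonempty) :
    ∃ L : ℝ, ∀ T γ, 0 ≤ T → IsSubunitPath X Ω T γ →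
      Metric.infDist (γ 0) (volume.restrict Ωᶜ).support ^ 2 ≤
        Metric.infDist (γ T) (volume.restrict Ωᶜ).support ^ 2 * Real.exp (L * T) := by
  set K := (volume.restrict Ωᶜ).support with hKdef
  have hKc : IsClosed K := Measure.isClosed_support
  obtain ⟨p₀, hp₀⟩ := hK
  obtain ⟨ρ, hρ⟩ := hΩb.subset_closedBall (0 : EuclideanSpace ℝ (Fin N))
  set R := ρ + (ρ + ‖p₀‖) with hR
  have hlip : ∀ j, ∃ L, LipschitzOnWith L (X j) (Metric.closedBall 0 R) := fun j =>
    ((hX j).locallyLipschitzOn (s := Metric.closedBall 0 R)).exists_lipschitzOnWith_of_compact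
      (isCompact_closedBall _ _)
  choose L hL using hlip
  set S : ℝ := ∑ j, (L j : ℝ) with hS
  refine ⟨2 * S, fun T γ hT hγ => ?_⟩
  set f : ℝ → ℝ := fun t => Metric.infDist (γ t) K with hf
  have hfac : AbsolutelyContinuousOnInterval f 0 T := hγ.absolutelyContinuous_infDist K
  have hexp : AbsolutelyContinuousOnInterval (fun t => Real.exp (2 * S * t)) 0 T :=
    ContDiffOn.absolutelyContinuousOnInterval (by fun_prop)
  have hac : AbsolutelyContinuousOnInterval (fun t => f t * f t * Real.exp (2 * S * t)) 0 T :=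
    (hfac.fun_mul hfac).fun_mul hexp
  have hdiff : ∀ᵐ t ∂(volume.restrict (Icc 0 T)), DifferentiableAt ℝ f t := by
    rw [ae_restrict_iff' measurableSet_Icc]
    have := hfac.ae_differentiableAt
    rwa [uIcc_of_le hT] at this
  have key : ∀ᵐ t ∂(volume.restrict (Icc 0 T)),
      0 ≤ deriv (fun t => f t * f t * Real.exp (2 * S * t)) t := by
    filter_upwards [hdiff, hγ.2.2, ae_restrict_mem measurableSet_Icc] with t hft hsub ht
    obtain ⟨θ, hθ, hd⟩ := hsub
    obtain ⟨p, hpK, hp⟩ := hKc.exists_infDist_eq_dist ⟨p₀, hp₀⟩ (γ t)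
    have hγΩ : γ t ∈ Ω := hγ.2.1 t ht
    have hne : γ t ≠ p := fun h => notMem_support_restrict_compl hΩo hγΩ (h ▸ hpK)
    have hfp : f t = ‖γ t - p‖ := by rw [hf]; simp only; rw [hp, dist_eq_norm]
    have hγρ : ‖γ t‖ ≤ ρ := by simpa using hρ hγΩ
    have hpR : ‖p‖ ≤ R := by
      have h1 : ‖γ t - p‖ ≤ ρ + ‖p₀‖ := by
        rw [← hfp]
        calc f t ≤ dist (γ t) p₀ := Metric.infDist_le_dist_of_mem hp₀
          _ ≤ ‖γ t‖ + ‖p₀‖ := by rw [dist_eq_norm]; exact norm_sub_le _ _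
          _ ≤ _ := by linarith
      calc ‖p‖ = ‖γ t - (γ t - p)‖ := by congr 1; abel
        _ ≤ ‖γ t‖ + ‖γ t - p‖ := norm_sub_le _ _
        _ ≤ _ := by linarith
    have hRγ : ‖γ t‖ ≤ R := by
      have := norm_nonneg p₀
      have := norm_nonneg (γ t)
      linarith
    -- derivative of the squared distance
    have hder : deriv (fun τ => f τ * f τ) t =
        2 * inner ℝ (γ t - p) (∑ j, θ j • X j (γ t)) := by
      have h1 : HasDerivAt (fun τ => ‖γ τ - p‖ ^ 2)
          (2 * inner ℝ (γ t - p) (∑ j, θ j • X j (γ t))) t := (hd.sub_const p).norm_sq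
      have h2 : HasDerivAt (fun τ => f τ * f τ) (deriv (fun τ => f τ * f τ) t) t :=
        (hft.mul hft).hasDerivAt
      -- The distance to the support is at most the distance to `p`, with equality at time `t`. The
      -- two squares touch there, so their derivatives agree.
      have h3 : IsLocalMax (fun τ => f τ * f τ - ‖γ τ - p‖ ^ 2) t := by
        refine Eventually.of_forall fun τ => ?_
        have h4 : f τ ≤ ‖γ τ - p‖ := by
          rw [← dist_eq_norm]; exact Metric.infDist_le_dist_of_mem hpK
        have h5 : 0 ≤ f τ := Metric.infDist_nonneg
        simp only [hfp]
        nlinarith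
      have := h3.hasDerivAt_eq_zero (h2.sub h1)
      linarith
    have hterm : ∀ j, |inner ℝ (γ t - p) (X j (γ t))| ≤ L j * (f t * f t) := by
      intro j
      -- The ball about `γ(t)` reaching to its nearest point `p` contains no point of the support,
      -- so the tangency result applies.
      have h0 := hflux.inner_eq_zero hX hΩo hpK hne (fun y hy hyK => by
        have h1 : Metric.infDist (γ t) K ≤ dist (γ t) y := Metric.infDist_le_dist_of_mem hyK
        rw [hp, dist_comm (γ t) y, dist_eq_norm (γ t) p] at h1
        exact absurd hy (by simpa using h1)) j
      have h1 : inner ℝ (γ t - p) (X j (γ t)) = inner ℝ (γ t - p) (X j (γ t) - X j p) := by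
        rw [inner_sub_right, h0, sub_zero]
      rw [h1]
      refine (abs_real_inner_le_norm _ _).trans ?_
      have h2 := (hL j).dist_le_mul (γ t) (by simpa using hRγ) p (by simpa using hpR)
      rw [dist_eq_norm, dist_eq_norm] at h2
      rw [hfp]
      have := norm_nonneg (γ t - p)
      nlinarith
    have hlow : -(S * (f t * f t)) ≤ inner ℝ (γ t - p) (∑ j, θ j • X j (γ t)) := by
      rw [inner_sum, neg_le_iff_add_nonneg, hS, Finset.sum_mul, ← Finset.sum_add_distrib]
      refine Finset.sum_nonneg fun j _ => ?_
      rw [real_inner_smul_right]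
      have h1 : θ j ^ 2 ≤ 1 :=
        (Finset.single_le_sum (f := fun j => θ j ^ 2) (fun i _ => sq_nonneg _)
          (Finset.mem_univ j)).trans hθ
      have h2 : |θ j| ≤ 1 := (sq_le_one_iff_abs_le_one _).1 h1
      have h3 : |θ j * inner ℝ (γ t - p) (X j (γ t))| ≤ L j * (f t * f t) := by
        rw [abs_mul]
        exact (mul_le_of_le_one_left (abs_nonneg _) h2).trans (hterm j)
      linarith [neg_abs_le (θ j * inner ℝ (γ t - p) (X j (γ t)))]
    have hdexp : HasDerivAt (fun τ => Real.exp (2 * S * τ)) (Real.exp (2 * S * t) * (2 * S)) t := by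
      have := ((hasDerivAt_id t).const_mul (2 * S)).exp
      simpa using this
    have hprod := ((hft.mul hft).hasDerivAt.mul hdexp).deriv
    have hprod' : deriv (fun t => f t * f t * Real.exp (2 * S * t)) t =
        deriv (fun τ => f τ * f τ) t * Real.exp (2 * S * t) +
          f t * f t * (Real.exp (2 * S * t) * (2 * S)) := hprod
    rw [hprod', hder]
    have := Real.exp_pos (2 * S * t)
    have e1 : 0 ≤ (2 * inner ℝ (γ t - p) (∑ j, θ j • X j (γ t)) + 2 * (S * (f t * f t))) *
      Real.exp (2 * S * t) := mul_nonneg (by linarith) this.le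
    linarith
  have hfin := le_of_ae_deriv_nonneg hT hac key
  simp only [mul_zero, Real.exp_zero, mul_one] at hfin
  simp only [sq]
  exact hfin

/-- Finite volume makes `Ω` one control ball, so all its points are reached from `x` within time
`R`, and zero flux keeps them at a fixed distance from the support `K` of the complement. But `Ω`
comes arbitrarily near the point of `K` closest to `x`. -/
theorem GeometricSetting.not_hasZeroFlux (h : GeometricSetting X Ω Q) (hN : 2 ≤ N)
    (hΩb : Bornology.IsBounded Ω) {x : EuclideanSpace ℝ (Fin N)} (hx : x ∈ Ω) :
    ¬ HasZeroFlux X Ω := by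
  intro hflux
  have : Nontrivial (EuclideanSpace ℝ (Fin N)) := by
    have : Nonempty (Fin N) := ⟨⟨0, by omega⟩⟩
    infer_instance
  have htop : volume (univ : Set (EuclideanSpace ℝ (Fin N))) = ⊤ :=
    measure_univ_of_isAddLeftInvariant _
  have hΩt : volume Ω ≠ ⊤ := hΩb.measure_lt_top.ne
  set K := (volume.restrict Ωᶜ).support with hKdef
  have hKc : IsClosed K := Measure.isClosed_support
  have hKne : K.Nonempty := by
    rw [hKdef, Measure.nonempty_support_iff]
    intro h0
    have h1 : volume Ωᶜ = 0 := by simpa using h0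
    have h2 := measure_univ_le_add_compl (μ := volume) Ω
    rw [h1, htop, add_zero, top_le_iff] at h2
    exact hΩt h2
  obtain ⟨L, hL⟩ := hflux.exists_infDist_le h.lip h.isOpen hΩb hKne
  obtain ⟨R, hR, hball⟩ := h.exists_eq_ball hΩt hx
  obtain ⟨p, hpK, hp⟩ := hKc.exists_infDist_eq_dist hKne x
  have hδ : 0 < dist x p := dist_pos.2 fun hxp =>
    notMem_support_restrict_compl h.isOpen hx (hxp ▸ hpK)
  set δ := dist x p with hδd
  -- the constant of the lower bound along paths
  set q := Real.exp (|L| * R) with hq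
  have hq0 : 0 < q := Real.exp_pos _
  have hlow : ∀ y ∈ Ω, δ ^ 2 ≤ Metric.infDist y K ^ 2 * q := by
    intro y hy
    have hyb : y ∈ ccBall X Ω x R := hball ▸ hy
    obtain ⟨T, ⟨hT, γ, hγ, h0, h1⟩, hTR⟩ := exists_travelTime_lt h.geo.connected hx hy hyb.2
    have h2 := hL T γ hT.le hγ
    rw [h0, h1, ← hKdef, hp] at h2
    refine h2.trans ?_
    have h3 : L * T ≤ |L| * R :=
      (mul_le_mul_of_nonneg_right (le_abs_self L) hT.le).trans
        (mul_le_mul_of_nonneg_left hTR.le (abs_nonneg L))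
    exact mul_le_mul_of_nonneg_left (Real.exp_le_exp.2 h3) (sq_nonneg _)
  -- points of `Ω` close to `p`
  obtain ⟨ε, hε0, hεq⟩ : ∃ ε : ℝ, 0 < ε ∧ ε ^ 2 * q < δ ^ 2 := by
    refine ⟨Real.sqrt (δ ^ 2 / (2 * q)), Real.sqrt_pos.2 (by positivity), ?_⟩
    rw [Real.sq_sqrt (by positivity), div_mul_eq_mul_div, div_lt_iff₀ (by positivity)]
    nlinarith [mul_pos hq0 (pow_pos hδ 2)]
  have hopen : IsOpen (Metric.ball x δ ∩ Metric.ball p ε) := Metric.isOpen_ball.inter Metric.isOpen_ball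
  have hne : (Metric.ball x δ ∩ Metric.ball p ε).Nonempty := by
    have hpcl : p ∈ closure (Metric.ball x δ) := by
      rw [closure_ball x hδ.ne', Metric.mem_closedBall, dist_comm]
    have := mem_closure_iff.1 hpcl (Metric.ball p ε) Metric.isOpen_ball (Metric.mem_ball_self hε0)
    rwa [inter_comm] at this
  -- The ball `B(x, δ)` misses `K`, so almost all of it belongs to `Ω`. Its part near `p` is open
  -- and nonempty, hence meets `Ω`.
  have hnull : (volume.restrict Ωᶜ) (Metric.ball x δ ∩ Metric.ball p ε) = 0 := by
    refine measure_mono_null (fun y hy => ?_) (Measure.measure_compl_support (μ := volume.restrict Ωᶜ))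
    intro hyK
    have h1 : Metric.infDist x K ≤ dist x y := Metric.infDist_le_dist_of_mem hyK
    rw [hp, dist_comm x y] at h1
    exact absurd hy.1 (by simpa using h1)
  rw [Measure.restrict_apply hopen.measurableSet] at hnull
  obtain ⟨y, hy1, hy2⟩ : ∃ y, y ∈ Metric.ball x δ ∩ Metric.ball p ε ∧ y ∈ Ω := by
    by_contra hcon
    push Not at hcon
    have h1 : (Metric.ball x δ ∩ Metric.ball p ε) ∩ Ωᶜ = Metric.ball x δ ∩ Metric.ball p ε :=
      inter_eq_left.2 fun y hy => hcon y hy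
    rw [h1] at hnull
    exact (hopen.measure_pos volume hne).ne' hnull
  have h1 := hlow y hy2
  have h2 : Metric.infDist y K ≤ ε :=
    (Metric.infDist_le_dist_of_mem hpK).trans (le_of_lt hy1.2)
  have h3 : Metric.infDist y K ^ 2 * q ≤ ε ^ 2 * q := by
    have := Metric.infDist_nonneg (x := y) (s := K)
    gcongr
  linarith

theorem GeometricSetting.hasFriedrichs_self (h : GeometricSetting X Ω Q) (hN : 2 ≤ N)
    (hΩb : Bornology.IsBounded Ω) {x : EuclideanSpace ℝ (Fin N)} (hx : x ∈ Ω) :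
    HasFriedrichs X Ω := by
  by_contra hF
  exact h.not_hasZeroFlux hN hΩb hx fun _ _ hj =>
    h.setIntegral_divField_eq_zero hΩb.measure_lt_top.ne hx hF hj

/-- The Sobolev inequality under the geometric assumptions, on `Ω` or on the whole space. -/
theorem GeometricAssumptions.hasSobolev (hN : 2 ≤ N) (hΩo : IsOpen Ω) (hΩb : Bornology.IsBounded Ω)
    (hX : ∀ j, LocallyLipschitz (X j)) (hD : D = Ω ∨ D = univ) (hQ : 2 < Q)
    (hgeo : GeometricAssumptions X D Q) :
    HasSobolev X Ω (ENNReal.ofReal (2 * Q / (Q - 2))) := by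
  rcases Ω.eq_empty_or_nonempty with rfl | ⟨x, hx⟩
  · exact ⟨0, by simp, fun φ _ => by simp⟩
  rcases hD with rfl | rfl
  · have h : GeometricSetting X D Q := ⟨hX, hΩo, hQ, hgeo⟩
    obtain ⟨R, hR, hball⟩ := h.exists_eq_ball hΩb.measure_lt_top.ne hx
    exact h.hasSobolev hΩo hx hR hball.subset (h.hasFriedrichs_self hN hΩb hx)
  · have h : GeometricSetting X univ Q := ⟨hX, isOpen_univ, hQ, hgeo⟩
    obtain ⟨n, hn, hsub⟩ := h.exists_subset_ball hΩb x
    exact h.hasSobolev hΩo (mem_univ x) (by exact_mod_cast hn) hsub (h.hasFriedrichs_univ hN hΩb)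

end

section

variable {N m : ℕ} {X : VectorFields N m} {Ω : Set (EuclideanSpace ℝ (Fin N))} {p : ℝ≥0∞}

/-! ### The space `W_0^{1,2}(Ω, X)` -/

theorem IsTest.add {φ ψ : EuclideanSpace ℝ (Fin N) → ℝ} (hφ : IsTest Ω φ) (hψ : IsTest Ω ψ) :
    IsTest Ω (φ + ψ) :=
  ⟨hφ.1.add hψ.1, hφ.2.1.add hψ.2.1, (tsupport_add φ ψ).trans (union_subset hφ.2.2 hψ.2.2)⟩

theorem IsTest.const_smul {φ : EuclideanSpace ℝ (Fin N) → ℝ} (hφ : IsTest Ω φ) (c : ℝ) :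
    IsTest Ω (c • φ) :=
  ⟨contDiff_const.smul hφ.1, hφ.2.1.smul_left (f := fun _ => c),
    (closure_mono (Function.support_const_smul_subset c φ)).trans hφ.2.2⟩

theorem IsTest.differentiable {φ : EuclideanSpace ℝ (Fin N) → ℝ} (hφ : IsTest Ω φ) :
    Differentiable ℝ φ := hφ.1.differentiable (by simp)

theorem IsTest.xGrad_add {φ ψ : EuclideanSpace ℝ (Fin N) → ℝ} (hφ : IsTest Ω φ) (hψ : IsTest Ω ψ) :
    xGrad X (φ + ψ) = xGrad X φ + xGrad X ψ := by
  ext x j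
  simp [xGrad, fderiv_add (hφ.differentiable x) (hψ.differentiable x)]

theorem IsTest.xGrad_const_smul {φ : EuclideanSpace ℝ (Fin N) → ℝ} (hφ : IsTest Ω φ) (c : ℝ) :
    xGrad X (c • φ) = c • xGrad X φ := by
  ext x j
  simp [xGrad, fderiv_const_smul (hφ.differentiable x) c]

theorem IsTest.memLp {φ : EuclideanSpace ℝ (Fin N) → ℝ} (hφ : IsTest Ω φ) (q : ℝ≥0∞) :
    MemLp φ q (volume.restrict Ω) :=
  (hφ.continuous.memLp_of_hasCompactSupport hφ.2.1).restrict Ω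

theorem IsTest.memLp_xGrad {φ : EuclideanSpace ℝ (Fin N) → ℝ} (hφ : IsTest Ω φ)
    (hX : ∀ j, LocallyLipschitz (X j)) (q : ℝ≥0∞) : MemLp (xGrad X φ) q (volume.restrict Ω) :=
  ((hφ.continuous_xGrad hX).memLp_of_hasCompactSupport hφ.hasCompactSupport_xGrad).restrict Ω

/-- The `ε`-form of the closure makes closedness under further limits a matter of halving `ε`. -/
theorem isSobolevZero_iff {u : EuclideanSpace ℝ (Fin N) → ℝ}
    {G : EuclideanSpace ℝ (Fin N) → EuclideanSpace ℝ (Fin m)} :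
    IsSobolevZero X Ω 2 u G ↔ MemLp u 2 (volume.restrict Ω) ∧ MemLp G 2 (volume.restrict Ω) ∧
      ∀ ε : ℝ≥0∞, 0 < ε → ∃ φ, IsTest Ω φ ∧ eLpNorm (φ - u) 2 (volume.restrict Ω) < ε ∧
        eLpNorm (xGrad X φ - G) 2 (volume.restrict Ω) < ε := by
  refine and_congr_right fun _ => and_congr_right fun _ => ⟨?_, fun h => ?_⟩
  · rintro ⟨φ, hφ, h1, h2⟩ ε hε
    obtain ⟨n, hn1, hn2⟩ := ((h1.eventually (gt_mem_nhds hε)).and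
      (h2.eventually (gt_mem_nhds hε))).exists
    exact ⟨φ n, hφ n, hn1, hn2⟩
  · have hpos : ∀ n : ℕ, (0 : ℝ≥0∞) < (n : ℝ≥0∞)⁻¹ := fun n => by simp
    choose φ hφ h1 h2 using fun n : ℕ => h (n : ℝ≥0∞)⁻¹ (hpos n)
    refine ⟨φ, hφ, ?_, ?_⟩
    · exact tendsto_of_tendsto_of_tendsto_of_le_of_le tendsto_const_nhds
        ENNReal.tendsto_inv_nat_nhds_zero (fun _ => zero_le) fun n => (h1 n).le
    · exact tendsto_of_tendsto_of_tendsto_of_le_of_le tendsto_const_nhds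
        ENNReal.tendsto_inv_nat_nhds_zero (fun _ => zero_le) fun n => (h2 n).le

theorem eLpNorm_sub_lt_of_lt {α F : Type*} [MeasurableSpace α] [NormedAddCommGroup F]
    {μ : Measure α} {f g h : α → F} (hf : AEStronglyMeasurable f μ)
    (hg : AEStronglyMeasurable g μ) (hh : AEStronglyMeasurable h μ) {ε : ℝ≥0∞}
    (h1 : eLpNorm (f - g) 2 μ < ε / 2) (h2 : eLpNorm (g - h) 2 μ < ε / 2) :
    eLpNorm (f - h) 2 μ < ε := by
  have : f - h = (f - g) + (g - h) := by abel
  rw [this]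
  calc _ ≤ _ := eLpNorm_add_le (hf.sub hg) (hg.sub hh) one_le_two
    _ < ε / 2 + ε / 2 := ENNReal.add_lt_add h1 h2
    _ = ε := ENNReal.add_halves ε

theorem IsTest.isSobolevZero {φ : EuclideanSpace ℝ (Fin N) → ℝ} (hφ : IsTest Ω φ)
    (hX : ∀ j, LocallyLipschitz (X j)) : IsSobolevZero X Ω 2 φ (xGrad X φ) :=
  isSobolevZero_iff.2 ⟨hφ.memLp 2, hφ.memLp_xGrad hX 2, fun ε hε => ⟨φ, hφ, by simpa, by simpa⟩⟩

namespace IsSobolevZero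

variable {u v : EuclideanSpace ℝ (Fin N) → ℝ}
  {G H : EuclideanSpace ℝ (Fin N) → EuclideanSpace ℝ (Fin m)}

theorem congr (h : IsSobolevZero X Ω 2 u G) (hu : u =ᵐ[volume.restrict Ω] v)
    (hG : G =ᵐ[volume.restrict Ω] H) : IsSobolevZero X Ω 2 v H := by
  obtain ⟨h1, h2, φ, hφ, h3, h4⟩ := h
  refine ⟨h1.ae_eq hu, h2.ae_eq hG, φ, hφ, ?_, ?_⟩
  · exact h3.congr fun n => eLpNorm_congr_ae (EventuallyEq.rfl.sub hu)
  · exact h4.congr fun n => eLpNorm_congr_ae (EventuallyEq.rfl.sub hG)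

theorem of_approx (hX : ∀ j, LocallyLipschitz (X j)) (hu : MemLp u 2 (volume.restrict Ω))
    (hG : MemLp G 2 (volume.restrict Ω))
    (h : ∀ ε : ℝ≥0∞, 0 < ε → ∃ v H, IsSobolevZero X Ω 2 v H ∧
      eLpNorm (v - u) 2 (volume.restrict Ω) < ε ∧ eLpNorm (H - G) 2 (volume.restrict Ω) < ε) :
    IsSobolevZero X Ω 2 u G := by
  refine isSobolevZero_iff.2 ⟨hu, hG, fun ε hε => ?_⟩
  obtain ⟨v, H, hv, h1, h2⟩ := h (ε / 2) (ENNReal.half_pos hε.ne')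
  obtain ⟨hvm, hHm, happ⟩ := isSobolevZero_iff.1 hv
  obtain ⟨φ, hφ, h3, h4⟩ := happ (ε / 2) (ENNReal.half_pos hε.ne')
  exact ⟨φ, hφ, eLpNorm_sub_lt_of_lt (hφ.memLp 2).1 hvm.1 hu.1 h3 h1,
    eLpNorm_sub_lt_of_lt (hφ.memLp_xGrad hX 2).1 hHm.1 hG.1 h4 h2⟩

theorem of_tendsto (hX : ∀ j, LocallyLipschitz (X j)) {us : ℕ → EuclideanSpace ℝ (Fin N) → ℝ}
    {Gs : ℕ → EuclideanSpace ℝ (Fin N) → EuclideanSpace ℝ (Fin m)}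
    (hs : ∀ n, IsSobolevZero X Ω 2 (us n) (Gs n)) (hu : MemLp u 2 (volume.restrict Ω))
    (hG : MemLp G 2 (volume.restrict Ω))
    (h1 : Tendsto (fun n => eLpNorm (us n - u) 2 (volume.restrict Ω)) atTop (𝓝 0))
    (h2 : Tendsto (fun n => eLpNorm (Gs n - G) 2 (volume.restrict Ω)) atTop (𝓝 0)) :
    IsSobolevZero X Ω 2 u G :=
  of_approx hX hu hG fun ε hε => by
    obtain ⟨n, hn1, hn2⟩ := ((h1.eventually (gt_mem_nhds hε)).and
      (h2.eventually (gt_mem_nhds hε))).exists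
    exact ⟨us n, Gs n, hs n, hn1, hn2⟩

theorem add (hX : ∀ j, LocallyLipschitz (X j)) (hu : IsSobolevZero X Ω 2 u G)
    (hv : IsSobolevZero X Ω 2 v H) : IsSobolevZero X Ω 2 (u + v) (G + H) := by
  obtain ⟨hum, hGm, φ, hφ, h1, h2⟩ := hu
  obtain ⟨hvm, hHm, ψ, hψ, h3, h4⟩ := hv
  have hφ' : ∀ n, IsTest Ω (φ n) := hφ
  have hψ' : ∀ n, IsTest Ω (ψ n) := hψ
  refine ⟨hum.add hvm, hGm.add hHm, fun n => φ n + ψ n, fun n => (hφ' n).add (hψ' n), ?_, ?_⟩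
  · refine tendsto_of_tendsto_of_tendsto_of_le_of_le tendsto_const_nhds
      (by simpa using h1.add h3) (fun _ => zero_le) fun n => ?_
    rw [show φ n + ψ n - (u + v) = (φ n - u) + (ψ n - v) by abel]
    exact eLpNorm_add_le (((hφ' n).memLp 2).1.sub hum.1) (((hψ' n).memLp 2).1.sub hvm.1) one_le_two
  · refine tendsto_of_tendsto_of_tendsto_of_le_of_le tendsto_const_nhds
      (by simpa using h2.add h4) (fun _ => zero_le) fun n => ?_
    rw [(hφ' n).xGrad_add (hψ' n),
      show xGrad X (φ n) + xGrad X (ψ n) - (G + H) = (xGrad X (φ n) - G) + (xGrad X (ψ n) - H) by abel]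
    exact eLpNorm_add_le (((hφ' n).memLp_xGrad hX 2).1.sub hGm.1)
      (((hψ' n).memLp_xGrad hX 2).1.sub hHm.1) one_le_two

theorem const_smul (hu : IsSobolevZero X Ω 2 u G) (c : ℝ) :
    IsSobolevZero X Ω 2 (c • u) (c • G) := by
  obtain ⟨hum, hGm, φ, hφ, h1, h2⟩ := hu
  have hφ' : ∀ n, IsTest Ω (φ n) := hφ
  refine ⟨hum.const_smul c, hGm.const_smul c, fun n => c • φ n, fun n => (hφ' n).const_smul c, ?_, ?_⟩
  · simp_rw [← smul_sub, eLpNorm_const_smul]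
    simpa using ENNReal.Tendsto.const_mul h1 (Or.inr enorm_ne_top)
  · simp_rw [fun n => (hφ' n).xGrad_const_smul (X := X) c, ← smul_sub, eLpNorm_const_smul]
    simpa using ENNReal.Tendsto.const_mul h2 (Or.inr enorm_ne_top)

theorem neg (hu : IsSobolevZero X Ω 2 u G) : IsSobolevZero X Ω 2 (-u) (-G) := by
  simpa using hu.const_smul (-1)

theorem sub (hX : ∀ j, LocallyLipschitz (X j)) (hu : IsSobolevZero X Ω 2 u G)
    (hv : IsSobolevZero X Ω 2 v H) : IsSobolevZero X Ω 2 (u - v) (G - H) := by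
  simpa [sub_eq_add_neg] using hu.add hX hv.neg

end IsSobolevZero

theorem isSobolevZero_zero (hX : ∀ j, LocallyLipschitz (X j)) :
    IsSobolevZero X Ω 2 (0 : EuclideanSpace ℝ (Fin N) → ℝ) 0 := by
  have h : IsTest Ω (0 : EuclideanSpace ℝ (Fin N) → ℝ) :=
    ⟨contDiff_const, HasCompactSupport.zero, by simp [tsupport]⟩
  have h0 : xGrad X (0 : EuclideanSpace ℝ (Fin N) → ℝ) = 0 := by ext x j; simp [xGrad]
  simpa [h0] using h.isSobolevZero hX

/-- The Sobolev inequality on `W_0^{1,2}(Ω, X)`. -/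
theorem HasSobolev.exists_forall (hX : ∀ j, LocallyLipschitz (X j)) (h : HasSobolev X Ω p) :
    ∃ C : ℝ≥0∞, C ≠ ⊤ ∧ ∀ u G, IsSobolevZero X Ω 2 u G →
      eLpNorm u p (volume.restrict Ω) ≤ C * eLpNorm G 2 (volume.restrict Ω) := by
  obtain ⟨C, hC, hS⟩ := h
  refine ⟨C, hC, fun u G hu => ?_⟩
  obtain ⟨hum, hGm, φ, hφ, h1, h2⟩ := hu
  have hφ' : ∀ n, IsTest Ω (φ n) := hφ
  -- Convergence in `L^2` says nothing about the `L^p` norm directly; along an almost everywhere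
  -- convergent subsequence Fatou's lemma gives lower semicontinuity.
  obtain ⟨ns, hns, hae⟩ := (tendstoInMeasure_of_tendsto_eLpNorm two_ne_zero
    (fun n => ((hφ' n).memLp 2).1) hum.1 h1).exists_seq_tendsto_ae
  have hlim := Lp.eLpNorm_lim_le_liminf_eLpNorm (p := p) (fun n => ((hφ' (ns n)).memLp 2).1) u hae
  refine hlim.trans ?_
  have hb : ∀ n, eLpNorm (φ (ns n)) p (volume.restrict Ω) ≤
      C * (eLpNorm (xGrad X (φ (ns n)) - G) 2 (volume.restrict Ω) +
        eLpNorm G 2 (volume.restrict Ω)) := fun n => by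
    refine (hS _ (hφ' (ns n))).trans ?_
    gcongr
    have := eLpNorm_add_le (μ := volume.restrict Ω) (((hφ' (ns n)).memLp_xGrad hX 2).1.sub hGm.1)
      hGm.1 one_le_two
    rwa [sub_add_cancel] at this
  have ht : Tendsto (fun n => C * (eLpNorm (xGrad X (φ (ns n)) - G) 2 (volume.restrict Ω) +
        eLpNorm G 2 (volume.restrict Ω))) atTop (𝓝 (C * (0 + eLpNorm G 2 (volume.restrict Ω)))) :=
    ENNReal.Tendsto.const_mul ((h2.comp hns.tendsto_atTop).add tendsto_const_nhds) (Or.inr hC)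
  rw [zero_add] at ht
  calc _ ≤ liminf (fun n => C * (eLpNorm (xGrad X (φ (ns n)) - G) 2 (volume.restrict Ω) +
        eLpNorm G 2 (volume.restrict Ω))) atTop := liminf_le_liminf (Eventually.of_forall hb)
    _ = _ := ht.liminf_eq

/-! ### Elliptic matrices -/

/-- Uniform ellipticity and boundedness of a measurable matrix function. -/
structure IsElliptic (Ω : Set (EuclideanSpace ℝ (Fin N)))
    (A : EuclideanSpace ℝ (Fin N) → Matrix (Fin m) (Fin m) ℝ) (α β : ℝ) : Prop where
  meas : ∀ i j, Measurable fun x => A x i j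
  pos : 0 < α
  nonneg : 0 ≤ β
  coercive : ∀ x ∈ Ω, ∀ η : EuclideanSpace ℝ (Fin m), α * ‖η‖ ^ 2 ≤ (A x *ᵥ η.ofLp) ⬝ᵥ η.ofLp
  bdd : ∀ x ∈ Ω, ∀ η : EuclideanSpace ℝ (Fin m), ‖WithLp.toLp 2 (A x *ᵥ η.ofLp)‖ ≤ β * ‖η‖

theorem dotProduct_eq_inner (a b : EuclideanSpace ℝ (Fin m)) : a.ofLp ⬝ᵥ b.ofLp = inner ℝ a b := by
  simp [PiLp.inner_apply, dotProduct, mul_comm]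

namespace IsElliptic

variable {A : EuclideanSpace ℝ (Fin N) → Matrix (Fin m) (Fin m) ℝ} {α β : ℝ}
  {G H : EuclideanSpace ℝ (Fin N) → EuclideanSpace ℝ (Fin m)}

theorem transpose (h : IsElliptic Ω A α β) : IsElliptic Ω (fun x => (A x)ᵀ) α β where
  meas i j := h.meas j i
  pos := h.pos
  nonneg := h.nonneg
  coercive x hx η := by
    rw [mulVec_transpose, ← dotProduct_mulVec, dotProduct_comm]
    exact h.coercive x hx η
  bdd x hx η := by
    -- For `ξ = Aᵀη` one has `‖ξ‖² = ⟪η, Aξ⟫ ≤ β ‖η‖ ‖ξ‖`.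
    set ξ : EuclideanSpace ℝ (Fin m) := WithLp.toLp 2 ((A x)ᵀ *ᵥ η.ofLp) with hξ
    have h1 : ‖ξ‖ ^ 2 = inner ℝ η (WithLp.toLp 2 (A x *ᵥ ξ.ofLp)) := by
      rw [← real_inner_self_eq_norm_sq, ← dotProduct_eq_inner, ← dotProduct_eq_inner,
        dotProduct_mulVec, ← mulVec_transpose, Matrix.transpose_transpose, dotProduct_comm]
    have h2 := real_inner_le_norm η (WithLp.toLp 2 (A x *ᵥ ξ.ofLp))
    have h3 := h.bdd x hx ξ
    rcases (norm_nonneg ξ).eq_or_lt with h0 | h0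
    · rw [← h0]; exact mul_nonneg h.nonneg (norm_nonneg _)
    · have h4 : ‖η‖ * ‖(WithLp.toLp 2 (A x *ᵥ ξ.ofLp) : EuclideanSpace ℝ (Fin m))‖ ≤
          ‖η‖ * (β * ‖ξ‖) := by gcongr
      nlinarith

theorem aestronglyMeasurable (h : IsElliptic Ω A α β) {μ : Measure (EuclideanSpace ℝ (Fin N))}
    (hG : AEStronglyMeasurable G μ) :
    AEStronglyMeasurable (fun x => (WithLp.toLp 2 (A x *ᵥ (G x).ofLp) : EuclideanSpace ℝ (Fin m))) μ := by
  have hGm : AEMeasurable G μ := hG.aemeasurable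
  have h1 : AEMeasurable (fun x => A x *ᵥ (G x).ofLp) μ := by
    refine aemeasurable_pi_iff.2 fun i => ?_
    simp only [mulVec, dotProduct]
    refine Finset.aemeasurable_fun_sum _ fun j _ => (h.meas i j).aemeasurable.mul ?_
    have : Measurable fun v : EuclideanSpace ℝ (Fin m) => v j := by fun_prop
    exact this.comp_aemeasurable hGm
  have h2 : Measurable fun v : Fin m → ℝ => (WithLp.toLp 2 v : EuclideanSpace ℝ (Fin m)) := by
    fun_prop
  exact (h2.comp_aemeasurable h1).aestronglyMeasurable

theorem memLp (h : IsElliptic Ω A α β) (hΩ : IsOpen Ω) {q : ℝ≥0∞}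
    (hG : MemLp G q (volume.restrict Ω)) :
    MemLp (fun x => (WithLp.toLp 2 (A x *ᵥ (G x).ofLp) : EuclideanSpace ℝ (Fin m))) q
      (volume.restrict Ω) := by
  refine hG.of_le_mul (c := β) (h.aestronglyMeasurable hG.1) ?_
  filter_upwards [ae_restrict_mem hΩ.measurableSet] with x hx using h.bdd x hx (G x)

theorem _root_.MeasureTheory.MemLp.integrable_inner_two {α F : Type*} [MeasurableSpace α]
    [NormedAddCommGroup F] [InnerProductSpace ℝ F] {μ : Measure α} {f g : α → F}
    (hf : MemLp f 2 μ) (hg : MemLp g 2 μ) : Integrable (fun x => inner ℝ (f x) (g x)) μ := by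
  refine (hf.norm.integrable_mul hg.norm).mono' (hf.1.inner hg.1) (Eventually.of_forall fun x => ?_)
  exact abs_real_inner_le_norm _ _

theorem integrable (h : IsElliptic Ω A α β) (hΩ : IsOpen Ω) (hG : MemLp G 2 (volume.restrict Ω))
    (hH : MemLp H 2 (volume.restrict Ω)) :
    Integrable (fun x => (A x *ᵥ (G x).ofLp) ⬝ᵥ (H x).ofLp) (volume.restrict Ω) := by
  refine ((h.memLp hΩ hG).integrable_inner_two hH).congr (Eventually.of_forall fun x => ?_)
  exact (dotProduct_eq_inner _ _).symm

theorem coercive_integral (h : IsElliptic Ω A α β) (hΩ : IsOpen Ω)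
    (hG : MemLp G 2 (volume.restrict Ω)) :
    α * (eLpNorm G 2 (volume.restrict Ω)).toReal ^ 2 ≤
      ∫ x in Ω, (A x *ᵥ (G x).ofLp) ⬝ᵥ (G x).ofLp := by
  have h1 : (eLpNorm G 2 (volume.restrict Ω)).toReal ^ 2 = ∫ x in Ω, ‖G x‖ ^ 2 := by
    have e1 := Lp.norm_toLp G hG
    rw [← e1, ← real_inner_self_eq_norm_sq, L2.inner_def]
    refine integral_congr_ae ?_
    filter_upwards [hG.coeFn_toLp] with x hx
    rw [hx, real_inner_self_eq_norm_sq]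
  rw [h1, ← integral_const_mul]
  refine integral_mono_ae ?_ (h.integrable hΩ hG hG) ?_
  · have := (hG.integrable_inner_two hG).const_mul α
    simpa only [real_inner_self_eq_norm_sq] using this
  · filter_upwards [ae_restrict_mem hΩ.measurableSet] with x hx using h.coercive x hx (G x)

end IsElliptic

end

section

variable {N m : ℕ} {X : VectorFields N m} {Ω : Set (EuclideanSpace ℝ (Fin N))} {Q : ℝ}

/-! ### Weak solutions -/

/-- A bounded open set whose locally Lipschitz vector fields satisfy the Sobolev inequality with
homogeneous dimension `Q`. -/
structure SobolevSetting (X : VectorFields N m) (Ω : Set (EuclideanSpace ℝ (Fin N))) (Q : ℝ) :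
    Prop where
  lip : ∀ j, LocallyLipschitz (X j)
  isOpen : IsOpen Ω
  isBounded : Bornology.IsBounded Ω
  two_lt : 2 < Q
  sobolev : HasSobolev X Ω (ENNReal.ofReal (2 * Q / (Q - 2)))

namespace SobolevSetting

theorem isFiniteMeasure (hS : SobolevSetting X Ω Q) : IsFiniteMeasure (volume.restrict Ω) :=
  ⟨by simpa using hS.isBounded.measure_lt_top⟩

theorem two_le_exponent (hS : SobolevSetting X Ω Q) : 2 ≤ ENNReal.ofReal (2 * Q / (Q - 2)) := by
  have h2 := hS.two_lt
  rw [show (2 : ℝ≥0∞) = ENNReal.ofReal 2 by simp]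
  refine ENNReal.ofReal_le_ofReal ?_
  rw [le_div_iff₀ (by linarith)]
  linarith

theorem holderConjugate (hS : SobolevSetting X Ω Q) :
    (ENNReal.ofReal (2 * Q / (Q + 2))).HolderConjugate (ENNReal.ofReal (2 * Q / (Q - 2))) := by
  have h2 := hS.two_lt
  refine Real.HolderConjugate.ennrealOfReal (Real.holderConjugate_iff.2 ⟨?_, ?_⟩)
  · rw [lt_div_iff₀ (by linarith)]; linarith
  · have : Q - 2 ≠ 0 := by linarith
    have : Q + 2 ≠ 0 := by linarith
    field_simp
    ring

theorem exists_eLpNorm_le (hS : SobolevSetting X Ω Q) {q : ℝ≥0∞}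
    (hq : q ≤ ENNReal.ofReal (2 * Q / (Q - 2))) (hq0 : 1 ≤ q) :
    ∃ C : ℝ≥0∞, C ≠ ⊤ ∧ ∀ u G, IsSobolevZero X Ω 2 u G →
      eLpNorm u q (volume.restrict Ω) ≤ C * eLpNorm G 2 (volume.restrict Ω) := by
  have := hS.isFiniteMeasure
  obtain ⟨C, hC, h⟩ := hS.sobolev.exists_forall hS.lip
  have hqt : q ≠ ⊤ := (hq.trans_lt ENNReal.ofReal_lt_top).ne
  refine ⟨C * volume.restrict Ω univ ^ (1 / q.toReal -
    1 / (ENNReal.ofReal (2 * Q / (Q - 2))).toReal), ENNReal.mul_ne_top hC ?_, fun u G hu => ?_⟩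
  · refine ENNReal.rpow_ne_top_of_nonneg ?_ (measure_ne_top _ _)
    have := ENNReal.toReal_mono ENNReal.ofReal_ne_top hq
    have h0 : 0 < q.toReal := ENNReal.toReal_pos (by positivity) hqt
    exact sub_nonneg.2 (one_div_le_one_div_of_le h0 this)
  · refine (eLpNorm_le_eLpNorm_mul_rpow_measure_univ hq hu.1.1).trans ?_
    rw [mul_right_comm]
    gcongr
    exact h u G hu

/-- By the Sobolev inequality the gradient determines the function, so `W_0^{1,2}(Ω, X)` can be
handled as a subspace of gradients in `L^2`. -/
theorem ae_eq_of_ae_eq (hS : SobolevSetting X Ω Q) {u v : EuclideanSpace ℝ (Fin N) → ℝ}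
    {G H : EuclideanSpace ℝ (Fin N) → EuclideanSpace ℝ (Fin m)} (hu : IsSobolevZero X Ω 2 u G)
    (hv : IsSobolevZero X Ω 2 v H) (h : G =ᵐ[volume.restrict Ω] H) : u =ᵐ[volume.restrict Ω] v := by
  obtain ⟨C, hC, hle⟩ := hS.exists_eLpNorm_le hS.two_le_exponent one_le_two
  have h1 := hle _ _ (hu.sub hS.lip hv)
  have h2 : eLpNorm (G - H) 2 (volume.restrict Ω) = 0 := by
    rw [eLpNorm_eq_zero_iff (hu.2.1.1.sub hv.2.1.1) two_ne_zero]
    filter_upwards [h] with x hx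
    simp [hx]
  rw [h2, mul_zero, nonpos_iff_eq_zero, eLpNorm_eq_zero_iff (hu.1.1.sub hv.1.1) two_ne_zero] at h1
  filter_upwards [h1] with x hx
  exact sub_eq_zero.1 hx

end SobolevSetting

/-- The space of `X`-gradients of the functions in `W_0^{1,2}(Ω, X)`. -/
def gradientSpace (hS : SobolevSetting X Ω Q) :
    Submodule ℝ (Lp (EuclideanSpace ℝ (Fin m)) 2 (volume.restrict Ω)) where
  carrier := {H | ∃ u, IsSobolevZero X Ω 2 u H}
  add_mem' := by
    rintro G H ⟨u, hu⟩ ⟨v, hv⟩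
    exact ⟨u + v, (hu.add hS.lip hv).congr EventuallyEq.rfl (Lp.coeFn_add G H).symm⟩
  zero_mem' := ⟨0, (isSobolevZero_zero hS.lip).congr EventuallyEq.rfl (Lp.coeFn_zero _ _ _).symm⟩
  smul_mem' := by
    rintro c G ⟨u, hu⟩
    exact ⟨c • u, (hu.const_smul c).congr EventuallyEq.rfl (Lp.coeFn_smul c G).symm⟩

theorem mem_gradientSpace {hS : SobolevSetting X Ω Q}
    {H : Lp (EuclideanSpace ℝ (Fin m)) 2 (volume.restrict Ω)} :
    H ∈ gradientSpace hS ↔ ∃ u, IsSobolevZero X Ω 2 u H := Iff.rfl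

attribute [irreducible] gradientSpace

/-- Uniqueness makes the choice of a primitive linear, and the Sobolev inequality makes it
continuous. -/
theorem exists_gradient_inverse (hS : SobolevSetting X Ω Q) :
    ∃ U : gradientSpace hS →L[ℝ] Lp ℝ 2 (volume.restrict Ω),
      ∀ H : gradientSpace hS, IsSobolevZero X Ω 2 (U H) H.1 := by
  choose u hu using fun H : gradientSpace hS => mem_gradientSpace.1 H.2
  obtain ⟨C, hC, hle⟩ := hS.exists_eLpNorm_le hS.two_le_exponent one_le_two
  let L : gradientSpace hS →ₗ[ℝ] Lp ℝ 2 (volume.restrict Ω) :=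
    { toFun := fun H => (hu H).1.toLp
      map_add' := fun G H => by
        rw [← MemLp.toLp_add, MemLp.toLp_eq_toLp_iff]
        exact hS.ae_eq_of_ae_eq (hu (G + H)) ((hu G).add hS.lip (hu H)) (Lp.coeFn_add _ _)
      map_smul' := fun c H => by
        rw [RingHom.id_apply, ← MemLp.toLp_const_smul, MemLp.toLp_eq_toLp_iff]
        exact hS.ae_eq_of_ae_eq (hu (c • H)) ((hu H).const_smul c) (Lp.coeFn_smul _ _) }
  refine ⟨L.mkContinuous C.toReal fun H => ?_, fun H => ?_⟩
  · change ‖(hu H).1.toLp‖ ≤ C.toReal * ‖H.1‖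
    rw [Lp.norm_toLp, Lp.norm_def, ← ENNReal.toReal_mul]
    exact ENNReal.toReal_mono (ENNReal.mul_ne_top hC (Lp.eLpNorm_ne_top _)) (hle _ _ (hu H))
  · exact (hu H).congr (hu H).1.coeFn_toLp.symm EventuallyEq.rfl

/-- If gradients converge, continuity of the inverse makes the functions Cauchy, and the limit pair
again lies in the closure. -/
theorem isClosed_gradientSpace (hS : SobolevSetting X Ω Q) :
    IsClosed (gradientSpace hS : Set (Lp (EuclideanSpace ℝ (Fin m)) 2 (volume.restrict Ω))) := by
  obtain ⟨U, hU⟩ := exists_gradient_inverse hS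
  refine IsSeqClosed.isClosed fun H G hH hG => ?_
  let K : ℕ → gradientSpace hS := fun n => ⟨H n, hH n⟩
  have hK : CauchySeq K := by
    have h1 : CauchySeq H := hG.cauchySeq
    rw [Metric.cauchySeq_iff'] at h1 ⊢
    exact h1
  obtain ⟨w, hw⟩ := cauchySeq_tendsto_of_complete (U.uniformContinuous.comp_cauchySeq hK)
  refine mem_gradientSpace.2 ⟨w, IsSobolevZero.of_tendsto hS.lip (fun n => hU (K n)) (Lp.memLp w) (Lp.memLp G) ?_ ?_⟩
  · exact (Lp.tendsto_Lp_iff_tendsto_eLpNorm' _ _).1 hw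
  · exact (Lp.tendsto_Lp_iff_tendsto_eLpNorm' _ _).1 hG

variable {A : EuclideanSpace ℝ (Fin N) → Matrix (Fin m) (Fin m) ℝ} {α β : ℝ}

theorem IsElliptic.exists_operator (hA : IsElliptic Ω A α β) (hΩ : IsOpen Ω) :
    ∃ T : Lp (EuclideanSpace ℝ (Fin m)) 2 (volume.restrict Ω) →L[ℝ]
        Lp (EuclideanSpace ℝ (Fin m)) 2 (volume.restrict Ω),
      ∀ G, T G =ᵐ[volume.restrict Ω] fun x => WithLp.toLp 2 (A x *ᵥ (G x).ofLp) := by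
  let L : Lp (EuclideanSpace ℝ (Fin m)) 2 (volume.restrict Ω) →ₗ[ℝ]
      Lp (EuclideanSpace ℝ (Fin m)) 2 (volume.restrict Ω) :=
    { toFun := fun G => (hA.memLp hΩ (Lp.memLp G)).toLp
      map_add' := fun G H => by
        rw [← MemLp.toLp_add, MemLp.toLp_eq_toLp_iff]
        filter_upwards [Lp.coeFn_add G H] with x hx
        rw [hx, Pi.add_apply, Pi.add_apply, WithLp.ofLp_add, mulVec_add, WithLp.toLp_add]
      map_smul' := fun c H => by
        rw [RingHom.id_apply, ← MemLp.toLp_const_smul, MemLp.toLp_eq_toLp_iff]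
        filter_upwards [Lp.coeFn_smul c H] with x hx
        rw [hx, Pi.smul_apply, Pi.smul_apply, WithLp.ofLp_smul, mulVec_smul, WithLp.toLp_smul] }
  refine ⟨L.mkContinuous β fun G => ?_, fun G => (hA.memLp hΩ (Lp.memLp G)).coeFn_toLp⟩
  refine Lp.norm_le_mul_norm_of_ae_le_mul ?_
  filter_upwards [ae_restrict_mem hΩ.measurableSet, (hA.memLp hΩ (Lp.memLp G)).coeFn_toLp]
    with x hx h1
  change ‖(hA.memLp hΩ (Lp.memLp G)).toLp _ x‖ ≤ _
  rw [h1]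
  exact hA.bdd x hx _

/-- Hölder with the conjugate exponents `2Q/(Q+2)` and `2Q/(Q-2)`: this is why approximating data
are taken in `L^{2Q/(Q+2)}`. -/
theorem SobolevSetting.exists_integral_mul_le (hS : SobolevSetting X Ω Q)
    {f : EuclideanSpace ℝ (Fin N) → ℝ}
    (hf : MemLp f (ENNReal.ofReal (2 * Q / (Q + 2))) (volume.restrict Ω)) :
    ∃ C : ℝ≥0∞, C ≠ ⊤ ∧ ∀ u G, IsSobolevZero X Ω 2 u G →
      Integrable (fun x => f x * u x) (volume.restrict Ω) ∧
      ‖∫ x in Ω, f x * u x‖ₑ ≤ C * eLpNorm G 2 (volume.restrict Ω) := by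
  have := hS.holderConjugate
  obtain ⟨C, hC, hle⟩ := hS.exists_eLpNorm_le le_rfl (one_le_two.trans hS.two_le_exponent)
  refine ⟨eLpNorm f (ENNReal.ofReal (2 * Q / (Q + 2))) (volume.restrict Ω) * C,
    ENNReal.mul_ne_top hf.2.ne hC, fun u G hu => ?_⟩
  have hu2 : MemLp u (ENNReal.ofReal (2 * Q / (Q - 2))) (volume.restrict Ω) :=
    ⟨hu.1.1, (hle u G hu).trans_lt (ENNReal.mul_lt_top hC.lt_top hu.2.1.2)⟩
  refine ⟨hf.integrable_mul hu2, (enorm_integral_le_lintegral_enorm _).trans ?_⟩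
  have h1 := eLpNorm_smul_le_mul_eLpNorm (p := ENNReal.ofReal (2 * Q / (Q + 2)))
    (q := ENNReal.ofReal (2 * Q / (Q - 2))) (r := 1) hu2.1 hf.1
  rw [eLpNorm_one_eq_lintegral_enorm] at h1
  refine h1.trans ?_
  rw [mul_assoc]
  gcongr
  exact hle u G hu

/-- The Lax–Milgram theorem on a closed subspace. -/
theorem exists_inner_eq_of_coercive {E : Type*} [NormedAddCommGroup E] [InnerProductSpace ℝ E]
    [CompleteSpace E] (V : Submodule ℝ E) (hV : IsClosed (V : Set E)) (T : E →L[ℝ] E)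
    (hα : 0 < α) (hT : ∀ G ∈ V, α * ‖G‖ ^ 2 ≤ inner ℝ (T G) G) (l : V →L[ℝ] ℝ) :
    ∃ G : V, ∀ K : V, inner ℝ (T G) (K : E) = l K := by
  have : CompleteSpace V := hV.completeSpace_coe
  let B : V →L[ℝ] V →L[ℝ] ℝ := (innerSL ℝ).bilinearComp (T ∘L V.subtypeL) V.subtypeL
  have hc : IsCoercive B := ⟨α, hα, fun G => by
    have := hT G G.2
    rwa [sq, ← mul_assoc] at this⟩
  refine ⟨hc.continuousLinearEquivOfBilin.symm ((InnerProductSpace.toDual ℝ V).symm l), fun K => ?_⟩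
  have := hc.continuousLinearEquivOfBilin_apply
    (hc.continuousLinearEquivOfBilin.symm ((InnerProductSpace.toDual ℝ V).symm l)) K
  rw [ContinuousLinearEquiv.apply_symm_apply, InnerProductSpace.toDual_symm_apply] at this
  exact this.symm

theorem exists_continuousLinearMap_eq {V : Type*} [SeminormedAddCommGroup V] [NormedSpace ℝ V]
    (F : V → ℝ) (hadd : ∀ x y, F (x + y) = F x + F y) (hsmul : ∀ (c : ℝ) x, F (c • x) = c • F x)
    (C : ℝ) (hbd : ∀ x, ‖F x‖ ≤ C * ‖x‖) : ∃ l : V →L[ℝ] ℝ, ∀ x, l x = F x :=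
  ⟨LinearMap.mkContinuous ⟨⟨F, hadd⟩, hsmul⟩ C hbd, fun _ => rfl⟩

set_option maxHeartbeats 1000000 in
theorem exists_datum_functional (hS : SobolevSetting X Ω Q) {f : EuclideanSpace ℝ (Fin N) → ℝ}
    (hf : MemLp f (ENNReal.ofReal (2 * Q / (Q + 2))) (volume.restrict Ω)) :
    ∃ l : gradientSpace hS →L[ℝ] ℝ, ∀ (H : gradientSpace hS) (u : EuclideanSpace ℝ (Fin N) → ℝ),
      IsSobolevZero X Ω 2 u H.1 → l H = ∫ x in Ω, f x * u x := by
  obtain ⟨U, hU⟩ := exists_gradient_inverse hS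
  obtain ⟨C, hC, hfle⟩ := hS.exists_integral_mul_le hf
  obtain ⟨F, hF⟩ : ∃ F : gradientSpace hS → ℝ, ∀ H, F H = ∫ x in Ω, f x * U H x :=
    ⟨_, fun _ => rfl⟩
  have hadd : ∀ G H, F (G + H) = F G + F H := fun G H => by
    rw [hF, hF, hF, ← integral_add (hfle _ _ (hU G)).1 (hfle _ _ (hU H)).1]
    refine integral_congr_ae ?_
    rw [map_add]
    filter_upwards [Lp.coeFn_add (U G) (U H)] with x hx
    rw [hx, Pi.add_apply, mul_add]
  have hsmul : ∀ (c : ℝ) H, F (c • H) = c • F H := fun c H => by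
    rw [hF, hF, smul_eq_mul, ← integral_const_mul]
    refine integral_congr_ae ?_
    rw [map_smul]
    filter_upwards [Lp.coeFn_smul c (U H)] with x hx
    rw [hx, Pi.smul_apply, smul_eq_mul]
    ring
  have hbd : ∀ H, ‖F H‖ ≤ C.toReal * ‖H‖ := fun H => by
    rw [hF, Submodule.coe_norm, ← toReal_enorm, Lp.norm_def, ← ENNReal.toReal_mul]
    exact ENNReal.toReal_mono (ENNReal.mul_ne_top hC (Lp.eLpNorm_ne_top _)) (hfle _ _ (hU H)).2
  obtain ⟨l, hl⟩ := exists_continuousLinearMap_eq F hadd hsmul C.toReal hbd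
  refine ⟨l, fun H u hu => (hl H).trans ((hF H).trans ?_)⟩
  refine integral_congr_ae ?_
  filter_upwards [hS.ae_eq_of_ae_eq hu (hU H) EventuallyEq.rfl] with x hx
  rw [hx]

/-- Lax–Milgram with the gradient as unknown: in the `L^2` norm of gradients the form is coercive
with the ellipticity constant itself. -/
theorem exists_isWeakSolution (hS : SobolevSetting X Ω Q) (hA : IsElliptic Ω A α β)
    {f : EuclideanSpace ℝ (Fin N) → ℝ}
    (hf : MemLp f (ENNReal.ofReal (2 * Q / (Q + 2))) (volume.restrict Ω)) :
    ∃ u, IsWeakSolution X Ω A f u := by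
  obtain ⟨T, hT⟩ := hA.exists_operator hS.isOpen
  obtain ⟨l, hl⟩ := exists_datum_functional hS hf
  have hT' : ∀ G H, inner ℝ (T G) H = ∫ x in Ω, (A x *ᵥ (G x).ofLp) ⬝ᵥ (H x).ofLp := fun G H => by
    rw [L2.inner_def]
    refine integral_congr_ae ?_
    filter_upwards [hT G] with x hx
    rw [hx, ← dotProduct_eq_inner]
  have hcoer : ∀ G ∈ gradientSpace hS, α * ‖G‖ ^ 2 ≤ inner ℝ (T G) G := fun G _ => by
    have := hA.coercive_integral hS.isOpen (Lp.memLp G)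
    rwa [← Lp.norm_def, ← hT'] at this
  obtain ⟨G, hG⟩ := exists_inner_eq_of_coercive (gradientSpace hS) (isClosed_gradientSpace hS) T
    hA.pos hcoer l
  obtain ⟨u, hu⟩ := mem_gradientSpace.1 G.2
  refine ⟨u, G.1, hu, fun v H hv => ?_⟩
  have hK : IsSobolevZero X Ω 2 v hv.2.1.toLp := hv.congr EventuallyEq.rfl hv.2.1.coeFn_toLp.symm
  rw [← hl ⟨hv.2.1.toLp, mem_gradientSpace.2 ⟨v, hK⟩⟩ v hK, ← hG, hT']
  refine integral_congr_ae ?_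
  filter_upwards [hv.2.1.coeFn_toLp] with x hx
  rw [hx]

/-- Testing both equations with the difference, coercivity forces equal gradients. -/
theorem IsWeakSolution.ae_eq (hS : SobolevSetting X Ω Q) (hA : IsElliptic Ω A α β)
    {f u v : EuclideanSpace ℝ (Fin N) → ℝ} (hu : IsWeakSolution X Ω A f u)
    (hv : IsWeakSolution X Ω A f v) : u =ᵐ[volume.restrict Ω] v := by
  obtain ⟨G, hG, h1⟩ := hu
  obtain ⟨H, hH, h2⟩ := hv
  refine hS.ae_eq_of_ae_eq hG hH ?_
  have hd := hG.sub hS.lip hH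
  have h3 := hA.coercive_integral hS.isOpen hd.2.1
  have h4 : ∫ x in Ω, (A x *ᵥ ((G - H) x).ofLp) ⬝ᵥ ((G - H) x).ofLp = 0 := by
    rw [← sub_eq_zero.2 ((h1 _ _ hd).trans (h2 _ _ hd).symm), ← integral_sub
      (hA.integrable hS.isOpen hG.2.1 hd.2.1) (hA.integrable hS.isOpen hH.2.1 hd.2.1)]
    refine integral_congr_ae (Eventually.of_forall fun x => ?_)
    change _ = A x *ᵥ (G x).ofLp ⬝ᵥ ((G - H) x).ofLp - A x *ᵥ (H x).ofLp ⬝ᵥ ((G - H) x).ofLp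
    rw [← sub_dotProduct, ← mulVec_sub]
    rfl
  rw [h4] at h3
  have h5 : (eLpNorm (G - H) 2 (volume.restrict Ω)).toReal = 0 := by
    have := hA.pos
    by_contra hne
    have : 0 < (eLpNorm (G - H) 2 (volume.restrict Ω)).toReal ^ 2 := by positivity
    nlinarith
  have h6 : eLpNorm (G - H) 2 (volume.restrict Ω) = 0 := by
    rcases (ENNReal.toReal_eq_zero_iff _).1 h5 with h | h
    · exact h
    · exact absurd h hd.2.1.2.ne
  rw [eLpNorm_eq_zero_iff hd.2.1.1 two_ne_zero] at h6
  filter_upwards [h6] with x hx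
  exact sub_eq_zero.1 hx

end

section

variable {N m : ℕ} {X : VectorFields N m} {Ω : Set (EuclideanSpace ℝ (Fin N))} {Q : ℝ}

/-! ### Truncations of functions in `W_0^{1,2}(Ω, X)` -/

theorem tendsto_eLpNorm_two_of_dominated {α F : Type*} [MeasurableSpace α] [NormedAddCommGroup F]
    {μ : Measure α} {f : ℕ → α → F} {b : α → ℝ} (hf : ∀ n, AEStronglyMeasurable (f n) μ)
    (hb : MemLp b 2 μ) (hle : ∀ n, ∀ᵐ x ∂μ, ‖f n x‖ ≤ b x)
    (hlim : ∀ᵐ x ∂μ, Tendsto (fun n => f n x) atTop (𝓝 0)) :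
    Tendsto (fun n => eLpNorm (f n) 2 μ) atTop (𝓝 0) := by
  have key : Tendsto (fun n => ∫⁻ x, ‖f n x‖ₑ ^ (2 : ℝ) ∂μ) atTop (𝓝 (∫⁻ _, 0 ∂μ)) := by
    refine tendsto_lintegral_of_dominated_convergence' (fun x => ‖b x‖ₑ ^ (2 : ℝ))
      (fun n => (hf n).enorm.pow_const _) (fun n => ?_) ?_ ?_
    · filter_upwards [hle n] with x hx
      gcongr
      rw [enorm_le_iff_norm_le]
      exact hx.trans (le_abs_self _)
    · have := lintegral_rpow_enorm_lt_top_of_eLpNorm_lt_top two_ne_zero ENNReal.ofNat_ne_top hb.2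
      simpa using this.ne
    · filter_upwards [hlim] with x hx
      have h1 : Tendsto (fun n => ‖f n x‖ₑ) atTop (𝓝 0) := by simpa using hx.enorm
      have h2 := ((ENNReal.continuous_rpow_const (y := (2 : ℝ))).tendsto 0).comp h1
      simpa [Function.comp_def] using h2
  have h3 := ((ENNReal.continuous_rpow_const (y := (1 / 2 : ℝ))).tendsto _).comp key
  simp only [lintegral_zero] at h3
  rw [ENNReal.zero_rpow_of_pos (by norm_num)] at h3
  refine h3.congr fun n => ?_
  rw [eLpNorm_eq_lintegral_rpow_enorm_toReal two_ne_zero ENNReal.ofNat_ne_top]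
  simp

theorem IsTest.comp {φ : EuclideanSpace ℝ (Fin N) → ℝ} (hφ : IsTest Ω φ) {T : ℝ → ℝ}
    (hT : ContDiff ℝ ∞ T) (h0 : T 0 = 0) : IsTest Ω (T ∘ φ) :=
  ⟨hT.comp hφ.1, hφ.2.1.comp_left h0,
    (closure_mono (Function.support_comp_subset h0 φ)).trans hφ.2.2⟩

theorem IsTest.xGrad_comp {φ : EuclideanSpace ℝ (Fin N) → ℝ} (hφ : IsTest Ω φ) {T : ℝ → ℝ}
    (hT : Differentiable ℝ T) (x : EuclideanSpace ℝ (Fin N)) :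
    xGrad X (T ∘ φ) x = deriv T (φ x) • xGrad X φ x := by
  ext j
  have : fderiv ℝ (T ∘ φ) x = deriv T (φ x) • fderiv ℝ φ x :=
    ((hT (φ x)).hasDerivAt.comp_hasFDerivAt x (hφ.differentiable x).hasFDerivAt).fderiv
  simp [xGrad, this]

/-- `T ∘ φ_n` is again a test function because `T 0 = 0`, and it converges to `T ∘ v` because `T` is
`1`-Lipschitz. -/
theorem IsSobolevZero.comp (hX : ∀ j, LocallyLipschitz (X j))
    {v : EuclideanSpace ℝ (Fin N) → ℝ} {G : EuclideanSpace ℝ (Fin N) → EuclideanSpace ℝ (Fin m)}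
    (hv : IsSobolevZero X Ω 2 v G) {T : ℝ → ℝ} (hT : ContDiff ℝ ∞ T) (h0 : T 0 = 0)
    (hT1 : ∀ s, |deriv T s| ≤ 1) :
    IsSobolevZero X Ω 2 (T ∘ v) (fun x => deriv T (v x) • G x) := by
  obtain ⟨hvm, hGm, φ, hφ, h1, h2⟩ := hv
  have hφ' : ∀ n, IsTest Ω (φ n) := hφ
  have hTd : Differentiable ℝ T := hT.differentiable (by simp)
  have hTc : Continuous (deriv T) := hT.continuous_deriv (by simp)
  have hlip : ∀ a b, |T a - T b| ≤ |a - b| := fun a b => by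
    have := (convex_univ (𝕜 := ℝ) (E := ℝ)).norm_image_sub_le_of_norm_deriv_le (f := T) (C := 1)
      (fun x _ => hTd x) (fun x _ => hT1 x) (mem_univ b) (mem_univ a)
    simpa using this
  obtain ⟨ns, hns, hae⟩ := (tendstoInMeasure_of_tendsto_eLpNorm two_ne_zero
    (fun n => ((hφ' n).memLp 2).1) hvm.1 h1).exists_seq_tendsto_ae
  have hTG : AEStronglyMeasurable (fun x => deriv T (v x) • G x) (volume.restrict Ω) :=
    (hTc.comp_aestronglyMeasurable hvm.1).smul hGm.1
  refine IsSobolevZero.of_tendsto hX (us := fun n => T ∘ φ (ns n))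
    (fun n => ((hφ' (ns n)).comp hT h0).isSobolevZero hX) ?_ ?_ ?_ ?_
  · refine hvm.mono (hTd.continuous.comp_aestronglyMeasurable hvm.1) (Eventually.of_forall fun x => ?_)
    simpa [h0] using hlip (v x) 0
  · refine hGm.mono hTG (Eventually.of_forall fun x => ?_)
    rw [norm_smul]
    exact mul_le_of_le_one_left (norm_nonneg _) (hT1 _)
  · refine tendsto_of_tendsto_of_tendsto_of_le_of_le tendsto_const_nhds
      (h1.comp hns.tendsto_atTop) (fun _ => zero_le) fun n => ?_
    refine eLpNorm_mono fun x => ?_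
    exact hlip _ _
  · have hlim : Tendsto (fun n => eLpNorm (fun x => (deriv T (φ (ns n) x) - deriv T (v x)) • G x) 2
        (volume.restrict Ω)) atTop (𝓝 0) := by
      refine tendsto_eLpNorm_two_of_dominated (b := fun x => 2 * ‖G x‖) (fun n => ?_)
        (hGm.norm.const_mul 2) (fun n => Eventually.of_forall fun x => ?_) ?_
      · exact ((hTc.comp_aestronglyMeasurable ((hφ' _).memLp 2).1).sub
          (hTc.comp_aestronglyMeasurable hvm.1)).smul hGm.1
      · rw [norm_smul]
        gcongr
        refine (norm_sub_le _ _).trans ?_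
        have h3 := hT1 (φ (ns n) x)
        have h4 := hT1 (v x)
        simp only [Real.norm_eq_abs]
        linarith
      · filter_upwards [hae] with x hx
        have h3 := ((hTc.tendsto (v x)).comp hx).sub_const (deriv T (v x))
        simpa using h3.smul_const (G x)
    refine tendsto_of_tendsto_of_tendsto_of_le_of_le tendsto_const_nhds
      (by simpa using (h2.comp hns.tendsto_atTop).add hlim) (fun _ => zero_le) fun n => ?_
    -- The first summand tends to zero because `|T'| ≤ 1`, the second by dominated convergence along
    -- the almost everywhere convergent subsequence.
    have hsplit : xGrad X (T ∘ φ (ns n)) - (fun x => deriv T (v x) • G x) =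
        (fun x => deriv T (φ (ns n) x) • (xGrad X (φ (ns n)) - G) x) +
        fun x => (deriv T (φ (ns n) x) - deriv T (v x)) • G x := by
      ext1 x
      simp only [Pi.sub_apply, Pi.add_apply, (hφ' (ns n)).xGrad_comp hTd x, smul_sub, sub_smul]
      abel
    rw [hsplit]
    refine (eLpNorm_add_le ?_ ?_ one_le_two).trans ?_
    · exact (hTc.comp_aestronglyMeasurable ((hφ' _).memLp 2).1).smul
        (((hφ' _).memLp_xGrad hX 2).1.sub hGm.1)
    · exact ((hTc.comp_aestronglyMeasurable ((hφ' _).memLp 2).1).sub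
          (hTc.comp_aestronglyMeasurable hvm.1)).smul hGm.1
    · refine add_le_add_left (eLpNorm_mono fun x => ?_) _
      rw [norm_smul]
      exact mul_le_of_le_one_left (norm_nonneg _) (hT1 _)

/-- A smooth function close to the positive part. -/
def smoothPosPart (s : ℝ) : ℝ := ∫ t in (0 : ℝ)..s, Real.smoothTransition t

theorem hasDerivAt_smoothPosPart (s : ℝ) :
    HasDerivAt smoothPosPart (Real.smoothTransition s) s :=
  Real.smoothTransition.continuous.integral_hasStrictDerivAt 0 s |>.hasDerivAt

theorem contDiff_smoothPosPart : ContDiff ℝ ∞ smoothPosPart := by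
  refine contDiff_infty_iff_deriv.2 ⟨fun s => (hasDerivAt_smoothPosPart s).differentiableAt, ?_⟩
  rw [funext fun s => (hasDerivAt_smoothPosPart s).deriv]
  exact Real.smoothTransition.contDiff

theorem smoothPosPart_of_nonpos {s : ℝ} (hs : s ≤ 0) : smoothPosPart s = 0 := by
  rw [smoothPosPart, intervalIntegral.integral_congr (g := fun _ => 0)]
  · simp
  · intro t ht
    rw [uIcc_of_ge hs] at ht
    exact Real.smoothTransition.zero_of_nonpos ht.2

theorem abs_smoothPosPart_sub_le (s : ℝ) : |smoothPosPart s - max s 0| ≤ 1 := by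
  have hi : ∀ a b, IntervalIntegrable Real.smoothTransition volume a b := fun a b =>
    Real.smoothTransition.continuous.intervalIntegrable a b
  rcases le_total s 0 with hs | hs
  · simp [smoothPosPart_of_nonpos hs, hs]
  · have h1 : smoothPosPart s ≤ s := by
      have := intervalIntegral.integral_mono_on hs (hi 0 s) intervalIntegrable_const
        (g := fun _ => 1) fun t _ => Real.smoothTransition.le_one t
      simpa [smoothPosPart] using this
    have h0 : ∀ b, 0 ≤ b → 0 ≤ smoothPosPart b := fun b hb =>
      intervalIntegral.integral_nonneg hb fun t _ => Real.smoothTransition.nonneg t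
    have h2 : s - 1 ≤ smoothPosPart s := by
      rcases le_total s 1 with h | h
      · linarith [h0 s hs]
      · have e1 : smoothPosPart s = smoothPosPart 1 + ∫ t in (1 : ℝ)..s, Real.smoothTransition t :=
          (intervalIntegral.integral_add_adjacent_intervals (hi _ _) (hi _ _)).symm
        have e2 : ∫ t in (1 : ℝ)..s, Real.smoothTransition t = s - 1 := by
          rw [intervalIntegral.integral_congr (g := fun _ => 1)]
          · simp
          · intro t ht
            rw [uIcc_of_le h] at ht
            exact Real.smoothTransition.one_of_one_le ht.1
        linarith [h0 1 zero_le_one]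
    rw [max_eq_left hs, abs_le]
    constructor <;> linarith

/-- Truncation: `(v - k)^+ ∈ W_0^{1,2}(Ω, X)` for `k ≥ 0`. -/
theorem IsSobolevZero.posPart_sub (hS : SobolevSetting X Ω Q)
    {v : EuclideanSpace ℝ (Fin N) → ℝ} {G : EuclideanSpace ℝ (Fin N) → EuclideanSpace ℝ (Fin m)}
    (hv : IsSobolevZero X Ω 2 v G) (hvm : StronglyMeasurable v) {k : ℝ} (hk : 0 ≤ k) :
    IsSobolevZero X Ω 2 (fun x => max (v x - k) 0) ({x | k < v x}.indicator G) := by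
  have := hS.isFiniteMeasure
  have hE : MeasurableSet {x | k < v x} := measurableSet_lt measurable_const hvm.measurable
  -- The rescaling brings the error to `1/(n+1)` and sends `T_n'` to `1` for `s > k` and to `0` for
  -- `s ≤ k`, matching the strict superlevel set. As `k ≥ 0`, `T_n` vanishes at `0`.
  set T : ℕ → ℝ → ℝ := fun n s => (n + 1 : ℝ)⁻¹ * smoothPosPart ((n + 1) * (s - k)) with hT
  have hder : ∀ n s, HasDerivAt (T n) (Real.smoothTransition ((n + 1) * (s - k))) s := fun n s => by
    have h1 : HasDerivAt (fun s : ℝ => ((n : ℝ) + 1) * (s - k)) ((n + 1) * 1) s :=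
      ((hasDerivAt_id s).sub_const k).const_mul _
    have h2 := ((hasDerivAt_smoothPosPart _).comp s h1).const_mul (n + 1 : ℝ)⁻¹
    refine h2.congr_deriv ?_
    have : (n : ℝ) + 1 ≠ 0 := by positivity
    field_simp
  have hTs : ∀ n, IsSobolevZero X Ω 2 (T n ∘ v) (fun x => deriv (T n) (v x) • G x) := fun n => by
    refine hv.comp hS.lip ?_ ?_ fun s => ?_
    · exact contDiff_const.mul (contDiff_smoothPosPart.comp
        (contDiff_const.mul (contDiff_id.sub contDiff_const)))
    · have : ((n : ℝ) + 1) * (0 - k) ≤ 0 := mul_nonpos_of_nonneg_of_nonpos (by positivity) (by linarith)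
      simp only [hT, smoothPosPart_of_nonpos this, mul_zero]
    · rw [(hder n s).deriv, abs_of_nonneg (Real.smoothTransition.nonneg _)]
      exact Real.smoothTransition.le_one _
  have hmax : Measurable fun x => max (v x - k) 0 :=
    (hvm.measurable.sub_const k).max measurable_const
  refine IsSobolevZero.of_tendsto hS.lip hTs ?_ (hv.2.1.indicator hE) ?_ ?_
  · refine hv.1.mono hmax.aestronglyMeasurable (Eventually.of_forall fun x => ?_)
    rw [Real.norm_of_nonneg (le_max_right _ _), Real.norm_eq_abs]
    exact max_le (by linarith [le_abs_self (v x)]) (abs_nonneg _)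
  · have hb : ∀ n, ∀ᵐ x ∂(volume.restrict Ω),
        ‖(T n ∘ v - fun x => max (v x - k) 0) x‖ ≤ (n + 1 : ℝ)⁻¹ := fun n =>
      Eventually.of_forall fun x => by
        have hn : (0 : ℝ) < n + 1 := by positivity
        have h1 := abs_smoothPosPart_sub_le ((n + 1) * (v x - k))
        have h2 : max (((n : ℝ) + 1) * (v x - k)) 0 = (n + 1) * max (v x - k) 0 := by
          rw [mul_max_of_nonneg _ _ hn.le, mul_zero]
        rw [h2] at h1
        have h3 : (T n ∘ v - fun x => max (v x - k) 0) x = (n + 1 : ℝ)⁻¹ *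
            (smoothPosPart ((n + 1) * (v x - k)) - (n + 1) * max (v x - k) 0) := by
          simp only [hT, Pi.sub_apply, Function.comp_apply]
          field_simp
        rw [h3, Real.norm_eq_abs, abs_mul, abs_of_pos (inv_pos.2 hn)]
        exact mul_le_of_le_one_right (inv_pos.2 hn).le h1
    refine tendsto_eLpNorm_two_of_dominated (b := fun _ => 1) (fun n => ?_) (memLp_const 1)
      (fun n => ?_) ?_
    · exact ((hTs n).1.1).sub hmax.aestronglyMeasurable
    · filter_upwards [hb n] with x hx
      refine hx.trans (inv_le_one_of_one_le₀ ?_)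
      linarith [n.cast_nonneg (α := ℝ)]
    · filter_upwards [ae_all_iff.2 hb] with x hx
      refine squeeze_zero_norm hx ?_
      exact tendsto_inv_atTop_zero.comp (tendsto_atTop_add_const_right _ _ tendsto_natCast_atTop_atTop)
  · refine tendsto_eLpNorm_two_of_dominated (b := fun x => 2 * ‖G x‖) (fun n => ?_)
      (hv.2.1.norm.const_mul 2) (fun n => Eventually.of_forall fun x => ?_)
      (Eventually.of_forall fun x => ?_)
    · exact (hTs n).2.1.1.sub (hv.2.1.indicator hE).1
    · refine (norm_sub_le _ _).trans ?_
      rw [two_mul]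
      refine add_le_add ?_ (norm_indicator_le_norm_self _ _)
      rw [norm_smul, (hder n _).deriv, Real.norm_of_nonneg (Real.smoothTransition.nonneg _)]
      exact mul_le_of_le_one_left (norm_nonneg _) (Real.smoothTransition.le_one _)
    · refine tendsto_const_nhds.congr' ?_
      by_cases hx : k < v x
      · have h1 : Tendsto (fun n : ℕ => ((n : ℝ) + 1) * (v x - k)) atTop atTop :=
          (tendsto_atTop_add_const_right _ _ tendsto_natCast_atTop_atTop).atTop_mul_const
            (sub_pos.2 hx)
        filter_upwards [h1.eventually_ge_atTop 1] with n hn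
        simp [(hder n _).deriv, Real.smoothTransition.one_of_one_le hn, indicator, hx]
      · refine Eventually.of_forall fun n => ?_
        have : ((n : ℝ) + 1) * (v x - k) ≤ 0 :=
          mul_nonpos_of_nonneg_of_nonpos (by positivity) (by linarith)
        simp [(hder n _).deriv, Real.smoothTransition.zero_of_nonpos this, indicator, hx]

end

section

variable {N m : ℕ} {X : VectorFields N m} {Ω : Set (EuclideanSpace ℝ (Fin N))} {Q : ℝ}

/-! ### Bounded solutions -/

/-- Stampacchia's iteration lemma. -/
theorem eq_zero_of_stampacchia {φ : ℝ → ℝ} (hφ : ∀ k, 0 ≤ φ k) {s b L d : ℝ} (hs : 0 < s)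
    (hb : 1 < b) (hL : 0 ≤ L) (hmono : Antitone φ)
    (h : ∀ k l, 0 ≤ k → k < l → (l - k) ^ s * φ l ≤ L * φ k ^ b) (hd : 0 < d)
    (hdL : L * φ 0 ^ (b - 1) * 2 ^ (s + s / (b - 1)) ≤ d ^ s) : φ d = 0 := by
  -- The decay rate solves `σ b = σ + s`, so the power `b` gained at each step pays for the
  -- shrinking gaps between levels.
  set σ := s / (b - 1) with hσ
  have hb1 : 0 < b - 1 := sub_pos.2 hb
  have hσ0 : 0 < σ := div_pos hs hb1
  have hσb : σ * b = σ + s := by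
    rw [hσ]; field_simp; ring
  -- Levels increasing to `d` with gaps `d 2^{-(n+1)}`.
  set k : ℕ → ℝ := fun n => d * (1 - (2 : ℝ) ^ (-(n : ℝ))) with hk
  have hstep : ∀ n : ℕ, k (n + 1) - k n = d * (2 : ℝ) ^ (-((n : ℝ) + 1)) := fun n => by
    have : (2 : ℝ) ^ (-(n : ℝ)) = 2 * (2 : ℝ) ^ (-((n : ℝ) + 1)) := by
      rw [neg_add, Real.rpow_add two_pos, Real.rpow_neg_one]; ring
    simp only [hk, Nat.cast_add, Nat.cast_one, this]
    ring
  have hk0 : ∀ n, 0 ≤ k n := fun n => by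
    refine mul_nonneg hd.le (sub_nonneg.2 ?_)
    exact Real.rpow_le_one_of_one_le_of_nonpos one_le_two (by simp)
  have hkd : ∀ n, k n ≤ d := fun n => by
    refine mul_le_of_le_one_right hd.le ?_
    have : (0 : ℝ) < 2 ^ (-(n : ℝ)) := by positivity
    linarith
  have hbound : ∀ n : ℕ, φ (k n) ≤ φ 0 * 2 ^ (-(n : ℝ) * σ) := by
    intro n
    induction n with
    | zero => simp [hk]
    | succ n ih =>
      have hpos : 0 < k (n + 1) - k n := by rw [hstep]; positivity
      have h1 := h (k n) (k (n + 1)) (hk0 n) (sub_pos.1 hpos)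
      have h2 : φ (k n) ^ b ≤ φ 0 * φ 0 ^ (b - 1) * 2 ^ (-(n : ℝ) * (σ + s)) := by
        refine (Real.rpow_le_rpow (hφ _) ih (by linarith)).trans_eq ?_
        rw [Real.mul_rpow (hφ 0) (by positivity), ← Real.rpow_mul two_pos.le, mul_assoc, hσb]
        congr 1
        rcases (hφ 0).eq_or_lt with h0 | h0
        · rw [← h0, Real.zero_rpow (by linarith), zero_mul]
        · rw [← Real.rpow_one_add' h0.le (by linarith)]
          congr 1; ring
      have h3 : (k (n + 1) - k n) ^ s = d ^ s * 2 ^ (-((n : ℝ) + 1) * s) := by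
        rw [hstep, Real.mul_rpow hd.le (by positivity), ← Real.rpow_mul two_pos.le]
      rw [h3] at h1
      have h4 : d ^ s * 2 ^ (-((n : ℝ) + 1) * s) * φ (k (n + 1)) ≤
          (d ^ s * 2 ^ (-((n : ℝ) + 1) * s)) * (φ 0 * 2 ^ (-((n : ℝ) + 1) * σ)) := by
        calc _ ≤ L * (φ 0 * φ 0 ^ (b - 1) * 2 ^ (-(n : ℝ) * (σ + s))) :=
              h1.trans (mul_le_mul_of_nonneg_left h2 hL)
          _ = (L * φ 0 ^ (b - 1) * 2 ^ (s + σ)) *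
              (φ 0 * (2 ^ (-((n : ℝ) + 1) * s) * 2 ^ (-((n : ℝ) + 1) * σ))) := by
              have : (2 : ℝ) ^ (-(n : ℝ) * (σ + s)) =
                  2 ^ (s + σ) * (2 ^ (-((n : ℝ) + 1) * s) * 2 ^ (-((n : ℝ) + 1) * σ)) := by
                rw [← Real.rpow_add two_pos, ← Real.rpow_add two_pos]
                congr 1; ring
              rw [this]; ring
          _ ≤ d ^ s * (φ 0 * (2 ^ (-((n : ℝ) + 1) * s) * 2 ^ (-((n : ℝ) + 1) * σ))) := by
              refine mul_le_mul_of_nonneg_right hdL ?_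
              have := hφ 0
              positivity
          _ = _ := by ring
      have h5 : 0 < d ^ s * (2 : ℝ) ^ (-((n : ℝ) + 1) * s) := by positivity
      have h6 := le_of_mul_le_mul_left h4 h5
      simpa using h6
  have hlim : Tendsto (fun n : ℕ => φ 0 * (2 : ℝ) ^ (-(n : ℝ) * σ)) atTop (𝓝 (φ 0 * 0)) := by
    refine Tendsto.const_mul _ ?_
    have h1 : Tendsto (fun n : ℕ => (n : ℝ) * σ) atTop atTop :=
      tendsto_natCast_atTop_atTop.atTop_mul_const hσ0
    have h2 := (tendsto_rpow_atBot_of_base_gt_one 2 one_lt_two).comp (tendsto_neg_atTop_atBot.comp h1)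
    simpa [Function.comp_def] using h2
  rw [mul_zero] at hlim
  exact le_antisymm (ge_of_tendsto' hlim fun n => (hmono (hkd n)).trans (hbound n)) (hφ d)

theorem IsWeakSolution.congr {A : EuclideanSpace ℝ (Fin N) → Matrix (Fin m) (Fin m) ℝ}
    {f g u v : EuclideanSpace ℝ (Fin N) → ℝ} (h : IsWeakSolution X Ω A f u)
    (hf : f =ᵐ[volume.restrict Ω] g) (hu : u =ᵐ[volume.restrict Ω] v) :
    IsWeakSolution X Ω A g v := by
  obtain ⟨G, hG, h1⟩ := h
  refine ⟨G, hG.congr hu EventuallyEq.rfl, fun w H hw => (h1 w H hw).trans (integral_congr_ae ?_)⟩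
  filter_upwards [hf] with x hx
  rw [hx]

theorem IsWeakSolution.neg {A : EuclideanSpace ℝ (Fin N) → Matrix (Fin m) (Fin m) ℝ}
    {f u : EuclideanSpace ℝ (Fin N) → ℝ} (h : IsWeakSolution X Ω A f u) :
    IsWeakSolution X Ω A (-f) (-u) := by
  obtain ⟨G, hG, h1⟩ := h
  refine ⟨-G, hG.neg, fun w H hw => ?_⟩
  have := h1 w H hw
  simp only [Pi.neg_apply, WithLp.ofLp_neg, mulVec_neg, neg_dotProduct, neg_mul, integral_neg, this]

variable {A : EuclideanSpace ℝ (Fin N) → Matrix (Fin m) (Fin m) ℝ} {α β : ℝ}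

/-- Energy estimate on superlevel sets. -/
theorem exists_level_estimate (hS : SobolevSetting X Ω Q) (hA : IsElliptic Ω A α β) {p : ℝ}
    (hp : Q / 2 < p) :
    ∃ C : ℝ, 0 ≤ C ∧ ∀ g v, MemLp g ∞ (volume.restrict Ω) → IsWeakSolution X Ω A g v →
      StronglyMeasurable v → ∀ k l, 0 ≤ k → k < l →
        (l - k) * ((volume.restrict Ω).real {x | l < v x}) ^ ((Q - 2) / (2 * Q)) ≤
          C * (eLpNorm g (ENNReal.ofReal p) (volume.restrict Ω)).toReal *
            ((volume.restrict Ω).real {x | k < v x}) ^ ((Q + 2) / (2 * Q) - 1 / p) := by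
  have := hS.isFiniteMeasure
  have hQ := hS.two_lt
  have hQ2 : 0 < Q - 2 := by linarith
  have hp0 : 0 < p := by linarith
  have := hS.holderConjugate
  obtain ⟨C, hC, hle⟩ := hS.exists_eLpNorm_le le_rfl (one_le_two.trans hS.two_le_exponent)
  have hpos := hA.pos
  refine ⟨C.toReal ^ 2 / α, by positivity, fun g v hg hv hvm k l hk hkl => ?_⟩
  obtain ⟨G, hG, hweak⟩ := hv
  set μ := volume.restrict Ω with hμ
  set s' := ENNReal.ofReal (2 * Q / (Q + 2)) with hs'
  set s := ENNReal.ofReal (2 * Q / (Q - 2)) with hs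
  set E := {x | k < v x} with hE
  have hEm : MeasurableSet E := measurableSet_lt measurable_const hvm.measurable
  -- The truncation is the test function: its gradient is that of `v` cut off to `E`, so the
  -- equation yields exactly the energy on `E`.
  set w : EuclideanSpace ℝ (Fin N) → ℝ := fun x => max (v x - k) 0 with hw
  have hwS : IsSobolevZero X Ω 2 w (E.indicator G) := hG.posPart_sub hS hvm hk
  have hw1 := hle _ _ hwS
  have hHtop : eLpNorm (E.indicator G) 2 μ ≠ ⊤ := hwS.2.1.2.ne
  have hwtop : eLpNorm w s μ ≠ ⊤ := (hw1.trans_lt (ENNReal.mul_lt_top hC.lt_top hHtop.lt_top)).ne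
  have hgp : MemLp g (ENNReal.ofReal p) μ := hg.mono_exponent le_top
  set h := (eLpNorm (E.indicator G) 2 μ).toReal with hh
  set θ := μ.real E with hθ
  have hθ0 : 0 ≤ θ := measureReal_nonneg
  have hγ : s' ≤ ENNReal.ofReal p := by
    refine ENNReal.ofReal_le_ofReal ?_
    rw [div_le_iff₀ (by linarith)]
    nlinarith
  -- the right-hand side
  have hrhs : ‖∫ x, g x * w x ∂μ‖ ≤ (eLpNorm g (ENNReal.ofReal p) μ).toReal *
      θ ^ ((Q + 2) / (2 * Q) - 1 / p) * (C.toReal * h) := by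
    have e1 : ∫ x, g x * w x ∂μ = ∫ x in E, g x * w x ∂μ := by
      refine (setIntegral_eq_integral_of_forall_compl_eq_zero fun x hx => ?_).symm
      have : v x - k ≤ 0 := by
        have : ¬ k < v x := hx
        linarith
      simp [hw, this]
    have e2 : ‖∫ x in E, g x * w x ∂μ‖ₑ ≤ eLpNorm g s' (μ.restrict E) * eLpNorm w s (μ.restrict E) := by
      refine (enorm_integral_le_lintegral_enorm _).trans ?_
      have := eLpNorm_smul_le_mul_eLpNorm (p := s') (q := s) (r := 1) (μ := μ.restrict E)
        hwS.1.1.restrict hg.1.restrict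
      rwa [eLpNorm_one_eq_lintegral_enorm] at this
    -- Hölder on `E` from `L^p` down to `L^{2Q/(Q+2)}`; the exponent of `|E|` is the difference of
    -- the reciprocals.
    have e3 : eLpNorm g s' (μ.restrict E) ≤ eLpNorm g (ENNReal.ofReal p) μ *
        μ E ^ ((Q + 2) / (2 * Q) - 1 / p) := by
      refine (eLpNorm_le_eLpNorm_mul_rpow_measure_univ hγ hg.1.restrict).trans ?_
      rw [Measure.restrict_apply_univ, hs', ENNReal.toReal_ofReal (by positivity),
        ENNReal.toReal_ofReal hp0.le, one_div_div]
      gcongr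
      exact Measure.restrict_le_self
    have e4 : eLpNorm w s (μ.restrict E) ≤ C * eLpNorm (E.indicator G) 2 μ :=
      (eLpNorm_mono_measure _ Measure.restrict_le_self).trans hw1
    have hexp : 0 ≤ (Q + 2) / (2 * Q) - 1 / p := by
      rw [sub_nonneg, div_le_div_iff₀ hp0 (by positivity)]
      nlinarith
    have e5 := e2.trans (mul_le_mul' e3 e4)
    rw [e1, ← toReal_enorm]
    refine (ENNReal.toReal_mono ?_ e5).trans_eq ?_
    · exact ENNReal.mul_ne_top (ENNReal.mul_ne_top hgp.2.ne
        (ENNReal.rpow_ne_top_of_nonneg hexp (measure_ne_top _ _))) (ENNReal.mul_ne_top hC hHtop)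
    · simp only [ENNReal.toReal_mul, ← ENNReal.toReal_rpow]
      rfl
  -- the energy
  have hen : α * h ^ 2 ≤ ∫ x, g x * w x ∂μ := by
    refine (hA.coercive_integral hS.isOpen hwS.2.1).trans_eq ?_
    rw [← hweak _ _ hwS]
    refine integral_congr_ae (Eventually.of_forall fun x => ?_)
    by_cases hx : x ∈ E <;> simp [hx]
  have hh1 : α * h ≤ (eLpNorm g (ENNReal.ofReal p) μ).toReal *
      θ ^ ((Q + 2) / (2 * Q) - 1 / p) * C.toReal := by
    rcases (ENNReal.toReal_nonneg (a := eLpNorm (E.indicator G) 2 μ)).eq_or_lt with h0 | h0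
    · rw [← hh] at h0
      rw [← h0, mul_zero]
      positivity
    · rw [← hh] at h0
      have := hen.trans ((le_abs_self _).trans hrhs)
      refine le_of_mul_le_mul_right ?_ h0
      linarith
  -- the Chebyshev inequality
  have hch : (l - k) * (μ.real {x | l < v x}) ^ ((Q - 2) / (2 * Q)) ≤ C.toReal * h := by
    have hlm : MeasurableSet {x | l < v x} := measurableSet_lt measurable_const hvm.measurable
    have c1 : eLpNorm ({x | l < v x}.indicator fun _ => l - k) s μ ≤ C * eLpNorm (E.indicator G) 2 μ := by
      refine (eLpNorm_mono fun x => ?_).trans hw1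
      by_cases hx : l < v x
      · have h1 : 0 ≤ l - k := by linarith
        have h2 : l - k ≤ v x - k := by linarith
        simp only [indicator, mem_ofPred_eq, hx, if_true, Real.norm_eq_abs, hw]
        rw [abs_of_nonneg h1, abs_of_nonneg (le_max_right _ _)]
        exact h2.trans (le_max_left _ _)
      · simp [indicator, hx]
    rw [eLpNorm_indicator_const hlm (ENNReal.ofReal_pos.2 (by positivity)).ne'
      ENNReal.ofReal_ne_top,
      ENNReal.toReal_ofReal (by positivity), one_div_div] at c1
    have c2 := ENNReal.toReal_mono (ENNReal.mul_ne_top hC hHtop) c1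
    rw [ENNReal.toReal_mul, ENNReal.toReal_mul, toReal_enorm, Real.norm_of_nonneg (by linarith),
      ← ENNReal.toReal_rpow] at c2
    exact c2
  refine hch.trans ?_
  have h7 : h ≤ ((eLpNorm g (ENNReal.ofReal p) μ).toReal *
      θ ^ ((Q + 2) / (2 * Q) - 1 / p) * C.toReal) / α := by
    rw [le_div_iff₀ hpos]; linarith
  calc C.toReal * h ≤ C.toReal * (((eLpNorm g (ENNReal.ofReal p) μ).toReal *
      θ ^ ((Q + 2) / (2 * Q) - 1 / p) * C.toReal) / α) := by gcongr
    _ = _ := by ring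

theorem exists_forall_le (hS : SobolevSetting X Ω Q) (hA : IsElliptic Ω A α β) {p : ℝ}
    (hp : Q / 2 < p) :
    ∃ K : ℝ, 0 ≤ K ∧ ∀ g v, MemLp g ∞ (volume.restrict Ω) → IsWeakSolution X Ω A g v →
      ∀ᵐ x ∂(volume.restrict Ω),
        v x ≤ K * (eLpNorm g (ENNReal.ofReal p) (volume.restrict Ω)).toReal := by
  have := hS.isFiniteMeasure
  have hQ := hS.two_lt
  have hQ2 : 0 < Q - 2 := by linarith
  have hp0 : 0 < p := by linarith
  obtain ⟨C, hC, hlev⟩ := exists_level_estimate hS hA hp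
  set μ := volume.restrict Ω with hμ
  set s := 2 * Q / (Q - 2) with hs
  have hs0 : 0 < s := by positivity
  set b := ((Q + 2) / (2 * Q) - 1 / p) * s with hbdef
  -- Here `b = 1 + (2/Q - 1/p) s`, so superlinearity is precisely the condition `p > Q/2`.
  have hb : 1 < b := by
    have : b = 1 + (4 / (2 * Q) - 1 / p) * s := by
      rw [hbdef, hs]
      have : Q - 2 ≠ 0 := hQ2.ne'
      have : Q ≠ 0 := by linarith
      field_simp
      ring
    rw [this]
    have h1 : 0 < 4 / (2 * Q) - 1 / p := by
      rw [sub_pos, div_lt_div_iff₀ hp0 (by positivity)]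
      linarith
    have := mul_pos h1 hs0
    linarith
  -- With `φ 0` bounded by the total mass, this is the value for which `d = K0 γ` meets the
  -- smallness condition of the iteration.
  set K0 : ℝ := C * (μ.real univ ^ (b - 1) * 2 ^ (s + s / (b - 1))) ^ s⁻¹ with hK0
  refine ⟨K0, by positivity, fun g v₀ hg hv₀ => ?_⟩
  obtain ⟨v, hvm, hvv⟩ : ∃ v, StronglyMeasurable v ∧ v₀ =ᵐ[μ] v := by
    obtain ⟨G, hG, _⟩ := hv₀
    exact ⟨_, hG.1.1.stronglyMeasurable_mk, hG.1.1.ae_eq_mk⟩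
  have hv := hv₀.congr EventuallyEq.rfl hvv
  set γ := (eLpNorm g (ENNReal.ofReal p) μ).toReal with hγ
  set φ : ℝ → ℝ := fun k => μ.real {x | k < v x} with hφ
  have hφ0 : ∀ k, 0 ≤ φ k := fun k => measureReal_nonneg
  have hmono : Antitone φ := fun k l hkl =>
    measureReal_mono fun x (hx : l < v x) => (hkl.trans_lt hx : k < v x)
  have hγ0 : 0 ≤ γ := ENNReal.toReal_nonneg
  have hstep : ∀ k l, 0 ≤ k → k < l → (l - k) ^ s * φ l ≤ (C * γ) ^ s * φ k ^ b := by
    intro k l hk hkl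
    have h1 := hlev g v hg hv hvm k l hk hkl
    have h2 := Real.rpow_le_rpow (mul_nonneg (by linarith) (by positivity)) h1 hs0.le
    rw [Real.mul_rpow (by linarith) (by positivity), Real.mul_rpow (by positivity) (by positivity),
      ← Real.rpow_mul (hφ0 _), ← Real.rpow_mul (hφ0 _)] at h2
    have h3 : (Q - 2) / (2 * Q) * s = 1 := by
      rw [hs]
      have : Q ≠ 0 := by linarith
      field_simp
    rw [h3, Real.rpow_one] at h2
    exact h2
  have hnull : ∀ d, 0 < d → K0 * γ ≤ d → μ {x | d < v x} = 0 := by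
    intro d hd hKd
    have hz : φ d = 0 := by
      refine eq_zero_of_stampacchia hφ0 hs0 hb (by positivity) hmono hstep hd ?_
      have h1 : (K0 * γ) ^ s = (C * γ) ^ s * (μ.real univ ^ (b - 1) * 2 ^ (s + s / (b - 1))) := by
        rw [hK0, mul_right_comm, Real.mul_rpow (by positivity) (by positivity),
          Real.rpow_inv_rpow (by positivity) hs0.ne']
      refine le_trans ?_ (Real.rpow_le_rpow (by positivity) hKd hs0.le)
      rw [h1, mul_assoc]
      have h2 : φ 0 ≤ μ.real univ := measureReal_mono (subset_univ _)
      have h3 : φ 0 ^ (b - 1) ≤ μ.real univ ^ (b - 1) :=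
        Real.rpow_le_rpow (hφ0 _) h2 (by linarith)
      gcongr
    exact (measureReal_eq_zero_iff).1 hz
  -- The iteration needs `d > 0`, while `γ` may vanish; hence the vanishing margin above `K0 γ`.
  have hae : ∀ n : ℕ, ∀ᵐ x ∂μ, v x ≤ K0 * γ + ((n : ℝ) + 1)⁻¹ := fun n => by
    have := hnull (K0 * γ + ((n : ℝ) + 1)⁻¹) (by positivity)
      (le_add_of_nonneg_right (by positivity))
    simpa [ae_iff] using this
  filter_upwards [ae_all_iff.2 hae, hvv] with x hx hxv
  rw [hxv]
  have hlim : Tendsto (fun n : ℕ => K0 * γ + ((n : ℝ) + 1)⁻¹) atTop (𝓝 (K0 * γ + 0)) :=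
    tendsto_const_nhds.add (tendsto_inv_atTop_zero.comp
      (tendsto_atTop_add_const_right _ _ tendsto_natCast_atTop_atTop))
  rw [add_zero] at hlim
  exact ge_of_tendsto' hlim hx

/-- Stampacchia's `L^∞` estimate. -/
theorem exists_eLpNorm_top_le (hS : SobolevSetting X Ω Q) (hA : IsElliptic Ω A α β) {p : ℝ}
    (hp : Q / 2 < p) :
    ∃ K : ℝ≥0∞, K ≠ ⊤ ∧ ∀ g v, MemLp g ∞ (volume.restrict Ω) → IsWeakSolution X Ω A g v →
      eLpNorm v ∞ (volume.restrict Ω) ≤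
        K * eLpNorm g (ENNReal.ofReal p) (volume.restrict Ω) := by
  have := hS.isFiniteMeasure
  obtain ⟨K, hK, hle⟩ := exists_forall_le hS hA hp
  refine ⟨ENNReal.ofReal K, ENNReal.ofReal_ne_top, fun g v hg hv => ?_⟩
  have h1 := hle g v hg hv
  have h2 := hle _ _ hg.neg hv.neg
  rw [eLpNorm_neg] at h2
  have hgp : MemLp g (ENNReal.ofReal p) (volume.restrict Ω) := hg.mono_exponent le_top
  rw [eLpNorm_exponent_top, ← ENNReal.ofReal_toReal hgp.2.ne, ← ENNReal.ofReal_mul hK]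
  refine eLpNormEssSup_le_of_ae_bound ?_
  filter_upwards [h1, h2] with x hx1 hx2
  rw [Real.norm_eq_abs, abs_le]
  exact ⟨by simp only [Pi.neg_apply] at hx2; linarith, hx1⟩

end

section

variable {N m : ℕ} {X : VectorFields N m} {Ω : Set (EuclideanSpace ℝ (Fin N))} {Q : ℝ}
  {A : EuclideanSpace ℝ (Fin N) → Matrix (Fin m) (Fin m) ℝ} {α β : ℝ}

/-! ### Duality solutions -/

theorem enorm_integral_mul_le {E : Type*} [MeasurableSpace E] {μ : Measure E} {g u : E → ℝ}
    (hg : AEStronglyMeasurable g μ) (hu : AEStronglyMeasurable u μ) :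
    ‖∫ x, g x * u x ∂μ‖ₑ ≤ eLpNorm g ∞ μ * eLpNorm u 1 μ := by
  refine (enorm_integral_le_lintegral_enorm _).trans ?_
  have := eLpNorm_smul_le_mul_eLpNorm (p := ∞) (q := 1) (r := 1) hu hg
  rwa [eLpNorm_one_eq_lintegral_enorm] at this

theorem _root_.MeasureTheory.MemLp.integrable_mul_top_one {E : Type*} [MeasurableSpace E] {μ : Measure E} {g u : E → ℝ}
    (hg : MemLp g ∞ μ) (hu : MemLp u 1 μ) : Integrable (fun x => g x * u x) μ :=
  MemLp.integrable_mul (p := ∞) (q := 1) hg hu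

theorem tendsto_integral_mul {E : Type*} [MeasurableSpace E] {μ : Measure E} {g u : E → ℝ}
    {us : ℕ → E → ℝ} (hg : MemLp g ∞ μ) (hus : ∀ n, MemLp (us n) 1 μ) (hu : MemLp u 1 μ)
    (h : Tendsto (fun n => eLpNorm (us n - u) 1 μ) atTop (𝓝 0)) :
    Tendsto (fun n => ∫ x, g x * us n x ∂μ) atTop (𝓝 (∫ x, g x * u x ∂μ)) := by
  have h' := ENNReal.Tendsto.const_mul h (Or.inr hg.2.ne)
  rw [mul_zero] at h'
  rw [tendsto_iff_edist_tendsto_0]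
  refine tendsto_of_tendsto_of_tendsto_of_le_of_le tendsto_const_nhds h' (fun _ => zero_le)
    fun n => ?_
  rw [edist_eq_enorm_sub, ← integral_sub (hg.integrable_mul_top_one (hus n))
    (hg.integrable_mul_top_one hu)]
  simp only [← mul_sub]
  exact enorm_integral_mul_le hg.1 ((hus n).1.sub hu.1)

theorem IsDualitySolution.sub {f f' u u' : EuclideanSpace ℝ (Fin N) → ℝ}
    (hf : MemLp f 1 (volume.restrict Ω)) (hf' : MemLp f' 1 (volume.restrict Ω))
    (hu : IsDualitySolution X Ω A f u) (hu' : IsDualitySolution X Ω A f' u') :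
    IsDualitySolution X Ω A (f - f') (u - u') := by
  refine ⟨hu.1.sub hu'.1, fun g hg v hv hw => ?_⟩
  simp only [Pi.sub_apply, mul_sub, sub_mul]
  rw [integral_sub (hg.integrable_mul_top_one hu.1) (hg.integrable_mul_top_one hu'.1),
    integral_sub, hu.2 g hg v hv hw, hu'.2 g hg v hv hw]
  · simpa only [mul_comm] using hv.integrable_mul_top_one hf
  · simpa only [mul_comm] using hv.integrable_mul_top_one hf'

theorem SobolevSetting.memLp_of_memLp_top (hS : SobolevSetting X Ω Q)
    {g : EuclideanSpace ℝ (Fin N) → ℝ} (hg : MemLp g ∞ (volume.restrict Ω)) (q : ℝ≥0∞) :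
    MemLp g q (volume.restrict Ω) :=
  have := hS.isFiniteMeasure
  hg.mono_exponent le_top

theorem SobolevSetting.memLp_one (hS : SobolevSetting X Ω Q) {f : EuclideanSpace ℝ (Fin N) → ℝ}
    (hf : MemLp f (ENNReal.ofReal (2 * Q / (Q + 2))) (volume.restrict Ω)) :
    MemLp f 1 (volume.restrict Ω) := by
  have := hS.isFiniteMeasure
  have hQ := hS.two_lt
  refine hf.mono_exponent ?_
  rw [ENNReal.one_le_ofReal, le_div_iff₀ (by linarith)]
  linarith

/-- Each equation is tested with the solution of the other; transposing the matrix makes the two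
left-hand sides equal. -/
theorem IsWeakSolution.isDualitySolution (hS : SobolevSetting X Ω Q)
    {f u : EuclideanSpace ℝ (Fin N) → ℝ} (hu : IsWeakSolution X Ω A f u) :
    IsDualitySolution X Ω A f u := by
  have := hS.isFiniteMeasure
  obtain ⟨G, hG, h1⟩ := hu
  refine ⟨hG.1.mono_exponent one_le_two, fun g _ v _ hv => ?_⟩
  obtain ⟨H, hH, h2⟩ := hv
  rw [← h1 v H hH, ← h2 u G hG]
  refine integral_congr_ae (Eventually.of_forall fun x => ?_)
  simp only
  rw [mulVec_transpose, ← dotProduct_mulVec, dotProduct_comm]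

/-- The a priori estimate of duality solutions in `L^q`. -/
theorem exists_eLpNorm_le_of_isDualitySolution_of_one_lt (hS : SobolevSetting X Ω Q)
    (hA : IsElliptic Ω A α β) {q : ℝ} (hq1 : 1 < q) (hq : q < Q / (Q - 2)) :
    ∃ C : ℝ≥0∞, C ≠ ⊤ ∧ ∀ f u, MemLp f 1 (volume.restrict Ω) → IsDualitySolution X Ω A f u →
      eLpNorm u (ENNReal.ofReal q) (volume.restrict Ω) ≤ C * eLpNorm f 1 (volume.restrict Ω) := by
  have := hS.isFiniteMeasure
  have hQ := hS.two_lt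
  have hq0 : 0 < q - 1 := by linarith
  -- The conjugate exponent: `q < Q/(Q-2)` is equivalent to `p > Q/2`, which the bound for the
  -- adjoint problem requires.
  set p := q / (q - 1) with hp
  have hp0 : 0 < p := by positivity
  have hpQ : Q / 2 < p := by
    rw [lt_div_iff₀ (by linarith)] at hq
    rw [hp, div_lt_div_iff₀ two_pos hq0]
    nlinarith
  obtain ⟨K, hK, hle⟩ := exists_eLpNorm_top_le hS hA.transpose hpQ
  refine ⟨K, hK, fun f u hf hu => ?_⟩
  set μ := volume.restrict Ω with hμ
  have hum : AEStronglyMeasurable u μ := hu.1.1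
  -- truncations
  set t : ℕ → ℝ → ℝ := fun n s => min |s| n with ht
  have ht0 : ∀ n s, 0 ≤ t n s := fun n s => le_min (abs_nonneg _) n.cast_nonneg
  have htm : ∀ n, Measurable (t n) := fun n => by fun_prop
  have htop : ∀ n, MemLp (fun x => t n (u x)) ∞ μ := fun n =>
    memLp_top_of_bound ((htm n).comp_aemeasurable hum.aemeasurable).aestronglyMeasurable n
      (Eventually.of_forall fun x => by
        rw [Real.norm_of_nonneg (ht0 _ _)]
        exact min_le_right _ _)
  have htb : ∀ n, eLpNorm (fun x => t n (u x)) (ENNReal.ofReal q) μ ≤ K * eLpNorm f 1 μ := by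
    intro n
    have htq : MemLp _ _ μ := hS.memLp_of_memLp_top (htop n) (ENNReal.ofReal q)
    -- The dual datum for the `L^q` norm of the truncation: `|ψ|^p = t^q`, and `ψ(s) s ≥ t^q`
    -- because truncating only lowers `|s|`. It is bounded, hence admissible.
    set ψ : ℝ → ℝ := fun s => if 0 ≤ s then t n s ^ (q - 1) else -(t n s ^ (q - 1)) with hψ
    have hψm : Measurable ψ := Measurable.ite measurableSet_Ici ((htm n).pow_const _)
      ((htm n).pow_const _).neg
    have hψa : ∀ s, |ψ s| = t n s ^ (q - 1) := fun s => by
      have := Real.rpow_nonneg (ht0 n s) (q - 1)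
      by_cases h : 0 ≤ s <;> simp [hψ, h, abs_of_nonneg this]
    have hψs : ∀ s, t n s ^ q ≤ ψ s * s := fun s => by
      have h1 := Real.rpow_nonneg (ht0 n s) (q - 1)
      have h2 : ψ s * s = t n s ^ (q - 1) * |s| := by
        by_cases h : 0 ≤ s
        · simp [hψ, h, abs_of_nonneg h]
        · simp [hψ, h, abs_of_neg (not_le.1 h)]
      have h3 : t n s ^ q = t n s ^ (q - 1) * t n s := by
        rw [← Real.rpow_add_one' (ht0 n s) (by linarith)]
        congr 1; ring
      rw [h2, h3]
      exact mul_le_mul_of_nonneg_left (min_le_left _ _) h1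
    set g : EuclideanSpace ℝ (Fin N) → ℝ := fun x => ψ (u x) with hg
    have hgt : MemLp g ∞ μ :=
      memLp_top_of_bound (hψm.comp_aemeasurable hum.aemeasurable).aestronglyMeasurable
        ((n : ℝ) ^ (q - 1)) (Eventually.of_forall fun x => by
          rw [Real.norm_eq_abs, hg, hψa]
          exact Real.rpow_le_rpow (ht0 _ _) (min_le_right _ _) hq0.le)
    have hgp : MemLp _ _ μ := hS.memLp_of_memLp_top hgt (ENNReal.ofReal p)
    obtain ⟨v, hv⟩ := exists_isWeakSolution hS hA.transpose
      (hS.memLp_of_memLp_top hgt (ENNReal.ofReal (2 * Q / (Q + 2))))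
    have hvle := hle g v hgt hv
    have hv1 : AEStronglyMeasurable v μ := by
      obtain ⟨_, h, _⟩ := hv
      exact h.1.1
    have hvt : MemLp v ∞ μ := ⟨hv1, hvle.trans_lt (ENNReal.mul_lt_top hK.lt_top hgp.2)⟩
    have hdual := hu.2 g hgt v hvt hv
    set J := ∫ x, t n (u x) ^ q ∂μ with hJ
    have hJ0 : 0 ≤ J := integral_nonneg fun x => Real.rpow_nonneg (ht0 _ _) _
    have hnt : eLpNorm (fun x => t n (u x)) (ENNReal.ofReal q) μ = ENNReal.ofReal (J ^ q⁻¹) := by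
      rw [htq.eLpNorm_eq_integral_rpow_norm (by simp; linarith) ENNReal.ofReal_ne_top,
        ENNReal.toReal_ofReal (by linarith)]
      simp only [Real.norm_of_nonneg (ht0 _ _), hJ]
    have hng : eLpNorm g (ENNReal.ofReal p) μ = ENNReal.ofReal (J ^ p⁻¹) := by
      rw [hgp.eLpNorm_eq_integral_rpow_norm (by simp; linarith) ENNReal.ofReal_ne_top,
        ENNReal.toReal_ofReal hp0.le]
      have : ∀ x, ‖g x‖ ^ p = t n (u x) ^ q := fun x => by
        rw [Real.norm_eq_abs, hg, hψa, ← Real.rpow_mul (ht0 _ _)]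
        congr 1
        rw [hp]; field_simp
      simp only [this, hJ]
    have hJle : ENNReal.ofReal J ≤ K * eLpNorm f 1 μ * ENNReal.ofReal (J ^ p⁻¹) := by
      have h1 : J ≤ ∫ x, g x * u x ∂μ := by
        refine integral_mono_of_nonneg (Eventually.of_forall fun x => Real.rpow_nonneg (ht0 _ _) _)
          (hgt.integrable_mul_top_one hu.1) (Eventually.of_forall fun x => hψs (u x))
      have h2 : ∫ x, g x * u x ∂μ = ∫ x, v x * f x ∂μ := by
        simpa only [mul_comm] using hdual
      calc ENNReal.ofReal J ≤ ENNReal.ofReal ‖∫ x, v x * f x ∂μ‖ :=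
            ENNReal.ofReal_le_ofReal (h1.trans (h2 ▸ le_abs_self _))
        _ = ‖∫ x, v x * f x ∂μ‖ₑ := ofReal_norm _
        _ ≤ eLpNorm v ∞ μ * eLpNorm f 1 μ := enorm_integral_mul_le hv1 hf.1
        _ ≤ (K * ENNReal.ofReal (J ^ p⁻¹)) * eLpNorm f 1 μ := by
            gcongr
            exact hng ▸ hvle
        _ = _ := by ring
    rw [hnt]
    -- Truncation has made `J` a genuine finite integral, so `J ≤ K ‖f‖_1 J^{1/p}` may be divided by
    -- `J^{1/p}`, leaving `J^{1/q}`.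
    rcases hJ0.eq_or_lt with h0 | h0
    · rw [← h0, Real.zero_rpow (by positivity)]
      simp
    · have hsplit : J = J ^ q⁻¹ * J ^ p⁻¹ := by
        rw [← Real.rpow_add h0]
        have : q⁻¹ + p⁻¹ = 1 := by
          rw [hp]; field_simp; ring
        rw [this, Real.rpow_one]
      have hpos : 0 < J ^ p⁻¹ := Real.rpow_pos_of_pos h0 _
      rw [hsplit, ENNReal.ofReal_mul (by positivity), ← hsplit] at hJle
      exact (ENNReal.mul_le_mul_iff_left (ENNReal.ofReal_pos.2 hpos).ne' ENNReal.ofReal_ne_top).1 hJle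
  have hlim : ∀ᵐ x ∂μ, Tendsto (fun n => t n (u x)) atTop (𝓝 |u x|) := by
    refine Eventually.of_forall fun x => tendsto_const_nhds.congr' ?_
    filter_upwards [tendsto_natCast_atTop_atTop.eventually_ge_atTop |u x|] with n hn
    exact (min_eq_left hn).symm
  have h5 := Lp.eLpNorm_lim_le_liminf_eLpNorm (p := ENNReal.ofReal q) (fun n => (htop n).1)
    (fun x => |u x|) hlim
  have h6 : eLpNorm (fun x => |u x|) (ENNReal.ofReal q) μ = eLpNorm u (ENNReal.ofReal q) μ :=
    eLpNorm_norm u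
  rw [h6] at h5
  refine h5.trans ((liminf_le_liminf (Eventually.of_forall htb)).trans_eq ?_)
  exact liminf_const _

/-- The measure is finite, so exponents `q ≤ 1` follow from any exponent between `max 1 q` and
`Q/(Q-2)`. -/
theorem exists_eLpNorm_le_of_isDualitySolution (hS : SobolevSetting X Ω Q)
    (hA : IsElliptic Ω A α β) {q : ℝ≥0∞} (hq : q < ENNReal.ofReal (Q / (Q - 2))) :
    ∃ C : ℝ≥0∞, C ≠ ⊤ ∧ ∀ f u, MemLp f 1 (volume.restrict Ω) → IsDualitySolution X Ω A f u →
      eLpNorm u q (volume.restrict Ω) ≤ C * eLpNorm f 1 (volume.restrict Ω) := by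
  have := hS.isFiniteMeasure
  have hQ := hS.two_lt
  have hQ2 : 0 < Q - 2 := by linarith
  have hs : 1 < Q / (Q - 2) := by rw [lt_div_iff₀ hQ2]; linarith
  have hqt : q ≠ ⊤ := (hq.trans ENNReal.ofReal_lt_top).ne
  rcases eq_or_ne q 0 with rfl | hq0
  · exact ⟨0, by simp, by simp⟩
  have hqr : q.toReal < Q / (Q - 2) := (ENNReal.lt_ofReal_iff_toReal_lt hqt).1 hq
  obtain ⟨r, hr1, hr2⟩ := exists_between (max_lt hs hqr)
  obtain ⟨C, hC, hle⟩ := exists_eLpNorm_le_of_isDualitySolution_of_one_lt hS hA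
    ((le_max_left _ _).trans_lt hr1) hr2
  have hqr' : q.toReal ≤ r := (le_max_right _ _).trans hr1.le
  have hqle : q ≤ ENNReal.ofReal r := by
    rw [← ENNReal.ofReal_toReal hqt]
    exact ENNReal.ofReal_le_ofReal hqr'
  refine ⟨C * volume.restrict Ω univ ^ (1 / q.toReal - 1 / (ENNReal.ofReal r).toReal),
    ENNReal.mul_ne_top hC (ENNReal.rpow_ne_top_of_nonneg ?_ (measure_ne_top _ _)),
    fun f u hf hu => ?_⟩
  · rw [ENNReal.toReal_ofReal (ENNReal.toReal_nonneg.trans hqr')]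
    exact sub_nonneg.2 (one_div_le_one_div_of_le (ENNReal.toReal_pos hq0 hqt) hqr')
  · refine (eLpNorm_le_eLpNorm_mul_rpow_measure_univ hqle hu.1.1).trans ?_
    rw [mul_right_comm]
    gcongr
    exact hle f u hf hu

theorem SobolevSetting.one_lt_exponent (hS : SobolevSetting X Ω Q) :
    1 < ENNReal.ofReal (Q / (Q - 2)) := by
  have hQ := hS.two_lt
  rw [← ENNReal.ofReal_one, ENNReal.ofReal_lt_ofReal_iff_of_nonneg zero_le_one,
    lt_div_iff₀ (by linarith)]
  linarith

/-- The difference is a duality solution with datum zero, and the a priori estimate at `q = 1` kills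
it. -/
theorem IsDualitySolution.ae_eq (hS : SobolevSetting X Ω Q) (hA : IsElliptic Ω A α β)
    {f u w : EuclideanSpace ℝ (Fin N) → ℝ} (hf : MemLp f 1 (volume.restrict Ω))
    (hu : IsDualitySolution X Ω A f u) (hw : IsDualitySolution X Ω A f w) :
    u =ᵐ[volume.restrict Ω] w := by
  obtain ⟨C, _, hle⟩ := exists_eLpNorm_le_of_isDualitySolution hS hA hS.one_lt_exponent
  have h1 := hle _ _ (hf.sub hf) (hu.sub hf hf hw)
  rw [sub_self, eLpNorm_zero, mul_zero, nonpos_iff_eq_zero,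
    eLpNorm_eq_zero_iff (hu.1.1.sub hw.1.1) one_ne_zero] at h1
  filter_upwards [h1] with x hx
  exact sub_eq_zero.1 hx

/-- An `L^1` limit of duality solutions is a duality solution. -/
theorem IsDualitySolution.of_tendsto {f u : EuclideanSpace ℝ (Fin N) → ℝ}
    {fs us : ℕ → EuclideanSpace ℝ (Fin N) → ℝ} (hf : MemLp f 1 (volume.restrict Ω))
    (hu : MemLp u 1 (volume.restrict Ω)) (hfs : ∀ n, MemLp (fs n) 1 (volume.restrict Ω))
    (hus : ∀ n, IsDualitySolution X Ω A (fs n) (us n))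
    (h1 : Tendsto (fun n => eLpNorm (fs n - f) 1 (volume.restrict Ω)) atTop (𝓝 0))
    (h2 : Tendsto (fun n => eLpNorm (us n - u) 1 (volume.restrict Ω)) atTop (𝓝 0)) :
    IsDualitySolution X Ω A f u := by
  refine ⟨hu, fun g hg v hv hw => ?_⟩
  have l1 := tendsto_integral_mul hg (fun n => (hus n).1) hu h2
  have l2 := tendsto_integral_mul hv hfs hf h1
  simp only [fun n => (hus n).2 g hg v hv hw, mul_comm (fs _ _)] at l1
  rw [tendsto_nhds_unique l1 l2]
  simp only [mul_comm]

/-- Simple functions are dense in `L^1` and, on a set of finite measure, lie in every `L^q`. -/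
theorem exists_isApproxData (hS : SobolevSetting X Ω Q) {f : EuclideanSpace ℝ (Fin N) → ℝ}
    (hf : MemLp f 1 (volume.restrict Ω)) : ∃ fs, IsApproxData Ω Q f fs := by
  have := hS.isFiniteMeasure
  have h : ∀ n : ℕ, ∃ g : SimpleFunc (EuclideanSpace ℝ (Fin N)) ℝ,
      eLpNorm (f - ⇑g) 1 (volume.restrict Ω) < (n : ℝ≥0∞)⁻¹ ∧ MemLp g 1 (volume.restrict Ω) :=
    fun n => hf.exists_simpleFunc_eLpNorm_sub_lt ENNReal.one_ne_top (by simp)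
  choose g hg _ using h
  refine ⟨fun n => g n, fun n => SimpleFunc.memLp_of_isFiniteMeasure _ _ _, ?_⟩
  refine tendsto_of_tendsto_of_tendsto_of_le_of_le tendsto_const_nhds
    ENNReal.tendsto_inv_nat_nhds_zero (fun _ => zero_le) fun n => ?_
  rw [eLpNorm_sub_comm]
  exact (hg n).le

/-- The a priori estimate applied to differences makes the approximate solutions Cauchy in `L^1`,
and duality passes to the limit. -/
theorem exists_isDualitySolution (hS : SobolevSetting X Ω Q) (hA : IsElliptic Ω A α β)
    {f : EuclideanSpace ℝ (Fin N) → ℝ} (hf : MemLp f 1 (volume.restrict Ω)) :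
    ∃ u, IsDualitySolution X Ω A f u := by
  obtain ⟨fs, hfs, hlim⟩ := exists_isApproxData hS hf
  have hfs1 := fun n => hS.memLp_one (hfs n)
  choose us hus using fun n => exists_isWeakSolution hS hA (hfs n)
  have hd := fun n => (hus n).isDualitySolution hS
  obtain ⟨C, hC, hle⟩ := exists_eLpNorm_le_of_isDualitySolution hS hA hS.one_lt_exponent
  have hcau : CauchySeq fun n => (hd n).1.toLp := by
    rw [Lp.cauchySeq_Lp_iff_cauchySeq_eLpNorm]
    have h1 : Tendsto (fun n : ℕ × ℕ => C * (eLpNorm (fs n.1 - f) 1 (volume.restrict Ω) +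
        eLpNorm (fs n.2 - f) 1 (volume.restrict Ω))) atTop (𝓝 0) := by
      have := (hlim.comp (tendsto_fst.mono_left prod_atTop_atTop_eq.ge)).add
        (hlim.comp (tendsto_snd.mono_left prod_atTop_atTop_eq.ge))
      rw [add_zero] at this
      simpa [Function.comp_def] using ENNReal.Tendsto.const_mul this (Or.inr hC)
    refine tendsto_of_tendsto_of_tendsto_of_le_of_le tendsto_const_nhds h1 (fun _ => zero_le)
      fun n => ?_
    rw [eLpNorm_congr_ae ((hd n.1).1.coeFn_toLp.sub (hd n.2).1.coeFn_toLp)]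
    refine (hle _ _ ((hfs1 n.1).sub (hfs1 n.2))
      ((hd n.1).sub (hfs1 n.1) (hfs1 n.2) (hd n.2))).trans ?_
    gcongr
    rw [← sub_sub_sub_cancel_right (fs n.1) (fs n.2) f]
    exact eLpNorm_sub_le ((hfs1 n.1).1.sub hf.1) ((hfs1 n.2).1.sub hf.1) le_rfl
  obtain ⟨u, hu⟩ := cauchySeq_tendsto_of_complete hcau
  refine ⟨u, IsDualitySolution.of_tendsto hf (Lp.memLp u) hfs1 hd hlim ?_⟩
  refine ((Lp.tendsto_Lp_iff_tendsto_eLpNorm' _ _).1 hu).congr fun n => ?_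
  exact eLpNorm_congr_ae ((hd n).1.coeFn_toLp.sub EventuallyEq.rfl)

/-- Since `u_n - u` is a duality solution with datum `f_n - f`, the estimate gives the convergence
with no compactness and no subsequence. -/
theorem tendsto_eLpNorm_sub_of_isApproxData (hS : SobolevSetting X Ω Q) (hA : IsElliptic Ω A α β)
    {f u : EuclideanSpace ℝ (Fin N) → ℝ} (hf : MemLp f 1 (volume.restrict Ω))
    (hu : IsDualitySolution X Ω A f u) {fs us : ℕ → EuclideanSpace ℝ (Fin N) → ℝ}
    (hfs : IsApproxData Ω Q f fs) (hus : ∀ n, IsWeakSolution X Ω A (fs n) (us n)) {q : ℝ≥0∞}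
    (hq : q < ENNReal.ofReal (Q / (Q - 2))) :
    Tendsto (fun n => eLpNorm (us n - u) q (volume.restrict Ω)) atTop (𝓝 0) := by
  obtain ⟨C, hC, hle⟩ := exists_eLpNorm_le_of_isDualitySolution hS hA hq
  have hfs1 := fun n => hS.memLp_one (hfs.1 n)
  refine tendsto_of_tendsto_of_tendsto_of_le_of_le tendsto_const_nhds
    (by simpa using ENNReal.Tendsto.const_mul hfs.2 (Or.inr hC)) (fun _ => zero_le) fun n => ?_
  exact hle _ _ ((hfs1 n).sub hf) (((hus n).isDualitySolution hS).sub (hfs1 n) hf hu)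

/-- An `L^1` limit of weak solutions is a duality solution, hence equals `u`; conversely, any
approximating sequence leads to `u`. -/
theorem isSolutionByApproximation_iff (hS : SobolevSetting X Ω Q) (hA : IsElliptic Ω A α β)
    {f u : EuclideanSpace ℝ (Fin N) → ℝ} (hf : MemLp f 1 (volume.restrict Ω))
    (hu : IsDualitySolution X Ω A f u) (w : EuclideanSpace ℝ (Fin N) → ℝ) :
    IsSolutionByApproximation X Ω A Q f w ↔ w =ᵐ[volume.restrict Ω] u := by
  constructor
  · rintro ⟨hw, fs, us, hfs, hus, hlim⟩
    exact (IsDualitySolution.of_tendsto hf hw (fun n => hS.memLp_one (hfs.1 n))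
      (fun n => (hus n).isDualitySolution hS) hfs.2 hlim).ae_eq hS hA hf hu
  · intro hw
    obtain ⟨fs, hfs⟩ := exists_isApproxData hS hf
    choose us hus using fun n => exists_isWeakSolution hS hA (hfs.1 n)
    refine ⟨hu.1.ae_eq hw.symm, fs, us, hfs, hus, ?_⟩
    refine (tendsto_eLpNorm_sub_of_isApproxData hS hA hf hu hfs hus hS.one_lt_exponent).congr
      fun n => ?_
    exact eLpNorm_congr_ae (EventuallyEq.rfl.sub hw.symm)

end

end XElliptic

end

/-! ### The main theorem -/

theorem theorem5p2 {N m : ℕ} (hN : 2 ≤ N)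
    -- the bounded open set, the vector fields and the geometric assumptions
    (Ω : Set (EuclideanSpace ℝ (Fin N))) (hΩ : IsOpen Ω) (hΩb : Bornology.IsBounded Ω)
    (X : XElliptic.VectorFields N m) (hX : ∀ j, LocallyLipschitz (X j))
    (D : Set (EuclideanSpace ℝ (Fin N))) (hD : D = Ω ∨ D = Set.univ)
    (Q : ℝ) (hQ : 2 < Q) (hgeo : XElliptic.GeometricAssumptions X D Q)
    -- the coefficient matrix
    (A : EuclideanSpace ℝ (Fin N) → Matrix (Fin m) (Fin m) ℝ)
    (hAmeas : ∀ i j, Measurable fun x => A x i j)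
    (α β : ℝ) (hα : 0 < α) (hαβ : α < β)
    (hAell : ∀ x ∈ Ω, ∀ η : EuclideanSpace ℝ (Fin m),
      α * ‖η‖ ^ 2 ≤ (A x *ᵥ η.ofLp) ⬝ᵥ η.ofLp)
    (hAbdd : ∀ x ∈ Ω, ∀ η : EuclideanSpace ℝ (Fin m),
      ‖WithLp.toLp 2 (A x *ᵥ η.ofLp)‖ ≤ β * ‖η‖)
    -- the datum
    (f : EuclideanSpace ℝ (Fin N) → ℝ) (hf : MemLp f 1 (volume.restrict Ω)) :
    -- the adjoint problems with bounded data are well posed, with bounded solutions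
    (∀ g, MemLp g ∞ (volume.restrict Ω) →
      ∃ v, XElliptic.IsWeakSolution X Ω (fun x => (A x)ᵀ) g v ∧
        MemLp v ∞ (volume.restrict Ω) ∧
        ∀ w, XElliptic.IsWeakSolution X Ω (fun x => (A x)ᵀ) g w →
          w =ᵐ[volume.restrict Ω] v) ∧
    -- there is a unique duality solution `u`
    ∃ u, XElliptic.IsDualitySolution X Ω A f u ∧
      (∀ w, XElliptic.IsDualitySolution X Ω A f w → w =ᵐ[volume.restrict Ω] u) ∧
      -- it is in `L^q` for all `q < Q / (Q - 2)`
      (∀ q : ℝ≥0∞, q < ENNReal.ofReal (Q / (Q - 2)) → MemLp u q (volume.restrict Ω)) ∧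
      -- it is exactly the solution found by approximation
      (∀ w, XElliptic.IsSolutionByApproximation X Ω A Q f w ↔ w =ᵐ[volume.restrict Ω] u) ∧
      -- and every approximating sequence leads to it
      (∀ fs, XElliptic.IsApproxData Ω Q f fs →
        (∀ n, ∃ w, XElliptic.IsWeakSolution X Ω A (fs n) w) ∧
        ∀ us : ℕ → EuclideanSpace ℝ (Fin N) → ℝ,
          (∀ n, XElliptic.IsWeakSolution X Ω A (fs n) (us n)) →
          ∀ q : ℝ≥0∞, q < ENNReal.ofReal (Q / (Q - 2)) →
            Tendsto (fun n => eLpNorm (us n - u) q (volume.restrict Ω)) atTop (𝓝 0)) := by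
  have hS : XElliptic.SobolevSetting X Ω Q :=
    ⟨hX, hΩ, hΩb, hQ, hgeo.hasSobolev hN hΩ hΩb hX hD hQ⟩
  have hA : XElliptic.IsElliptic Ω A α β :=
    ⟨hAmeas, hα, (hα.trans hαβ).le, hAell, hAbdd⟩
  refine ⟨fun g hg => ?_, ?_⟩
  · obtain ⟨v, hv⟩ := XElliptic.exists_isWeakSolution hS hA.transpose
      (hS.memLp_of_memLp_top hg _)
    -- For bounded data any exponent above `Q/2` serves; `Q` is one.
    obtain ⟨K, hK, hle⟩ := XElliptic.exists_eLpNorm_top_le hS hA.transpose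
      (show Q / 2 < Q by linarith)
    refine ⟨v, hv, ⟨?_, (hle g v hg hv).trans_lt
      (ENNReal.mul_lt_top hK.lt_top (hS.memLp_of_memLp_top hg _).2)⟩,
      fun w hw => hw.ae_eq hS hA.transpose hv⟩
    obtain ⟨_, h, _⟩ := hv
    exact h.1.1
  · obtain ⟨u, hu⟩ := XElliptic.exists_isDualitySolution hS hA hf
    refine ⟨u, hu, fun w hw => hw.ae_eq hS hA hf hu, fun q hq => ?_,
      XElliptic.isSolutionByApproximation_iff hS hA hf hu, fun fs hfs =>
      ⟨fun n => XElliptic.exists_isWeakSolution hS hA (hfs.1 n), fun us hus q hq =>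
        XElliptic.tendsto_eLpNorm_sub_of_isApproxData hS hA hf hu hfs hus hq⟩⟩
    obtain ⟨C, hC, hle⟩ := XElliptic.exists_eLpNorm_le_of_isDualitySolution hS hA hq
    exact ⟨hu.1.1, (hle f u hf hu).trans_lt (ENNReal.mul_lt_top hC.lt_top hf.2)⟩
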